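/- **Theorem (Hirota bilinear form of the periodic non-chiral ILW equation).** Let $L>0$, $\delta>0$. For $\delta'>0$ put $$\zeta_1(z|L/2,\mathrm i\delta')=\frac{\pi}{L}\lim_{M\to\infty}\sum_{n=-M}^{M}\cot\Big(\frac{\pi}{L}(z-2\mathrm i n\delta')\Big),$$ and for $L$-periodic $f:\mathbb R\to\mathbb C$ put $$(Tf)(x)=\frac1\pi\,\mathrm{p.v.}\!\!\int_{-L/2}^{L/2}\zeta_1(x'-x|L/2,\mathrm i\delta)f(x')\,\mathrm dx',\qquad (\tilde Tf)(x)=\frac1\pi\int_{-L/2}^{L/2}\zeta_1(x'-x+\mathrm i\delta|L/2,\mathrm i\delta)f(x')\,\mathrm dx'.$$ The periodic non-chiral ILW (ncILW) equation for $u,v:\mathbb R^2\to\mathbb C$ is $$u_t+2uu_x+Tu_{xx}+\tilde Tv_{xx}=0,\qquad v_t-2vv_x-Tv_{xx}-\tilde Tu_{xx}=0 .$$ For a function $F(z,t)$ write $F^\pm(x,t)=F(x\pm\mathrm i\delta/2,t)$, and let $D_xf\cdot g=f_xg-fg_x$, $D_x^2f\cdot g=f_{xx}g-2f_xg_x+fg_{xx}$,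 $D_tf\cdot g=f_tg-fg_t$. For $\bar u,\bar v\in\mathbb C$ and $\lambda_1,\lambda_2:\mathbb R\to\mathbb C$ the Hirota system is $$\big(\mathrm iD_t-D_x^2+2\mathrm i\bar uD_x-\lambda_1(t)+\bar u^2\big)F^-\cdot G^+=0,\qquad \big(\mathrm iD_t-D_x^2-2\mathrm i\bar vD_x-\lambda_2(t)+\bar v^2\big)F^+\cdot G^-=0. \tag{H}$$ **(A)** Let $F(z,t)$, $G(z,t)$ be $L$-periodic in $z$ such that, for every $t\in\mathbb R$, $\log F(\cdot,t)$ and $\log G(\cdot,t)$ are analytic for $|\mathrm{Im}\,z|<\delta/2$ and continuous for $|\mathrm{Im}\,z|\le\delta/2$, and such that $F^\pm,G^\pm$ are $C^4$ functions of $(x,t)\in\mathbb R^2$. Let $\bar u,\bar v\in\mathbb C$. Then there are functions $\lambda_1,\lambda_2:\mathbb R\to\mathbb C$ such that $F,G$ satisfy (H) if and only if $$u=\bar u+\mathrm i\,\partial_x\log\frac{F^-}{G^+},\qquad v=\bar v+\mathrm i\,\partial_x\log\frac{G^-}{F^+}\tag{1}$$ satisfy the ncILW equation. **(B)** Let $u,v$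 be solutions of the ncILW equation of class $C^3$ on $\mathbb R^2$ and $L$-periodic in $x$, and let $\bar u,\bar v$ be their spatial means over a period at $t=0$. Then $\bar u,\bar v$ are their means at every time $t$. Put $$u_\pm=\tfrac12(u-\bar u)\mp\tfrac{\mathrm i}{2}\big(T(u-\bar u)+\tilde T(v-\bar v)\big),\qquad v_\pm=\tfrac12(v-\bar v)\pm\tfrac{\mathrm i}{2}\big(T(v-\bar v)+\tilde T(u-\bar u)\big).$$ There are $F(z,t)$, $G(z,t)$ such that, for every $t$, $\log F(\cdot,t)$ and $\log G(\cdot,t)$ are analytic for $|\mathrm{Im}\,z|<\delta/2$, continuous for $|\mathrm{Im}\,z|\le\delta/2$, and, for $|\mathrm{Im}\,z|<\delta/2$, $$\mathrm i\,\partial_z\log F(z,t)=\frac1{2\pi\mathrm i}\int_{-L/2}^{L/2}\zeta_1\big(x'-z-\tfrac{\mathrm i\delta}2\big|L/2,\tfrac{\mathrm i\delta}2\big)\,(u_++v_+)(x',t)\,\mathrm dx',$$ $$\mathrm i\,\partial_z\log G(z,t)=\frac1{2\pi\mathrm i}\int_{-L/2}^{L/2}\zeta_1\big(x'-z-\tfrac{\mathrm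 i\delta}2\big|L/2,\tfrac{\mathrm i\delta}2\big)\,(u_-+v_-)(x',t)\,\mathrm dx'.$$ They can be chosen with arbitrary non-vanishing values $F(0,t)$, $G(0,t)$, and each is unique for $|\mathrm{Im}\,z|\le\delta/2$ up to multiplication by a non-vanishing function of $t$. For every such pair with $F(0,t)$, $G(0,t)$ differentiable in $t$: $F$ and $G$ are $L$-periodic for $|\mathrm{Im}\,z|\le\delta/2$; $F^\pm,G^\pm$ are $C^2$ in $x$ and differentiable in $t$; $u_+-u_-$ and $v_+-v_-$ are differentiable in $x$; (1) holds; the expressions $$\lambda_1=\mathrm i\Big(\log\frac{F^-}{G^+}\Big)_t+u^2+\mathrm i(u_+-u_-)_x,\qquad \lambda_2=\mathrm i\Big(\log\frac{F^+}{G^-}\Big)_t+v^2-\mathrm i(v_+-v_-)_x$$ depend on $t$ only; and (H) holds with these $\lambda_1,\lambda_2$. -/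

import Mathlib

open Complex Filter Topology
open scoped Real

namespace NcILW

noncomputable section

/-- The modified Weierstrass zeta function `ζ₁(z | L/2, iδ)`, with periods `L` and `2iδ`:
`(π/L) lim_{M → ∞} ∑_{n=-M}^{M} cot ((π/L) (z - 2 i n δ))`. -/
def zeta1 (L δ : ℝ) (z : ℂ) : ℂ :=
  (π / L : ℂ) * limUnder atTop (fun M : ℕ =>
    ∑ n ∈ Finset.Icc (-(M : ℤ)) (M : ℤ), Complex.cot ((π / L : ℂ) * (z - 2 * I * n * δ)))

/-- Truncated integral for the principal value in `T`. The arguments `f` of `T` are `L`-periodic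
and `ζ₁` has period `L`, so the integral over `[-L/2, L/2]` (a full period of the circle) is
written over the period `[x - L/2, x + L/2]` centred at the pole. -/
def truncT (L δ : ℝ) (f : ℝ → ℂ) (x ε : ℝ) : ℂ :=
  (1 / π : ℂ) * ((∫ y in (x - L / 2)..(x - ε), zeta1 L δ ((y - x : ℝ) : ℂ) * f y) +
    ∫ y in (x + ε)..(x + L / 2), zeta1 L δ ((y - x : ℝ) : ℂ) * f y)

/-- The principal value integral that defines `(T f)(x)` converges. -/
def TConverges (L δ : ℝ) (f : ℝ → ℂ) (x : ℝ) : Prop :=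
  ∃ l : ℂ, Tendsto (truncT L δ f x) (𝓝[>] 0) (𝓝 l)

/-- `(T f)(x) = (1/π) p.v.∫ ζ₁(x' - x | L/2, iδ) f(x') dx'`. -/
def opT (L δ : ℝ) (f : ℝ → ℂ) (x : ℝ) : ℂ :=
  limUnder (𝓝[>] (0 : ℝ)) (truncT L δ f x)

/-- `(T̃ f)(x) = (1/π) ∫ ζ₁(x' - x + iδ | L/2, iδ) f(x') dx'`. -/
def opTt (L δ : ℝ) (f : ℝ → ℂ) (x : ℝ) : ℂ :=
  (1 / π : ℂ) * ∫ y in (-(L / 2))..(L / 2), zeta1 L δ (((y - x : ℝ) : ℂ) + I * δ) * f y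

/-- The spatial mean over one period. -/
def mean (L : ℝ) (f : ℝ → ℂ) : ℂ := (1 / L : ℂ) * ∫ x in (-(L / 2))..(L / 2), f x

/-- First and second spatial derivatives and the time derivative of `u = u(x, t)`. -/
def dx (u : ℝ → ℝ → ℂ) (x t : ℝ) : ℂ := deriv (fun y => u y t) x

/-- Second spatial derivative. -/
def dxx (u : ℝ → ℝ → ℂ) (x t : ℝ) : ℂ := deriv (fun y => dx u y t) x

/-- Time derivative. -/
def dt (u : ℝ → ℝ → ℂ) (x t : ℝ) : ℂ := deriv (fun s => u x s) t

/-- `(u, v)` satisfies the ncILW equation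
`u_t + 2 u u_x + T u_xx + T̃ v_xx = 0`, `v_t - 2 v v_x - T v_xx - T̃ u_xx = 0`,
all principal value integrals being convergent. -/
def SolvesNcILW (L δ : ℝ) (u v : ℝ → ℝ → ℂ) : Prop :=
  ∀ x t : ℝ,
    TConverges L δ (fun y => dxx u y t) x ∧ TConverges L δ (fun y => dxx v y t) x ∧
    dt u x t + 2 * u x t * dx u x t + opT L δ (fun y => dxx u y t) x
      + opTt L δ (fun y => dxx v y t) x = 0 ∧
    dt v x t - 2 * v x t * dx v x t - opT L δ (fun y => dxx v y t) x
      - opTt L δ (fun y => dxx u y t) x = 0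

/-- `-δ/2 < Im z < δ/2`. -/
def openStrip (δ : ℝ) : Set ℂ := {z | -(δ / 2) < z.im ∧ z.im < δ / 2}

/-- `-δ/2 ≤ Im z ≤ δ/2`. -/
def closedStrip (δ : ℝ) : Set ℂ := {z | -(δ / 2) ≤ z.im ∧ z.im ≤ δ / 2}

/-- `log F` is analytic in the open strip and continuous on the closed strip. -/
def HasAnalyticLog (δ : ℝ) (F : ℂ → ℂ) : Prop :=
  ∃ f : ℂ → ℂ, (∀ z ∈ closedStrip δ, F z = exp (f z)) ∧
    DifferentiableOn ℂ f (openStrip δ) ∧ ContinuousOn f (closedStrip δ)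

/-- `F⁺(x, t) = F(x + iδ/2, t)`. -/
def bdryPlus (δ : ℝ) (F : ℂ → ℝ → ℂ) (x t : ℝ) : ℂ := F ((x : ℂ) + I * (δ / 2)) t

/-- `F⁻(x, t) = F(x - iδ/2, t)`. -/
def bdryMinus (δ : ℝ) (F : ℂ → ℝ → ℂ) (x t : ℝ) : ℂ := F ((x : ℂ) - I * (δ / 2)) t

/-- Hirota derivative `D_x f · g = f_x g - f g_x`. -/
def hirotaDx (f g : ℝ → ℝ → ℂ) (x t : ℝ) : ℂ := dx f x t * g x t - f x t * dx g x t

/-- Hirota derivative `D_x² f · g = f_xx g - 2 f_x g_x + f g_xx`. -/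
def hirotaDxx (f g : ℝ → ℝ → ℂ) (x t : ℝ) : ℂ :=
  dxx f x t * g x t - 2 * dx f x t * dx g x t + f x t * dxx g x t

/-- Hirota derivative `D_t f · g = f_t g - f g_t`. -/
def hirotaDt (f g : ℝ → ℝ → ℂ) (x t : ℝ) : ℂ := dt f x t * g x t - f x t * dt g x t

/-- The bilinear system
`(i D_t - D_x² + 2 i ū D_x - λ₁(t) + ū²) F⁻ · G⁺ = 0`,
`(i D_t - D_x² - 2 i v̄ D_x - λ₂(t) + v̄²) F⁺ · G⁻ = 0`. -/
def HirotaSystem (δ : ℝ) (ubar vbar : ℂ) (lam1 lam2 : ℝ → ℂ) (F G : ℂ → ℝ → ℂ) : Prop :=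
  ∀ x t : ℝ,
    I * hirotaDt (bdryMinus δ F) (bdryPlus δ G) x t
      - hirotaDxx (bdryMinus δ F) (bdryPlus δ G) x t
      + 2 * I * ubar * hirotaDx (bdryMinus δ F) (bdryPlus δ G) x t
      + (-lam1 t + ubar ^ 2) * (bdryMinus δ F x t * bdryPlus δ G x t) = 0 ∧
    I * hirotaDt (bdryPlus δ F) (bdryMinus δ G) x t
      - hirotaDxx (bdryPlus δ F) (bdryMinus δ G) x t
      - 2 * I * vbar * hirotaDx (bdryPlus δ F) (bdryMinus δ G) x t
      + (-lam2 t + vbar ^ 2) * (bdryPlus δ F x t * bdryMinus δ G x t) = 0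

/-- `u = ū + i ∂ₓ log (F⁻ / G⁺)`. -/
def uOfFG (δ : ℝ) (ubar : ℂ) (F G : ℂ → ℝ → ℂ) (x t : ℝ) : ℂ :=
  ubar + I * logDeriv (fun y : ℝ => bdryMinus δ F y t / bdryPlus δ G y t) x

/-- `v = v̄ + i ∂ₓ log (G⁻ / F⁺)`. -/
def vOfFG (δ : ℝ) (vbar : ℂ) (F G : ℂ → ℝ → ℂ) (x t : ℝ) : ℂ :=
  vbar + I * logDeriv (fun y : ℝ => bdryMinus δ G y t / bdryPlus δ F y t) x

/-- The function `x ↦ T(f - f̄)(x) + T̃(g - ḡ)(x)` at time `t`. -/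
def TTt (L δ : ℝ) (fbar gbar : ℂ) (f g : ℝ → ℝ → ℂ) (x t : ℝ) : ℂ :=
  opT L δ (fun y => f y t - fbar) x + opTt L δ (fun y => g y t - gbar) x

/-- `u₊ = (u - ū)/2 - (i/2) (T(u - ū) + T̃(v - v̄))`. -/
def uPlus (L δ : ℝ) (ubar vbar : ℂ) (u v : ℝ → ℝ → ℂ) (x t : ℝ) : ℂ :=
  (u x t - ubar) / 2 - I / 2 * TTt L δ ubar vbar u v x t

/-- `u₋ = (u - ū)/2 + (i/2) (T(u - ū) + T̃(v - v̄))`. -/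
def uMinus (L δ : ℝ) (ubar vbar : ℂ) (u v : ℝ → ℝ → ℂ) (x t : ℝ) : ℂ :=
  (u x t - ubar) / 2 + I / 2 * TTt L δ ubar vbar u v x t

/-- `v₊ = (v - v̄)/2 + (i/2) (T(v - v̄) + T̃(u - ū))`. -/
def vPlus (L δ : ℝ) (ubar vbar : ℂ) (u v : ℝ → ℝ → ℂ) (x t : ℝ) : ℂ :=
  (v x t - vbar) / 2 + I / 2 * TTt L δ vbar ubar v u x t

/-- `v₋ = (v - v̄)/2 - (i/2) (T(v - v̄) + T̃(u - ū))`. -/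
def vMinus (L δ : ℝ) (ubar vbar : ℂ) (u v : ℝ → ℝ → ℂ) (x t : ℝ) : ℂ :=
  (v x t - vbar) / 2 - I / 2 * TTt L δ vbar ubar v u x t

/-- `log F(·, t)` is analytic for `|Im z| < δ/2`, continuous for `|Im z| ≤ δ/2`, and
`i ∂_z log F(z, t) = (1/(2πi)) ∫ ζ₁(x' - z - iδ/2 | L/2, iδ/2) J(x', t) dx'` for `|Im z| < δ/2`. -/
def IsHirotaPotential (L δ : ℝ) (J : ℝ → ℝ → ℂ) (F : ℂ → ℝ → ℂ) : Prop :=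
  ∀ t : ℝ, HasAnalyticLog δ (fun z => F z t) ∧
    ∀ z ∈ openStrip δ, I * logDeriv (fun w => F w t) z =
      1 / (2 * π * I) * ∫ y in (-(L / 2))..(L / 2),
        zeta1 L (δ / 2) ((y : ℂ) - z - I * (δ / 2)) * J y t

/-- `F(·, t)` is `L`-periodic on the closed strip. -/
def StripPeriodic (L δ : ℝ) (F : ℂ → ℝ → ℂ) : Prop :=
  ∀ t : ℝ, ∀ z ∈ closedStrip δ, F (z + L) t = F z t

/-- The boundary values `F^±` are `C^n` functions of `(x, t) ∈ ℝ²`. -/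
def BdryContDiff (δ : ℝ) (n : ℕ) (F : ℂ → ℝ → ℂ) : Prop :=
  ContDiff ℝ n (fun p : ℝ × ℝ => bdryPlus δ F p.1 p.2) ∧
    ContDiff ℝ n (fun p : ℝ × ℝ => bdryMinus δ F p.1 p.2)

/-- The boundary values `F^±` are `C²` in `x` and differentiable in `t`, so that all derivatives
in the bilinear system exist. -/
def BdryRegular (δ : ℝ) (F : ℂ → ℝ → ℂ) : Prop :=
  (∀ t : ℝ, ContDiff ℝ 2 (fun x => bdryPlus δ F x t) ∧
    ContDiff ℝ 2 (fun x => bdryMinus δ F x t)) ∧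
  ∀ x : ℝ, Differentiable ℝ (fun t => bdryPlus δ F x t) ∧
    Differentiable ℝ (fun t => bdryMinus δ F x t)

end

end NcILW

/-! Everything is computed in Fourier series. Write `k = 2πn/L`. Pairing the terms `±n` of the
series for `ζ₁` and summing a Lambert series shows that, on `C¹` periodic functions, `T` is the
Fourier multiplier `i coth(kδ)`, with value `0` at `n = 0`. On mean-zero functions `T̃` is the
multiplier `i / sinh(kδ)` (`opT_eq_mulOp`, `opTt_eq_mulOp`).

Two facts give (A). The first is algebraic. With `u = ū + i ∂ₓ log (P/Q)`, dividing a bilinear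
equation by `PQ` turns it into `E = λ(t)`, where `E = i ∂ₜ log (P/Q) + u² - ∂ₓ² log (PQ)`
(`hirotaForm_eq`). Hence some `λ` exists exactly when `∂ₓE = 0`, that is, `u_t + 2uu_x - ∂ₓ³ log
(PQ) = 0` (`hirotaForm_iff`). The second is analytic. Up to a linear term, which three derivatives
remove, `log F` is periodic and holomorphic in the strip, so Cauchy's theorem on a rectangle relates
the Fourier coefficients on the two boundary lines by the factor `exp(-kδ)` (`fcoef_bdry`). For `h^±
= ∂ₓ³ log F^±` this reads `T h⁻ - T̃ h⁺ = i h⁻` and `T̃ h⁻ - T h⁺ = i h⁺` (`mulOp_bdry_relations`).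
Together with the same relations for `G` it gives `T u_xx + T̃ v_xx = -∂ₓ³ log (F⁻G⁺)`, so the first
ncILW equation is `∂ₓE = 0`. The second one is the same statement for `-v`, `F⁺`, `G⁻`.

For (B), the zero Fourier mode of the equation gives conservation of the means. The integral
equation for `F` is solved mode by mode: its kernel has symbol `e_n(z) / (2 sinh(kδ/2))`, where
`e_n(z) = exp(ikz)`, and this stays bounded up to the boundary of the strip, so an explicit series
for `log F` converges there. Uniqueness holds because two solutions have equal logarithmic
derivatives. Hyperbolic half-angle identities (`symbol_identities`) evaluate the boundary
derivatives as `i ∂ₓ log F⁻ = u₊` and `i ∂ₓ log F⁺ = -v₊`. Exchanging `u` and `v` gives `G`, with `i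
∂ₓ log G⁻ = v₋` and `i ∂ₓ log G⁺ = -u₋`, and (1) follows because `u₊ + u₋ = u - ū` and `v₊ + v₋ = v
- v̄`. Finally `∂ₓE` is, once more, the left-hand side of the ncILW equation, so `E` depends on `t`
only and can serve as `λ`. -/

namespace NcILW

noncomputable section

/-! ### Fourier series of `L`-periodic functions -/

/-- The Fourier mode `exp (2πi n z / L)`. -/
def mode (L : ℝ) (n : ℤ) (z : ℂ) : ℂ := exp (2 * π * I * n * z / L)

/-- The `n`-th Fourier coefficient over the period `[-L/2, L/2]`. -/
def fcoef (L : ℝ) (h : ℝ → ℂ) (n : ℤ) : ℂ :=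
  (1 / L : ℂ) * ∫ x in (-(L / 2))..(L / 2), h x * mode L (-n) x

/-- The Fourier multiplier with symbol `m`. -/
def mulOp (L : ℝ) (m : ℤ → ℂ) (h : ℝ → ℂ) (x : ℝ) : ℂ :=
  ∑' n : ℤ, m n * fcoef L h n * mode L n x

theorem mode_zero_index (L : ℝ) (z : ℂ) : mode L 0 z = 1 := by simp [mode]

theorem mode_zero (L : ℝ) (n : ℤ) : mode L n 0 = 1 := by simp [mode]

theorem mode_add (L : ℝ) (n : ℤ) (z w : ℂ) : mode L n (z + w) = mode L n z * mode L n w := by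
  rw [mode, mode, mode, ← Complex.exp_add]; congr 1; ring

theorem mode_neg_arg (L : ℝ) (n : ℤ) (z : ℂ) : mode L n (-z) = mode L (-n) z := by
  rw [mode, mode]; congr 1; push_cast; ring

theorem mode_mul (L : ℝ) (n m : ℤ) (z : ℂ) : mode L n z * mode L m z = mode L (n + m) z := by
  rw [mode, mode, mode, ← Complex.exp_add]; congr 1; push_cast; ring

theorem mode_mul_neg (L : ℝ) (n : ℤ) (z : ℂ) : mode L n z * mode L (-n) z = 1 := by
  rw [mode_mul, add_neg_cancel, mode_zero_index]

theorem mode_ne_zero (L : ℝ) (n : ℤ) (z : ℂ) : mode L n z ≠ 0 := exp_ne_zero _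

theorem norm_mode (L : ℝ) (n : ℤ) (z : ℂ) :
    ‖mode L n z‖ = Real.exp (-(2 * π * n / L * z.im)) := by
  rw [mode, Complex.norm_exp]
  congr 1
  have : 2 * π * I * n * z / L = ((2 * π * n / L : ℝ) : ℂ) * (I * z) := by push_cast; ring
  rw [this, Complex.re_ofReal_mul]
  simp

theorem norm_mode_real (L : ℝ) (n : ℤ) (x : ℝ) : ‖mode L n x‖ = 1 := by
  simp [norm_mode]

theorem mode_period {L : ℝ} (hL : 0 < L) (n : ℤ) : mode L n L = 1 := by
  have : (L : ℂ) ≠ 0 := by exact_mod_cast hL.ne'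
  rw [mode, Complex.exp_eq_one_iff]
  exact ⟨n, by field_simp⟩

theorem mode_add_period {L : ℝ} (hL : 0 < L) (n : ℤ) (z : ℂ) :
    mode L n (z + L) = mode L n z := by
  rw [mode_add, mode_period hL, mul_one]

theorem hasDerivAt_mode (L : ℝ) (n : ℤ) (z : ℂ) :
    HasDerivAt (mode L n) (2 * π * I * n / L * mode L n z) z := by
  have h : HasDerivAt (fun w : ℂ => 2 * π * I * n * w / L) (2 * π * I * n / L) z := by
    simpa using ((hasDerivAt_id z).const_mul (2 * π * I * n : ℂ)).div_const (L : ℂ)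
  rw [mul_comm]
  exact h.cexp

theorem hasDerivAt_mode_real (L : ℝ) (n : ℤ) (x : ℝ) :
    HasDerivAt (fun y : ℝ => mode L n y) (2 * π * I * n / L * mode L n x) x :=
  (hasDerivAt_mode L n x).comp_ofReal

theorem continuous_mode (L : ℝ) (n : ℤ) : Continuous (mode L n) := by
  unfold mode; fun_prop

theorem continuous_mode_real (L : ℝ) (n : ℤ) : Continuous (fun x : ℝ => mode L n x) :=
  (continuous_mode L n).comp continuous_ofReal

theorem fourier_eq_mode (L : ℝ) (n : ℤ) (x : ℝ) : fourier n (x : AddCircle L) = mode L n x := by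
  rw [fourier_coe_apply, mode]

theorem fourierCoeff_lift_eq {L : ℝ} [Fact (0 < L)] {h : ℝ → ℂ} (hp : Function.Periodic h L)
    (n : ℤ) : fourierCoeff (hp.lift : AddCircle L → ℂ) n = fcoef L h n := by
  rw [fourierCoeff_eq_intervalIntegral _ _ (-(L / 2)), fcoef]
  have : -(L / 2) + L = L / 2 := by ring
  rw [this, Complex.real_smul]
  push_cast
  congr 1
  refine intervalIntegral.integral_congr fun x _ => ?_
  simp only [smul_eq_mul, fourier_eq_mode]
  rw [mul_comm]
  congr 1

/-- A continuous periodic function as a continuous function on the circle. -/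
def circleLift {L : ℝ} {h : ℝ → ℂ} (hp : Function.Periodic h L) (hc : Continuous h) :
    C(AddCircle L, ℂ) :=
  ⟨hp.lift, continuous_coinduced_dom.mpr hc⟩

theorem hasSum_fourier_inversion {L : ℝ} (hL : 0 < L) {h : ℝ → ℂ} (hp : Function.Periodic h L)
    (hc : Continuous h) (hs : Summable fun n => ‖fcoef L h n‖) (x : ℝ) :
    HasSum (fun n : ℤ => fcoef L h n * mode L n x) (h x) := by
  have : Fact (0 < L) := ⟨hL⟩
  have key := has_pointwise_sum_fourier_series_of_summable (f := circleLift hp hc) (T := L)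
    (by
      have : fourierCoeff (circleLift hp hc) = fcoef L h := by
        funext n; exact fourierCoeff_lift_eq hp n
      rw [this]; exact hs.of_norm) (x : AddCircle L)
  have h2 : ∀ n : ℤ, fourierCoeff (circleLift hp hc) n • fourier n (x : AddCircle L)
      = fcoef L h n * mode L n x := fun n => by
    rw [smul_eq_mul, fourier_eq_mode]; congr 1; exact fourierCoeff_lift_eq hp n
  simp only [h2] at key
  exact key

theorem summable_sq_fcoef {L : ℝ} (hL : 0 < L) {h : ℝ → ℂ} (hp : Function.Periodic h L)
    (hc : Continuous h) : Summable fun n => ‖fcoef L h n‖ ^ 2 := by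
  have : Fact (0 < L) := ⟨hL⟩
  have key := (hasSum_sq_fourierCoeff
    (ContinuousMap.toLp 2 AddCircle.haarAddCircle ℂ (circleLift hp hc))).summable
  refine key.congr fun n => ?_
  rw [fourierCoeff_toLp]
  congr 2
  exact fourierCoeff_lift_eq hp n

theorem norm_fcoef_le {L : ℝ} (hL : 0 < L) {h : ℝ → ℂ} {K : ℝ}
    (hK : ∀ x ∈ Set.Icc (-(L / 2)) (L / 2), ‖h x‖ ≤ K) (n : ℤ) : ‖fcoef L h n‖ ≤ K := by
  have h1 : ‖∫ x in (-(L / 2))..(L / 2), h x * mode L (-n) x‖ ≤ K * |L / 2 - -(L / 2)| := by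
    refine intervalIntegral.norm_integral_le_of_norm_le_const fun x hx => ?_
    rw [norm_mul, norm_mode_real, mul_one]
    rw [Set.uIoc_of_le (by linarith)] at hx
    exact hK x ⟨hx.1.le, hx.2⟩
  have h2 : L / 2 - -(L / 2) = L := by ring
  rw [h2, abs_of_pos hL] at h1
  rw [fcoef, norm_mul, norm_div, norm_one, Complex.norm_real, Real.norm_of_nonneg hL.le]
  rw [div_mul_eq_mul_div, one_mul, div_le_iff₀ hL]
  exact h1

theorem periodic_deriv {L : ℝ} {h : ℝ → ℂ} (hp : Function.Periodic h L) :
    Function.Periodic (deriv h) L := fun x => by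
  rw [← deriv_comp_add_const h L x]
  congr 1
  funext y
  exact hp y

theorem fcoef_deriv {L : ℝ} (hL : 0 < L) {h : ℝ → ℂ} (hp : Function.Periodic h L)
    (hh : ContDiff ℝ 1 h) (n : ℤ) :
    fcoef L (deriv h) n = 2 * π * I * n / L * fcoef L h n := by
  have hd : ∀ x, HasDerivAt h (deriv h x) x := fun x =>
    (hh.differentiable one_ne_zero x).hasDerivAt
  have hc : Continuous (deriv h) := hh.continuous_deriv_one
  have h1 := intervalIntegral.integral_mul_deriv_eq_deriv_mul (a := -(L / 2)) (b := L / 2)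
    (u := fun x : ℝ => mode L (-n) x) (v := h) (v' := deriv h)
    (fun x _ => hasDerivAt_mode_real L (-n) x) (fun x _ => hd x)
    ((continuous_const.mul (continuous_mode_real L (-n))).intervalIntegrable _ _)
    (hc.intervalIntegrable _ _)
  -- Periodicity cancels the boundary terms of the integration by parts.
  have h2 : h (L / 2) = h (-(L / 2)) := by
    rw [← hp (-(L / 2))]; congr 1; ring
  have h3 : mode L (-n) ((L / 2 : ℝ) : ℂ) = mode L (-n) ((-(L / 2) : ℝ) : ℂ) := by
    rw [← mode_add_period hL (-n) ((-(L / 2) : ℝ) : ℂ)]; congr 1; push_cast; ring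
  rw [h2, h3, sub_self, zero_sub] at h1
  rw [fcoef, fcoef]
  have h4 : ∫ x in (-(L / 2))..(L / 2), deriv h x * mode L (-n) x
      = ∫ x in (-(L / 2))..(L / 2), mode L (-n) x * deriv h x :=
    intervalIntegral.integral_congr fun x _ => mul_comm _ _
  rw [h4, h1, ← intervalIntegral.integral_neg]
  have h5 : ∫ x in (-(L / 2))..(L / 2), -(2 * π * I * ((-n : ℤ) : ℂ) / L * mode L (-n) x * h x)
      = (2 * π * I * n / L) * ∫ x in (-(L / 2))..(L / 2), h x * mode L (-n) x := by
    rw [← intervalIntegral.integral_const_mul]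
    refine intervalIntegral.integral_congr fun x _ => ?_
    push_cast
    ring
  rw [h5]
  ring

theorem summable_one_div_int_sq : Summable fun n : ℤ => 1 / (n : ℝ) ^ 2 :=
  Real.summable_one_div_int_pow.mpr one_lt_two

theorem norm_symbol {L : ℝ} (hL : 0 < L) (n : ℤ) :
    ‖(2 * π * I * n / L : ℂ)‖ = 2 * π / L * |(n : ℝ)| := by
  simp [abs_of_pos hL, abs_of_pos Real.pi_pos, Complex.norm_real]
  ring

/-- For `n ≠ 0` the coefficient is that of `h'` divided by `2πin/L`. The inequality `ab ≤ a² + b²`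
for `a, b ≥ 0`, with Parseval for `h'`, makes the sum finite, so one continuous derivative suffices.
-/
theorem summable_fcoef {L : ℝ} (hL : 0 < L) {h : ℝ → ℂ} (hp : Function.Periodic h L)
    (hh : ContDiff ℝ 1 h) :
    Summable fun n => ‖fcoef L h n‖ := by
  have h1 := summable_sq_fcoef hL (periodic_deriv hp) hh.continuous_deriv_one
  have h2 : Summable fun n : ℤ => (L / (2 * π)) * (1 / (n : ℝ) ^ 2 + ‖fcoef L (deriv h) n‖ ^ 2) :=
    (summable_one_div_int_sq.add h1).mul_left _
  -- The majorant `1/n²` is `0` at `n = 0` by convention and `h'` has mean zero, so the mean of `h`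
  -- needs a term of its own.
  have h3 : Summable fun n : ℤ => (if n = 0 then ‖fcoef L h 0‖ else 0 : ℝ) :=
    summable_of_ne_finset_zero (s := {0}) fun n hn => by simp at hn; simp [hn]
  refine Summable.of_nonneg_of_le (fun n => norm_nonneg _) (fun n => ?_) (h2.add h3)
  by_cases hn : n = 0
  · subst hn
    simp only [if_true]
    have : 0 ≤ L / (2 * π) * (1 / ((0 : ℤ) : ℝ) ^ 2 + ‖fcoef L (deriv h) 0‖ ^ 2) := by positivity
    linarith
  · simp only [hn, if_false, add_zero]
    have h4 := fcoef_deriv hL hp hh n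
    have hn' : 0 < |(n : ℝ)| := abs_pos.mpr (by exact_mod_cast hn)
    have h5 : ‖fcoef L (deriv h) n‖ = 2 * π / L * |(n : ℝ)| * ‖fcoef L h n‖ := by
      rw [h4, norm_mul, norm_symbol hL]
    have h6 : ‖fcoef L h n‖ = L / (2 * π) * (1 / |(n : ℝ)| * ‖fcoef L (deriv h) n‖) := by
      rw [h5]; field_simp
    rw [h6]
    refine mul_le_mul_of_nonneg_left ?_ (by positivity)
    have h7 : 1 / (n : ℝ) ^ 2 = (1 / |(n : ℝ)|) ^ 2 := by rw [div_pow, sq_abs, one_pow]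
    rw [h7]
    nlinarith [sq_nonneg (1 / |(n : ℝ)| - ‖fcoef L (deriv h) n‖), sq_nonneg (1 / |(n : ℝ)|),
      sq_nonneg ‖fcoef L (deriv h) n‖]

theorem fcoef_mode {L : ℝ} (hL : 0 < L) (m n : ℤ) :
    fcoef L (fun x => mode L m x) n = if n = m then 1 else 0 := by
  have : Fact (0 < L) := ⟨hL⟩
  have hp : Function.Periodic (fun x : ℝ => mode L m x) L := fun x => by
    push_cast; exact mode_add_period hL m x
  have h1 := fourierCoeff_lift_eq hp n
  have h2 : (hp.lift : AddCircle L → ℂ) = fourier m := by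
    funext y
    induction y using QuotientAddGroup.induction_on with
    | H x => exact (fourier_eq_mode L m x).symm
  rw [← h1, h2, fourierCoeff_fourier, Pi.single_apply]

/-- Integration of an absolutely convergent series of functions against a bounded function. -/
theorem hasSum_integral_series {a : ℤ → ℂ} (ha : Summable fun n => ‖a n‖)
    {g : ℝ → ℂ} (hg : Continuous g) {e : ℤ → ℝ → ℂ} (he : ∀ n, Continuous (e n))
    (he1 : ∀ n x, ‖e n x‖ ≤ 1) (c d : ℝ) :
    HasSum (fun n => a n * ∫ x in c..d, e n x * g x)
      (∫ x in c..d, (∑' n, a n * e n x) * g x) := by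
  have hsx : ∀ x, Summable fun n => a n * e n x := fun x =>
    Summable.of_norm_bounded ha fun n => by
      rw [norm_mul]; exact mul_le_of_le_one_right (norm_nonneg _) (he1 n x)
  have := intervalIntegral.hasSum_integral_of_dominated_convergence
    (μ := MeasureTheory.volume) (a := c) (b := d) (ι := ℤ)
    (F := fun n x => a n * e n x * g x) (f := fun x => (∑' n, a n * e n x) * g x)
    (fun n x => ‖a n‖ * ‖g x‖)
    (fun n => (((continuous_const.mul (he n)).mul hg).aestronglyMeasurable))
    (fun n => Eventually.of_forall fun x _ => by
      rw [norm_mul, norm_mul]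
      refine mul_le_mul_of_nonneg_right ?_ (norm_nonneg _)
      exact mul_le_of_le_one_right (norm_nonneg _) (he1 n x))
    (Eventually.of_forall fun x _ => ha.mul_right _)
    (by
      simp only [tsum_mul_right]
      exact (continuous_const.mul hg.norm).intervalIntegrable _ _)
    (Eventually.of_forall fun x _ => (hsx x).hasSum.mul_right _)
  have h2 : ∀ n, ∫ x in c..d, a n * e n x * g x = a n * ∫ x in c..d, e n x * g x := fun n => by
    rw [← intervalIntegral.integral_const_mul]
    simp only [mul_assoc]
  simpa only [h2] using this

theorem norm_mode_real_le (L : ℝ) (n : ℤ) (x : ℝ) : ‖mode L n x‖ ≤ 1 := (norm_mode_real L n x).le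

theorem fcoef_series {L : ℝ} (hL : 0 < L) {a : ℤ → ℂ} (ha : Summable fun n => ‖a n‖) (n : ℤ) :
    fcoef L (fun x => ∑' m, a m * mode L m x) n = a n := by
  have h1 := hasSum_integral_series ha (continuous_mode_real L (-n)) (continuous_mode_real L)
    (norm_mode_real_le L) (-(L / 2)) (L / 2)
  have h2 := h1.mul_left (1 / L : ℂ)
  have h3 : ∀ m, (1 / L : ℂ) * (a m * ∫ x in (-(L / 2))..(L / 2), mode L m x * mode L (-n) x)
      = if m = n then a n else 0 := fun m => by
    have := fcoef_mode hL m n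
    rw [fcoef] at this
    rw [mul_left_comm, this]
    split_ifs with h h' h'
    · rw [h, mul_one]
    · exact absurd h.symm h'
    · exact absurd h'.symm h
    · rw [mul_zero]
  simp only [h3] at h2
  exact h2.unique (hasSum_ite_eq n (a n))

theorem fcoef_add {L : ℝ} {f g : ℝ → ℂ} (hf : Continuous f) (hg : Continuous g) (n : ℤ) :
    fcoef L (fun x => f x + g x) n = fcoef L f n + fcoef L g n := by
  have hm := continuous_mode_real L (-n)
  have h1 : Continuous fun x => f x * mode L (-n) x := by fun_prop
  have h2 : Continuous fun x => g x * mode L (-n) x := by fun_prop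
  rw [fcoef, fcoef, fcoef, ← mul_add, ← intervalIntegral.integral_add
    (h1.intervalIntegrable _ _) (h2.intervalIntegrable _ _)]
  simp only [add_mul]

theorem fcoef_const_mul {L : ℝ} (c : ℂ) (f : ℝ → ℂ) (n : ℤ) :
    fcoef L (fun x => c * f x) n = c * fcoef L f n := by
  rw [fcoef, fcoef, mul_left_comm, ← intervalIntegral.integral_const_mul c]
  simp only [mul_assoc]

theorem fcoef_sub {L : ℝ} {f g : ℝ → ℂ} (hf : Continuous f) (hg : Continuous g) (n : ℤ) :
    fcoef L (fun x => f x - g x) n = fcoef L f n - fcoef L g n := by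
  have h1 : (fun x => f x - g x) = fun x => f x + (-1) * g x := by funext x; ring
  have h2 : Continuous fun x => (-1) * g x := by fun_prop
  rw [h1, fcoef_add hf h2, fcoef_const_mul]
  ring

theorem fcoef_const {L : ℝ} (hL : 0 < L) (c : ℂ) (n : ℤ) :
    fcoef L (fun _ => c) n = if n = 0 then c else 0 := by
  have h1 : (fun _ : ℝ => c) = fun x : ℝ => c * mode L 0 x := by
    funext x; rw [mode_zero_index, mul_one]
  rw [h1, fcoef_const_mul, fcoef_mode hL]
  split_ifs <;> simp

theorem fcoef_zero_eq_mean (L : ℝ) (f : ℝ → ℂ) : fcoef L f 0 = mean L f := by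
  simp [fcoef, mean, mode_zero_index]

theorem fcoef_deriv_zero {L : ℝ} (hL : 0 < L) {h : ℝ → ℂ} (hp : Function.Periodic h L)
    (hh : ContDiff ℝ 1 h) : fcoef L (deriv h) 0 = 0 := by
  rw [fcoef_deriv hL hp hh]; simp

/-! ### Fourier multipliers -/

section Multiplier

variable {L : ℝ} {h : ℝ → ℂ} {m : ℤ → ℂ} {B : ℝ}

theorem summable_mul_fcoef (hL : 0 < L) (hp : Function.Periodic h L) (hh : ContDiff ℝ 1 h)
    (hm : ∀ n, ‖m n‖ ≤ B) : Summable fun n => ‖m n * fcoef L h n‖ := by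
  refine Summable.of_nonneg_of_le (fun n => norm_nonneg _) (fun n => ?_)
    ((summable_fcoef hL hp hh).mul_left B)
  rw [norm_mul]
  exact mul_le_mul_of_nonneg_right (hm n) (norm_nonneg _)

theorem summable_mulOp (hL : 0 < L) (hp : Function.Periodic h L) (hh : ContDiff ℝ 1 h)
    (hm : ∀ n, ‖m n‖ ≤ B) (x : ℝ) : Summable fun n => m n * fcoef L h n * mode L n x :=
  Summable.of_norm_bounded (summable_mul_fcoef hL hp hh hm) fun n => by
    rw [norm_mul _ (mode L n x), norm_mode_real, mul_one]

theorem fcoef_mulOp (hL : 0 < L) (hp : Function.Periodic h L) (hh : ContDiff ℝ 1 h)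
    (hm : ∀ n, ‖m n‖ ≤ B) (n : ℤ) : fcoef L (mulOp L m h) n = m n * fcoef L h n :=
  fcoef_series hL (summable_mul_fcoef hL hp hh hm) n

theorem continuous_mulOp (hL : 0 < L) (hp : Function.Periodic h L) (hh : ContDiff ℝ 1 h)
    (hm : ∀ n, ‖m n‖ ≤ B) : Continuous (mulOp L m h) :=
  continuous_tsum (fun n => continuous_const.mul (continuous_mode_real L n))
    (summable_mul_fcoef hL hp hh hm) fun n x => by
      rw [norm_mul _ (mode L n x), norm_mode_real, mul_one]

theorem hasDerivAt_mulOp (hL : 0 < L) (hp : Function.Periodic h L) (hh : ContDiff ℝ 2 h)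
    (hm : ∀ n, ‖m n‖ ≤ B) (x : ℝ) :
    HasDerivAt (mulOp L m h) (mulOp L m (deriv h) x) x := by
  have hh1 : ContDiff ℝ 1 h := hh.of_le (by norm_num)
  have hh' : ContDiff ℝ 1 (deriv h) := hh.deriv' (n := 1)
  have key := hasDerivAt_tsum (𝕜 := ℝ) (y₀ := (0 : ℝ))
    (g := fun (n : ℤ) (y : ℝ) => m n * fcoef L h n * mode L n y)
    (g' := fun (n : ℤ) (y : ℝ) => m n * fcoef L (deriv h) n * mode L n y)
    (summable_mul_fcoef hL (periodic_deriv hp) hh' hm)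
    (fun n y => by
      refine ((hasDerivAt_mode_real L n y).const_mul (m n * fcoef L h n)).congr_deriv ?_
      rw [fcoef_deriv hL hp hh1]
      ring)
    (fun n y => by rw [norm_mul _ (mode L n y), norm_mode_real, mul_one])
    (summable_mulOp hL hp hh1 hm 0) x
  exact key

theorem deriv_mulOp (hL : 0 < L) (hp : Function.Periodic h L) (hh : ContDiff ℝ 2 h)
    (hm : ∀ n, ‖m n‖ ≤ B) : deriv (mulOp L m h) = mulOp L m (deriv h) :=
  funext fun x => (hasDerivAt_mulOp hL hp hh hm x).deriv

/-- One derivative is lost because absolute summability of the coefficients is obtained from a `C¹`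
bound. This is why `C³` data lead to `C²` boundary values in (B). -/
theorem contDiff_mulOp (hL : 0 < L) (hp : Function.Periodic h L) (k : ℕ)
    (hh : ContDiff ℝ (k + 1) h) (hm : ∀ n, ‖m n‖ ≤ B) : ContDiff ℝ k (mulOp L m h) := by
  induction k generalizing h with
  | zero => exact contDiff_zero.mpr (continuous_mulOp hL hp (by simpa using hh) hm)
  | succ k ih =>
    have hh2 : ContDiff ℝ 2 h := hh.of_le (by
      push_cast
      have : (2 : WithTop ℕ∞) = 1 + 1 := by norm_num
      rw [this, add_assoc]
      exact le_add_self)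
    have e : ((k + 1 : ℕ) : WithTop ℕ∞) = (k : WithTop ℕ∞) + 1 := by push_cast; rfl
    rw [e, contDiff_succ_iff_deriv]
    refine ⟨fun x => (hasDerivAt_mulOp hL hp hh2 hm x).differentiableAt, by simp, ?_⟩
    rw [deriv_mulOp hL hp hh2 hm]
    rw [e] at hh
    exact ih (periodic_deriv hp) (hh.deriv')

theorem mulOp_one (hL : 0 < L) (hp : Function.Periodic h L) (hh : ContDiff ℝ 1 h) (x : ℝ) :
    mulOp L (fun _ => 1) h x = h x := by
  have := (hasSum_fourier_inversion hL hp hh.continuous (summable_fcoef hL hp hh) x).tsum_eq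
  rw [mulOp]
  simpa only [one_mul] using this

/-- A continuous periodic function is determined by its Fourier coefficients. -/
theorem eq_mulOp_of_fcoef {f : ℝ → ℂ} (hL : 0 < L) (hfp : Function.Periodic f L)
    (hf : Continuous f) (hp : Function.Periodic h L) (hh : ContDiff ℝ 1 h)
    (hm : ∀ n, ‖m n‖ ≤ B) (hfc : ∀ n, fcoef L f n = m n * fcoef L h n) (x : ℝ) :
    f x = mulOp L m h x := by
  have hs : Summable fun n => ‖fcoef L f n‖ := by
    simp only [hfc]; exact summable_mul_fcoef hL hp hh hm
  have := (hasSum_fourier_inversion hL hfp hf hs x).tsum_eq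
  rw [← this, mulOp]
  simp only [hfc]

end Multiplier

end

end NcILW

namespace NcILW

noncomputable section

/-! ### The function `ζ₁` -/

theorem mode_pow (L : ℝ) (k : ℕ) (n : ℤ) (z : ℂ) : mode L n z ^ k = mode L (k * n) z := by
  rw [mode, mode, ← Complex.exp_nat_mul]; congr 1; push_cast; ring

theorem cot_eq_mode (L : ℝ) (z : ℂ) :
    Complex.cot (π / L * z) = (mode L 1 z + 1) / (I * (1 - mode L 1 z)) := by
  rw [Complex.cot_eq_exp_ratio, mode]
  have : 2 * I * (π / L * z) = 2 * π * I * ((1 : ℤ) : ℂ) * z / L := by push_cast; ring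
  rw [this]

theorem complex_cot_neg (z : ℂ) : Complex.cot (-z) = -Complex.cot z := by
  rw [Complex.cot, Complex.cot, Complex.sin_neg, Complex.cos_neg, div_neg]

/-- The square of the nome, `exp (-4πδ/L)`. -/
def nome (L δ : ℝ) : ℝ := Real.exp (-(4 * π * δ / L))

theorem nome_pos (L δ : ℝ) : 0 < nome L δ := Real.exp_pos _

theorem nome_lt_one {L δ : ℝ} (hL : 0 < L) (hδ : 0 < δ) : nome L δ < 1 := by
  rw [nome, Real.exp_lt_one_iff]
  have : 0 < 4 * π * δ / L := by positivity
  linarith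

theorem mode_shift (L δ : ℝ) (n : ℕ) (z : ℂ) :
    mode L 1 (z + 2 * I * n * δ) = mode L 1 z * (nome L δ : ℂ) ^ n := by
  rw [mode_add]
  congr 1
  rw [mode, nome, Complex.ofReal_exp, ← Complex.exp_nat_mul]
  congr 1
  push_cast
  linear_combination (4 * π * n * δ / L : ℂ) * I_sq

/-- The strip reaches up to the poles of `ζ₁` nearest to the real line, at height `±2δ`. Both
Lambert series, in `e_1(z)` and in `e_{-1}(z)`, converge there. -/
theorem norm_mode_one_mul_lt {L δ : ℝ} (hL : 0 < L) {z : ℂ} (hz : |z.im| < 2 * δ) :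
    nome L δ * ‖mode L 1 z‖ < 1 ∧ nome L δ * ‖mode L (-1) z‖ < 1 := by
  have hz' := abs_lt.mp hz
  have hc : 0 < 2 * π / L := by positivity
  rw [norm_mode, norm_mode, nome, ← Real.exp_add, ← Real.exp_add, Real.exp_lt_one_iff,
    Real.exp_lt_one_iff]
  push_cast
  constructor
  · have : -(4 * π * δ / L) + -(2 * π * 1 / L * z.im) = (2 * π / L) * (-2 * δ - z.im) := by ring
    rw [this]
    exact mul_neg_of_pos_of_neg hc (by linarith)
  · have : -(4 * π * δ / L) + -(2 * π * -1 / L * z.im) = (2 * π / L) * (z.im - 2 * δ) := by ring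
    rw [this]
    exact mul_neg_of_pos_of_neg hc (by linarith)

/-- Lambert series: interchange of the two geometric summations. -/
theorem hasSum_lambert {q : ℝ} (hq : 0 < q) (hq1 : q < 1) {x : ℂ} (hx : q * ‖x‖ < 1) :
    (Summable fun m : ℕ => (q : ℂ) ^ (m + 1) / (1 - (q : ℂ) ^ (m + 1)) * x ^ (m + 1)) ∧
    HasSum (fun n : ℕ => (q : ℂ) ^ (n + 1) * x / (1 - (q : ℂ) ^ (n + 1) * x))
      (∑' m : ℕ, (q : ℂ) ^ (m + 1) / (1 - (q : ℂ) ^ (m + 1)) * x ^ (m + 1)) := by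
  obtain ⟨f, hf⟩ : ∃ f : ℕ × ℕ → ℂ, f = fun p => ((q : ℂ) ^ (p.1 + 1) * x) ^ (p.2 + 1) := ⟨_, rfl⟩
  have hqn : ‖(q : ℂ)‖ = q := by rw [Complex.norm_real, Real.norm_of_nonneg hq.le]
  have hqp : ∀ n : ℕ, q ^ (n + 1) ≤ q := fun n => by
    rw [pow_succ]; exact mul_le_of_le_one_left hq.le (pow_le_one₀ hq.le hq1.le)
  have hs : Summable f := by
    -- The term `(q^(n+1) x)^(m+1)` has norm `q^(n(m+1)) (q‖x‖)^(m+1)`, at most `q^n (q‖x‖)^m`: a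
    -- product of two geometric series.
    have h1 : Summable fun n : ℕ => q ^ n := summable_geometric_of_lt_one hq.le hq1
    have h2 : Summable fun n : ℕ => (q * ‖x‖) ^ n :=
      summable_geometric_of_lt_one (by positivity) hx
    have h3 := Summable.mul_of_nonneg h1 h2 (fun n => by positivity) (fun n => by positivity)
    refine Summable.of_norm_bounded h3 fun p => ?_
    have e : ‖f p‖ = q ^ (p.1 * (p.2 + 1)) * (q * ‖x‖) ^ (p.2 + 1) := by
      rw [hf]
      simp only [norm_pow, norm_mul, hqn]
      ring
    rw [e]
    refine mul_le_mul (pow_le_pow_of_le_one hq.le hq1.le ?_)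
      (pow_le_pow_of_le_one (by positivity) hx.le (Nat.le_succ _)) (by positivity) (by positivity)
    exact Nat.le_mul_of_pos_right _ (Nat.succ_pos _)
  have geo : ∀ y : ℂ, ‖y‖ < 1 → HasSum (fun n : ℕ => y ^ (n + 1)) (y / (1 - y)) := fun y hy => by
    simpa only [pow_succ', div_eq_mul_inv] using (hasSum_geometric_of_norm_lt_one hy).mul_left y
  have hrow : ∀ n : ℕ, HasSum (fun m : ℕ => f (n, m))
      ((q : ℂ) ^ (n + 1) * x / (1 - (q : ℂ) ^ (n + 1) * x)) := fun n => by
    have : ‖(q : ℂ) ^ (n + 1) * x‖ < 1 := by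
      rw [norm_mul, norm_pow, hqn]
      exact (mul_le_mul_of_nonneg_right (hqp n) (norm_nonneg _)).trans_lt hx
    simpa only [hf] using geo _ this
  have hcol : ∀ m : ℕ, HasSum (fun n : ℕ => f (n, m))
      ((q : ℂ) ^ (m + 1) / (1 - (q : ℂ) ^ (m + 1)) * x ^ (m + 1)) := fun m => by
    have : ‖(q : ℂ) ^ (m + 1)‖ < 1 := by
      rw [norm_pow, hqn]; exact (hqp m).trans_lt hq1
    have h1 := (geo _ this).mul_right (x ^ (m + 1))
    have h2 : ∀ n : ℕ, f (n, m) = ((q : ℂ) ^ (m + 1)) ^ (n + 1) * x ^ (m + 1) := fun n => by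
      rw [hf]
      simp only [mul_pow, ← pow_mul, mul_comm]
    simpa only [h2] using h1
  have hs' : HasSum (fun p : ℕ × ℕ => f (p.2, p.1)) (∑' p, f p) :=
    (Equiv.prodComm ℕ ℕ).hasSum_iff.mpr hs.hasSum
  have h2 := hs'.prod_fiberwise hcol
  refine ⟨h2.summable, ?_⟩
  rw [h2.tsum_eq]
  exact hs.hasSum.prod_fiberwise hrow

/-- Fourier coefficients of the regular part `ζ₁(z) - (π/L) cot (πz/L)`. -/
def regCoef (L δ : ℝ) (n : ℤ) : ℂ :=
  -(2 * π * I / L) * n.sign * ((nome L δ : ℂ) ^ n.natAbs / (1 - (nome L δ : ℂ) ^ n.natAbs))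

theorem sum_Icc_symm (f : ℤ → ℂ) (M : ℕ) :
    ∑ n ∈ Finset.Icc (-(M : ℤ)) (M : ℤ), f n
      = f 0 + ∑ n ∈ Finset.range M, (f (n + 1) + f (-(n + 1))) := by
  induction M with
  | zero => simp
  | succ M ih =>
    have := Finset.sum_Icc_succ_eq_add_endpoints f (N := M)
    push_cast
    rw [this, ih, Finset.sum_range_succ]
    ring

/-- Far from the real axis `cot` tends to `±i`. In a symmetric pair these constants cancel and an
exponentially small remainder is left, which is why the symmetric partial sums converge. -/
theorem cot_pair {L δ : ℝ} (hL : 0 < L) (hδ : 0 < δ) {z : ℂ} (hz : |z.im| < 2 * δ) (n : ℕ) :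
    Complex.cot (π / L * (z - 2 * I * ((n : ℤ) + 1 : ℤ) * δ)) +
      Complex.cot (π / L * (z - 2 * I * (-((n : ℤ) + 1) : ℤ) * δ)) =
    2 * I * ((nome L δ : ℂ) ^ (n + 1) * mode L (-1) z / (1 - (nome L δ : ℂ) ^ (n + 1) * mode L (-1) z)
      - (nome L δ : ℂ) ^ (n + 1) * mode L 1 z / (1 - (nome L δ : ℂ) ^ (n + 1) * mode L 1 z)) := by
  have hq := nome_pos L δ
  have hq1 := nome_lt_one hL hδ
  have hqp : nome L δ ^ (n + 1) ≤ nome L δ := by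
    rw [pow_succ]; exact mul_le_of_le_one_left hq.le (pow_le_one₀ hq.le hq1.le)
  have hne : ∀ y : ℂ, nome L δ * ‖y‖ < 1 → 1 - (nome L δ : ℂ) ^ (n + 1) * y ≠ 0 := fun y hy h => by
    have h1 : ‖(nome L δ : ℂ) ^ (n + 1) * y‖ < 1 := by
      rw [norm_mul, norm_pow, Complex.norm_real, Real.norm_of_nonneg hq.le]
      exact (mul_le_mul_of_nonneg_right hqp (norm_nonneg _)).trans_lt hy
    rw [← sub_eq_zero.mp h, norm_one] at h1
    exact lt_irrefl _ h1
  obtain ⟨h1, h2⟩ := norm_mode_one_mul_lt hL hz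
  have e1 : (π / L : ℂ) * (z - 2 * I * ((n : ℤ) + 1 : ℤ) * δ)
      = -(π / L * (-z + 2 * I * ((n + 1 : ℕ) : ℂ) * δ)) := by push_cast; ring
  have e2 : (π / L : ℂ) * (z - 2 * I * (-((n : ℤ) + 1) : ℤ) * δ)
      = π / L * (z + 2 * I * ((n + 1 : ℕ) : ℂ) * δ) := by push_cast; ring
  rw [e1, e2, complex_cot_neg, cot_eq_mode, cot_eq_mode, mode_shift, mode_shift, mode_neg_arg]
  have g1 := hne _ h1
  have g2 := hne _ h2
  rw [mul_comm] at g1 g2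
  generalize mode L 1 z = M at *
  generalize mode L (-1) z = N at *
  generalize (nome L δ : ℂ) ^ (n + 1) = Q at *
  have g1' : 1 - Q * M ≠ 0 := by rwa [mul_comm]
  have g2' : 1 - Q * N ≠ 0 := by rwa [mul_comm]
  have c1 : (M * Q + 1) / (I * (1 - M * Q)) = -I * (1 + 2 * (Q * M / (1 - Q * M))) := by
    rw [div_eq_iff (mul_ne_zero I_ne_zero g1), mul_comm M Q]
    field_simp
    linear_combination (Q * M + 1) * I_sq
  have c2 : (N * Q + 1) / (I * (1 - N * Q)) = -I * (1 + 2 * (Q * N / (1 - Q * N))) := by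
    rw [div_eq_iff (mul_ne_zero I_ne_zero g2), mul_comm N Q]
    field_simp
    linear_combination (Q * N + 1) * I_sq
  rw [c1, c2]
  ring

/-- This evaluates the limit in the definition of `ζ₁`. The central cotangent carries the real poles
and stays apart; the other terms form an absolutely convergent Fourier series on the strip. -/
theorem hasSum_regCoef {L δ : ℝ} (hL : 0 < L) (hδ : 0 < δ) {z : ℂ} (hz : |z.im| < 2 * δ) :
    HasSum (fun n => regCoef L δ n * mode L n z) (zeta1 L δ z - π / L * Complex.cot (π / L * z)) := by
  have hq := nome_pos L δ
  have hq1 := nome_lt_one hL hδ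
  obtain ⟨h1, h2⟩ := norm_mode_one_mul_lt hL hz
  obtain ⟨sM, hM⟩ := hasSum_lambert hq hq1 h1
  obtain ⟨sN, hN⟩ := hasSum_lambert hq hq1 h2
  have h3 := (hN.sub hM).mul_left (2 * I)
  have h4 := (h3.tendsto_sum_nat).const_add (Complex.cot (π / L * z))
  have h5 : (fun M : ℕ => ∑ n ∈ Finset.Icc (-(M : ℤ)) (M : ℤ),
      Complex.cot ((π / L : ℂ) * (z - 2 * I * n * δ))) = fun M : ℕ => Complex.cot (π / L * z) +
      ∑ n ∈ Finset.range M, 2 * I * ((nome L δ : ℂ) ^ (n + 1) * mode L (-1) z /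
        (1 - (nome L δ : ℂ) ^ (n + 1) * mode L (-1) z)
      - (nome L δ : ℂ) ^ (n + 1) * mode L 1 z / (1 - (nome L δ : ℂ) ^ (n + 1) * mode L 1 z)) := by
    funext M
    rw [sum_Icc_symm]
    congr 1
    · simp
    · exact Finset.sum_congr rfl fun n _ => cot_pair hL hδ hz n
  rw [← h5] at h4
  rw [zeta1, h4.limUnder_eq]
  have h6 : HasSum (fun n : ℕ => regCoef L δ ((n : ℤ) + 1) * mode L ((n : ℤ) + 1) z)
      (-(2 * π * I / L) * ∑' m : ℕ, (nome L δ : ℂ) ^ (m + 1) / (1 - (nome L δ : ℂ) ^ (m + 1))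
        * mode L 1 z ^ (m + 1)) := by
    refine (sM.hasSum.mul_left _).congr_fun fun n => ?_
    have a1 : ((n : ℤ) + 1).natAbs = n + 1 := by omega
    have a2 : ((n : ℤ) + 1).sign = 1 := Int.sign_eq_one_of_pos (by omega)
    rw [regCoef, a1, a2, mode_pow]
    push_cast
    ring_nf
  have h7 : HasSum (fun n : ℕ => regCoef L δ (-((n : ℤ) + 1)) * mode L (-((n : ℤ) + 1)) z)
      (2 * π * I / L * ∑' m : ℕ, (nome L δ : ℂ) ^ (m + 1) / (1 - (nome L δ : ℂ) ^ (m + 1))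
        * mode L (-1) z ^ (m + 1)) := by
    refine (sN.hasSum.mul_left _).congr_fun fun n => ?_
    have a1 : (-((n : ℤ) + 1)).natAbs = n + 1 := by omega
    have a2 : (-((n : ℤ) + 1)).sign = -1 := Int.sign_eq_neg_one_of_neg (by omega)
    rw [regCoef, a1, a2, mode_pow]
    push_cast
    ring_nf
  have h8 := HasSum.of_add_one_of_neg_add_one (f := fun n : ℤ => regCoef L δ n * mode L n z) h6 h7
  convert! h8 using 1
  simp only [regCoef, Int.sign_zero]
  push_cast
  ring

/-- `2πnδ/L`. -/
def freq (L δ : ℝ) (n : ℤ) : ℝ := 2 * π * n * δ / L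

/-- `coth (2πnδ/L)`, with value `0` at `n = 0`. -/
def cothSym (L δ : ℝ) (n : ℤ) : ℂ := ((Real.cosh (freq L δ n) / Real.sinh (freq L δ n) : ℝ) : ℂ)

/-- `1 / sinh (2πnδ/L)`, with value `0` at `n = 0`. -/
def cschSym (L δ : ℝ) (n : ℤ) : ℂ := ((1 / Real.sinh (freq L δ n) : ℝ) : ℂ)

theorem freq_neg (L δ : ℝ) (n : ℤ) : freq L δ (-n) = -freq L δ n := by
  rw [freq, freq]; push_cast; ring

theorem freq_ne_zero {L δ : ℝ} (hL : 0 < L) (hδ : 0 < δ) {n : ℤ} (hn : n ≠ 0) :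
    freq L δ n ≠ 0 := by
  have : (n : ℝ) ≠ 0 := by exact_mod_cast hn
  rw [freq]
  positivity

theorem sinh_freq_ne_zero {L δ : ℝ} (hL : 0 < L) (hδ : 0 < δ) {n : ℤ} (hn : n ≠ 0) :
    Real.sinh (freq L δ n) ≠ 0 := by
  rw [Ne, Real.sinh_eq_zero]; exact freq_ne_zero hL hδ hn

theorem cothSym_neg (L δ : ℝ) (n : ℤ) : cothSym L δ (-n) = -cothSym L δ n := by
  rw [cothSym, cothSym, freq_neg, Real.sinh_neg, Real.cosh_neg, div_neg, Complex.ofReal_neg]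

theorem cothSym_zero (L δ : ℝ) : cothSym L δ 0 = 0 := by simp [cothSym, freq]

theorem cschSym_zero (L δ : ℝ) : cschSym L δ 0 = 0 := by simp [cschSym, freq]

theorem exp_two_mul_ne_one {s : ℝ} (hs : s ≠ 0) : 1 - Real.exp (2 * s) ≠ 0 := by
  intro h
  have : Real.exp (2 * s) = 1 := by linarith
  rw [Real.exp_eq_one_iff] at this
  exact hs (by linarith)

theorem coth_eq_exp {s : ℝ} (hs : s ≠ 0) :
    Real.cosh s / Real.sinh s = 1 - 2 / (1 - Real.exp (2 * s)) := by
  have h1 := exp_two_mul_ne_one hs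
  have h2 : Real.sinh s ≠ 0 := by rwa [Ne, Real.sinh_eq_zero]
  have h3 := Real.exp_pos s
  rw [div_eq_iff h2, Real.sinh_eq, Real.cosh_eq]
  have e1 : Real.exp (2 * s) = Real.exp s ^ 2 := by rw [← Real.exp_nat_mul]; norm_num
  have e2 : Real.exp (-s) = (Real.exp s)⁻¹ := Real.exp_neg s
  rw [e1] at h1 ⊢
  rw [e2]
  field_simp
  ring

theorem csch_eq_exp {s : ℝ} (hs : s ≠ 0) :
    1 / Real.sinh s = -(2 * Real.exp s) / (1 - Real.exp (2 * s)) := by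
  have h1 := exp_two_mul_ne_one hs
  have h2 : Real.sinh s ≠ 0 := by rwa [Ne, Real.sinh_eq_zero]
  have h3 := Real.exp_pos s
  rw [div_eq_div_iff h2 h1, Real.sinh_eq]
  have e1 : Real.exp (2 * s) = Real.exp s ^ 2 := by rw [← Real.exp_nat_mul]; norm_num
  have e2 : Real.exp (-s) = (Real.exp s)⁻¹ := Real.exp_neg s
  rw [e1] at h1 ⊢
  rw [e2]
  field_simp
  ring

/-- For `n > 0`, `2qⁿ / (1 - qⁿ) = coth(2πnδ/L) - 1` with `q = exp(-4πδ/L)`. Both sides are odd in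
`n`. -/
theorem regCoef_eq {L δ : ℝ} (hL : 0 < L) (hδ : 0 < δ) (n : ℤ) :
    regCoef L δ n = -(π * I / L) * (cothSym L δ n - n.sign) := by
  have pos : ∀ m : ℤ, 0 < m → regCoef L δ m = -(π * I / L) * (cothSym L δ m - m.sign) := by
    intro m hm
    have hs := freq_ne_zero hL hδ hm.ne'
    have h1 := exp_two_mul_ne_one hs
    have h0 : nome L δ ^ m.natAbs = (Real.exp (2 * freq L δ m))⁻¹ := by
      rw [nome, ← Real.exp_nat_mul, ← Real.exp_neg]
      congr 1
      have : ((m.natAbs : ℕ) : ℝ) = m := by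
        rw [← Int.cast_natCast, Int.natAbs_of_nonneg hm.le]
      rw [this, freq]
      ring
    have h2 : (nome L δ : ℂ) ^ m.natAbs = ((Real.exp (2 * freq L δ m))⁻¹ : ℝ) := by
      rw [← h0]; push_cast; rfl
    rw [regCoef, cothSym, coth_eq_exp hs, h2, Int.sign_eq_one_of_pos hm]
    have h3 : (Real.exp (2 * freq L δ m)) ≠ 0 := (Real.exp_pos _).ne'
    generalize Real.exp (2 * freq L δ m) = E at *
    have h1' : (1 - E : ℂ) ≠ 0 := by exact_mod_cast h1
    have h3' : (E : ℂ) ≠ 0 := by exact_mod_cast h3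
    have h4' : (E - 1 : ℂ) ≠ 0 := by rw [← neg_sub]; exact neg_ne_zero.mpr h1'
    have key : ((E : ℂ))⁻¹ / (1 - (E : ℂ)⁻¹) = -1 / (1 - E) := by
      have : (1 - (E : ℂ)⁻¹) ≠ 0 := by
        intro h
        rw [sub_eq_zero] at h
        exact h1' (by rw [sub_eq_zero, ← inv_inv (E : ℂ), ← h, inv_one])
      rw [div_eq_div_iff this h1']
      field_simp
      ring
    push_cast
    rw [key]
    ring
  rcases lt_trichotomy n 0 with hn | hn | hn
  · have h1 := pos (-n) (by omega)
    have h2 : regCoef L δ (-n) = -regCoef L δ n := by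
      rw [regCoef, regCoef, Int.natAbs_neg, Int.sign_neg]; push_cast; ring
    rw [h2, cothSym_neg, Int.sign_neg] at h1
    rw [← neg_neg (regCoef L δ n), h1]
    push_cast
    ring
  · subst hn; simp [regCoef, cothSym_zero]
  · exact pos n hn

theorem zeta1_neg {L δ : ℝ} (hL : 0 < L) (hδ : 0 < δ) {z : ℂ} (hz : |z.im| < 2 * δ) :
    zeta1 L δ (-z) = -zeta1 L δ z := by
  have h1 := hasSum_regCoef hL hδ hz
  have h2 := hasSum_regCoef hL hδ (z := -z) (by simpa using hz)
  have h3 := (Equiv.neg ℤ).hasSum_iff.mpr h2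
  have h4 : ((fun n => regCoef L δ n * mode L n (-z)) ∘ (Equiv.neg ℤ))
      = fun n => -(regCoef L δ n * mode L n z) := by
    funext n
    simp only [Function.comp_apply, Equiv.neg_apply]
    rw [mode_neg_arg, neg_neg, regCoef_eq hL hδ, regCoef_eq hL hδ, cothSym_neg, Int.sign_neg]
    push_cast
    ring
  rw [h4] at h3
  have h5 := h3.unique h1.neg
  rw [mul_neg, complex_cot_neg] at h5
  linear_combination h5

/-- Fourier coefficients of `ζ₁` on the strip `-2δ < Im z < 0`. -/
def lowerCoef (L δ : ℝ) (n : ℤ) : ℂ :=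
  -(π * I / L) * (cothSym L δ n - 1)

/-- Below the real axis `|e_{-1}(z)| < 1`, so the central cotangent is a geometric series in
`e_{-1}`. Its coefficients are `-(πi/L)(sign n - 1)`, and adding the regular part replaces `sign n`
by `1`. -/
theorem hasSum_zeta1_lower {L δ : ℝ} (hL : 0 < L) (hδ : 0 < δ) {z : ℂ} (hz : -(2 * δ) < z.im)
    (hz0 : z.im < 0) :
    HasSum (fun n => lowerCoef L δ n * mode L n z) (zeta1 L δ z) := by
  have h1 := hasSum_regCoef hL hδ (z := z) (abs_lt.mpr ⟨hz, by linarith⟩)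
  have hN : ‖mode L (-1) z‖ < 1 := by
    rw [norm_mode, Real.exp_lt_one_iff]
    push_cast
    have : -(2 * π * -1 / L * z.im) = 2 * π / L * z.im := by ring
    rw [this]
    exact mul_neg_of_pos_of_neg (by positivity) hz0
  have h2 := ((hasSum_geometric_of_norm_lt_one hN).mul_left (mode L (-1) z)).mul_left (2 * π * I / L)
  -- Positive modes vanish, negative ones give the geometric series, and `sign 0 = 0` leaves the
  -- constant `πi/L`.
  have h3 := HasSum.of_add_one_of_neg_add_one
    (f := fun n : ℤ => (-(π * I / L) * (n.sign - 1)) * mode L n z) (m := 0)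
    (m' := 2 * π * I / L * (mode L (-1) z * (1 - mode L (-1) z)⁻¹))
    (by
      have a2 : ∀ n : ℕ, ((n : ℤ) + 1).sign = 1 := fun n => Int.sign_eq_one_of_pos (by omega)
      simp only [a2]
      simp)
    (by
      refine h2.congr_fun fun n => ?_
      have a2 : (-((n : ℤ) + 1)).sign = -1 := Int.sign_eq_neg_one_of_neg (by omega)
      rw [a2, ← pow_succ', mode_pow]
      push_cast
      ring_nf)
  have h4 := h1.add h3
  have h5 : ∀ n : ℤ, regCoef L δ n * mode L n z + -(π * I / L) * (n.sign - 1) * mode L n z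
      = lowerCoef L δ n * mode L n z := fun n => by
    rw [regCoef_eq hL hδ, lowerCoef]; ring
  simp only [h5] at h4
  convert! h4 using 1
  rw [cot_eq_mode, mode_zero_index]
  have hMN := mode_mul_neg L 1 z
  have hM0 := mode_ne_zero L 1 z
  generalize mode L (-1) z = N at *
  generalize mode L 1 z = M at *
  have hN1 : 1 - N ≠ 0 := fun h => by
    rw [← sub_eq_zero.mp h, norm_one] at hN; exact lt_irrefl _ hN
  have hM1 : 1 - M ≠ 0 := fun h => by
    rw [← sub_eq_zero.mp h, one_mul] at hMN
    rw [hMN, norm_one] at hN; exact lt_irrefl _ hN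
  have key : (M + 1) / (I * (1 - M)) = I * (1 + 2 * (N * (1 - N)⁻¹)) := by
    rw [div_eq_iff (mul_ne_zero I_ne_zero hM1)]
    have : N * (1 - N)⁻¹ = -(1 - M)⁻¹ := by
      rw [← div_eq_mul_inv, ← one_div, ← neg_div, div_eq_div_iff hN1 hM1]
      linear_combination -hMN
    rw [this]
    field_simp
    linear_combination (1 + M) * I_sq
  rw [key]
  simp
  ring

theorem hasSum_zeta1_upper {L δ : ℝ} (hL : 0 < L) (hδ : 0 < δ) {z : ℂ} (hz : z.im < 2 * δ)
    (hz0 : 0 < z.im) :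
    HasSum (fun n => -(π * I / L) * (cothSym L δ n + 1) * mode L n z) (zeta1 L δ z) := by
  have h1 := hasSum_zeta1_lower hL hδ (z := -z) (by simpa using hz) (by simpa using hz0)
  rw [zeta1_neg hL hδ (abs_lt.mpr ⟨by linarith, hz⟩)] at h1
  have h2 := ((Equiv.neg ℤ).hasSum_iff.mpr h1).neg
  rw [neg_neg] at h2
  refine h2.congr_fun fun n => ?_
  simp only [Function.comp_apply, Equiv.neg_apply]
  rw [mode_neg_arg, neg_neg, lowerCoef, cothSym_neg]
  ring

end

end NcILW

namespace NcILW

noncomputable section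

/-! ### The kernel `ζ₁` on the real line -/

theorem integral_half_symm {f : ℝ → ℂ} (hf : Continuous f) (b : ℝ) :
    ∫ y in (0 : ℝ)..b, (f y + f (-y)) = ∫ y in (-b)..b, f y := by
  have hf' : Continuous fun y => f (-y) := by fun_prop
  rw [intervalIntegral.integral_add (hf.intervalIntegrable _ _) (hf'.intervalIntegrable _ _),
    intervalIntegral.integral_comp_neg, neg_zero, add_comm,
    intervalIntegral.integral_add_adjacent_intervals (hf.intervalIntegrable _ _)
      (hf.intervalIntegrable _ _)]

theorem integral_mode_symm {L : ℝ} (hL : 0 < L) (j : ℤ) :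
    ∫ y in (0 : ℝ)..(L / 2), (mode L j y + mode L (-j) y) = if j = 0 then (L : ℂ) else 0 := by
  have h1 := integral_half_symm (continuous_mode_real L j) (L / 2)
  have h2 : ∀ y : ℝ, mode L j ((-y : ℝ) : ℂ) = mode L (-j) y := fun y => by
    push_cast; exact mode_neg_arg L j y
  simp only [h2] at h1
  rw [h1]
  have h3 := fcoef_mode hL j 0
  have hL' : (L : ℂ) ≠ 0 := by exact_mod_cast hL.ne'
  simp only [fcoef, neg_zero, mode_zero_index, mul_one] at h3
  rw [one_div, inv_mul_eq_iff_eq_mul₀ hL'] at h3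
  rw [h3]
  by_cases hj : j = 0
  · simp [hj]
  · rw [if_neg hj, if_neg (Ne.symm hj), mul_zero]

theorem sin_pi_div_pos {L y : ℝ} (hy : 0 < y) (hyL : y < L) : 0 < Real.sin (π / L * y) := by
  have hL : 0 < L := hy.trans hyL
  refine Real.sin_pos_of_pos_of_lt_pi (by positivity) ?_
  rw [div_mul_eq_mul_div, div_lt_iff₀ hL]
  exact mul_lt_mul_of_pos_left hyL Real.pi_pos

theorem complex_sin_ne_zero {L y : ℝ} (hy : 0 < y) (hyL : y < L) :
    Complex.sin (π / L * (y : ℂ)) ≠ 0 := by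
  have h : ((Real.sin (π / L * y) : ℝ) : ℂ) ≠ 0 := by
    exact_mod_cast (sin_pi_div_pos hy hyL).ne'
  simpa using h

theorem mode_one_ne_one {L y : ℝ} (hy : 0 < y) (hyL : y < L) : 1 - mode L 1 y ≠ 0 := by
  have h := complex_sin_ne_zero hy hyL
  intro h1
  apply h
  rw [Complex.sin]
  have h2 : mode L 1 (y : ℂ) = exp (π / L * (y : ℂ) * I) * exp (π / L * (y : ℂ) * I) := by
    rw [mode, ← Complex.exp_add]; congr 1; push_cast; ring
  have h3 : exp (-(π / L * (y : ℂ)) * I) * exp (π / L * (y : ℂ) * I) = 1 := by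
    rw [← Complex.exp_add]; simp
  rw [h2] at h1
  have h4 := exp_ne_zero (π / L * (y : ℂ) * I)
  have h5 : exp (-(π / L * (y : ℂ)) * I) - exp (π / L * (y : ℂ) * I) = 0 := by
    apply mul_right_cancel₀ h4
    rw [sub_mul, h3, h1, zero_mul]
  rw [h5]; simp

/-- The zero of `e_n - e_{-n}` cancels the pole: `cot · (e_{n+1} - e_{-n-1}) = cot · (e_n - e_{-n})
+ i (e_{n+1} + e_{-n-1} + e_n + e_{-n})`. By induction the product is a trigonometric polynomial.
Among the added terms only `e_0 + e_0`, in the step from `0` to `1`, has a nonzero integral. -/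
theorem cot_mul_modes {L : ℝ} (hL : 0 < L) (n : ℕ) :
    ∃ P : ℝ → ℂ, Continuous P ∧
      (∀ y ∈ Set.Ioc 0 (L / 2), Complex.cot (π / L * (y : ℂ)) * (mode L n y - mode L (-n) y) = P y) ∧
      ∫ y in (0 : ℝ)..(L / 2), P y = if n = 0 then 0 else I * L := by
  induction n with
  | zero => exact ⟨fun _ => 0, continuous_const, fun y _ => by simp, by simp⟩
  | succ n ih =>
    obtain ⟨P, hP, hPe, hPi⟩ := ih
    set e1 : ℝ → ℂ := fun y => mode L (n + 1 : ℤ) y + mode L (-(n + 1 : ℤ)) y with he1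
    set e0 : ℝ → ℂ := fun y => mode L (n : ℤ) y + mode L (-(n : ℤ)) y with he0
    have c1 : Continuous e1 := (continuous_mode_real L _).add (continuous_mode_real L _)
    have c0 : Continuous e0 := (continuous_mode_real L _).add (continuous_mode_real L _)
    refine ⟨fun y => P y + I * (e1 y + e0 y), by fun_prop, fun y hy => ?_, ?_⟩
    · have hy1 := mode_one_ne_one (L := L) hy.1 (by linarith [hy.2])
      beta_reduce
      rw [← hPe y hy, cot_eq_mode, he1, he0]
      have m1 : mode L (((n + 1 : ℕ) : ℤ)) (y : ℂ) = mode L n y * mode L 1 y := by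
        rw [mode_mul]; push_cast; rfl
      have m2 : mode L (-((n + 1 : ℕ) : ℤ)) (y : ℂ) * mode L 1 y = mode L (-n) y := by
        rw [mode_mul]; congr 1; push_cast; ring
      push_cast at m1 m2 ⊢
      rw [m1, ← m2]
      generalize mode L 1 (y : ℂ) = M at *
      generalize mode L (n : ℤ) (y : ℂ) = A at *
      generalize mode L (-((n : ℤ) + 1)) (y : ℂ) = Bn at *
      field_simp
      linear_combination (-(1 - M) * (A * M + Bn + (A + Bn * M))) * I_sq
    · have i1 : Continuous fun y => I * (e1 y + e0 y) := by fun_prop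
      rw [intervalIntegral.integral_add (hP.intervalIntegrable _ _) (i1.intervalIntegrable _ _),
        intervalIntegral.integral_const_mul,
        intervalIntegral.integral_add (c1.intervalIntegrable _ _) (c0.intervalIntegrable _ _),
        hPi, he1, he0, integral_mode_symm hL, integral_mode_symm hL]
      have h0 : ¬ ((n : ℤ) + 1 = 0) := by omega
      rw [if_neg h0, if_neg (Nat.succ_ne_zero n)]
      by_cases hn : n = 0
      · simp [hn]
      · have : ¬ ((n : ℤ) = 0) := by exact_mod_cast hn
        simp [hn]

theorem summable_regCoef {L δ : ℝ} (hL : 0 < L) (hδ : 0 < δ) :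
    Summable fun n => ‖regCoef L δ n‖ := by
  have h := (hasSum_regCoef hL hδ (z := 0) (by simpa using hδ)).summable.norm
  simpa [mode_zero] using h

/-- The regular part of `ζ₁` on the real line. -/
def regPart (L δ : ℝ) (y : ℝ) : ℂ := ∑' n, regCoef L δ n * mode L n y

theorem continuous_regPart {L δ : ℝ} (hL : 0 < L) (hδ : 0 < δ) : Continuous (regPart L δ) :=
  continuous_tsum (fun n => continuous_const.mul (continuous_mode_real L n))
    (summable_regCoef hL hδ) fun n x => by rw [norm_mul, norm_mode_real, mul_one]

theorem zeta1_real {L δ : ℝ} (hL : 0 < L) (hδ : 0 < δ) (y : ℝ) :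
    zeta1 L δ y = π / L * Complex.cot (π / L * y) + regPart L δ y := by
  have h := (hasSum_regCoef hL hδ (z := (y : ℂ)) (by simpa using hδ)).tsum_eq
  rw [regPart, h]; ring

theorem zeta1_real_neg {L δ : ℝ} (hL : 0 < L) (hδ : 0 < δ) (y : ℝ) :
    zeta1 L δ ((-y : ℝ) : ℂ) = -zeta1 L δ y := by
  rw [Complex.ofReal_neg, zeta1_neg hL hδ (by simpa using hδ)]

theorem regPart_neg {L δ : ℝ} (hL : 0 < L) (hδ : 0 < δ) (y : ℝ) :
    regPart L δ (-y) = -regPart L δ y := by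
  have h := zeta1_real_neg hL hδ y
  rw [zeta1_real hL hδ, zeta1_real hL hδ, Complex.ofReal_neg, mul_neg, complex_cot_neg] at h
  linear_combination h

theorem continuousOn_zeta1 {L δ : ℝ} (hL : 0 < L) (hδ : 0 < δ) :
    ContinuousOn (fun y : ℝ => zeta1 L δ y) (Set.Ioo 0 L) := by
  simp only [zeta1_real hL hδ, Complex.cot]
  have h1 : Continuous fun y : ℝ => Complex.cos (π / L * (y : ℂ)) := by fun_prop
  have h2 : Continuous fun y : ℝ => Complex.sin (π / L * (y : ℂ)) := by fun_prop
  exact ((continuousOn_const.mul (h1.continuousOn.div h2.continuousOn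
    fun y hy => complex_sin_ne_zero hy.1 hy.2))).add (continuous_regPart hL hδ).continuousOn

/-- The pole at `0` is simple. Jordan's inequality `sin θ ≥ 2θ/π` on `[0, π/2]` makes this
quantitative for the cotangent. -/
theorem exists_zeta1_bound {L δ : ℝ} (hL : 0 < L) (hδ : 0 < δ) :
    ∃ K : ℝ, ∀ y ∈ Set.Ioc 0 (L / 2), ‖zeta1 L δ (y : ℂ)‖ * y ≤ K := by
  obtain ⟨K, hK⟩ := (isCompact_Icc (a := (0 : ℝ)) (b := L / 2)).exists_bound_of_continuousOn
    (continuous_regPart hL hδ).continuousOn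
  refine ⟨π / 2 + K * (L / 2), fun y hy => ?_⟩
  have hy0 := hy.1
  rw [zeta1_real hL hδ]
  have hs := sin_pi_div_pos (L := L) hy.1 (by linarith [hy.2])
  have h1 : ‖(π / L : ℂ) * Complex.cot (π / L * y)‖ * y ≤ π / 2 := by
    have e : (π / L : ℂ) * Complex.cot (π / L * y)
        = ((π / L * (Real.cos (π / L * y) / Real.sin (π / L * y)) : ℝ) : ℂ) := by
      push_cast; rw [Complex.cot]
    rw [e, Complex.norm_real, Real.norm_eq_abs, abs_mul, abs_div (Real.cos _), abs_of_pos hs,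
      abs_of_pos (by positivity : 0 < π / L)]
    have hθ : π / L * y ≤ π / 2 := by
      rw [div_mul_eq_mul_div, div_le_div_iff₀ hL two_pos]
      nlinarith [Real.pi_pos, hy.2]
    have hj := Real.mul_le_sin (x := π / L * y) (by positivity) hθ
    have hc := Real.abs_cos_le_one (π / L * y)
    rw [mul_div_assoc', div_mul_eq_mul_div, div_le_iff₀ hs]
    have e2 : 2 / π * (π / L * y) = 2 * y / L := by field_simp
    rw [e2] at hj
    calc π / L * |Real.cos (π / L * y)| * y ≤ π / L * 1 * y := by gcongr
      _ = π / 2 * (2 * y / L) := by field_simp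
      _ ≤ π / 2 * Real.sin (π / L * y) := by gcongr
  have h2 : ‖regPart L δ y‖ * y ≤ K * (L / 2) := by
    have := hK y ⟨hy.1.le, hy.2⟩
    have hK0 : 0 ≤ K := (norm_nonneg _).trans this
    exact mul_le_mul this hy.2 hy.1.le hK0
  calc _ ≤ (‖(π / L : ℂ) * Complex.cot (π / L * y)‖ + ‖regPart L δ y‖) * y :=
        mul_le_mul_of_nonneg_right (norm_add_le _ _) hy.1.le
    _ ≤ _ := by rw [add_mul]; exact add_le_add h1 h2

/-- For `n > 0` the cotangent contributes `πi`, and the odd regular part, unfolded to a full period,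
contributes `πi (coth - 1)`. -/
theorem integral_zeta1_modes {L δ : ℝ} (hL : 0 < L) (hδ : 0 < δ) (n : ℤ) :
    ∫ y in (0 : ℝ)..(L / 2), zeta1 L δ y * (mode L n y - mode L (-n) y) = π * I * cothSym L δ n := by
  have hL' : (L : ℂ) ≠ 0 := by exact_mod_cast hL.ne'
  have pos : ∀ n : ℕ, ∫ y in (0 : ℝ)..(L / 2), zeta1 L δ y * (mode L n y - mode L (-n) y)
      = π * I * cothSym L δ n := by
    intro n
    obtain ⟨P, hP, hPe, hPi⟩ := cot_mul_modes hL n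
    set f : ℝ → ℂ := fun y => regPart L δ y * mode L n y with hf
    have hcf : Continuous f := (continuous_regPart hL hδ).mul (continuous_mode_real L n)
    have h1 : ∫ y in (0 : ℝ)..(L / 2), zeta1 L δ y * (mode L n y - mode L (-n) y)
        = ∫ y in (0 : ℝ)..(L / 2), (π / L * P y + (f y + f (-y))) := by
      refine intervalIntegral.integral_congr_ae (Eventually.of_forall fun y hy => ?_)
      rw [Set.uIoc_of_le (by positivity)] at hy
      rw [← hPe y hy, zeta1_real hL hδ, hf]
      simp only [regPart_neg hL hδ]
      have : mode L n ((-y : ℝ) : ℂ) = mode L (-n) y := by push_cast; exact mode_neg_arg L n y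
      rw [this]
      ring
    have c1 : Continuous fun y => (π / L : ℂ) * P y := by fun_prop
    have c2 : Continuous fun y => f y + f (-y) := by fun_prop
    rw [h1, intervalIntegral.integral_add (c1.intervalIntegrable _ _) (c2.intervalIntegrable _ _),
      intervalIntegral.integral_const_mul, hPi, integral_half_symm hcf]
    have h2 := fcoef_series hL (summable_regCoef hL hδ) (-n)
    rw [fcoef, neg_neg, one_div, inv_mul_eq_iff_eq_mul₀ hL'] at h2
    have h3 : ∫ y in (-(L / 2))..(L / 2), f y = L * regCoef L δ (-n) := h2
    rw [h3, regCoef_eq hL hδ, cothSym_neg, Int.sign_neg]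
    by_cases hn : n = 0
    · simp [hn, cothSym_zero]
    · have : (n : ℤ).sign = 1 := Int.sign_eq_one_of_pos (by omega)
      rw [if_neg hn, this]
      push_cast
      field_simp
      ring
  obtain ⟨k, hk | hk⟩ := n.eq_nat_or_neg
  · rw [hk]; exact pos k
  · rw [hk, neg_neg, cothSym_neg, mul_neg, ← pos k, ← intervalIntegral.integral_neg]
    refine intervalIntegral.integral_congr fun y _ => ?_
    ring

end

end NcILW

namespace NcILW

noncomputable section

/-! ### `T` and `T̃` as Fourier multipliers -/

theorem exists_bound_of_periodic {L : ℝ} (hL : 0 < L) {h : ℝ → ℂ} (hp : Function.Periodic h L)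
    (hc : Continuous h) : ∃ K, ∀ x, ‖h x‖ ≤ K := by
  obtain ⟨K, hK⟩ := (isCompact_Icc (a := (0 : ℝ)) (b := L)).exists_bound_of_continuousOn
    hc.continuousOn
  refine ⟨K, fun x => ?_⟩
  obtain ⟨y, hy, hxy⟩ := hp.exists_mem_Ico₀ hL x
  rw [hxy]
  exact hK y ⟨hy.1, hy.2.le⟩

theorem fcoef_shift {L : ℝ} {h : ℝ → ℂ} (hL : 0 < L) (hp : Function.Periodic h L) (y : ℝ) (n : ℤ) :
    fcoef L (fun x => h (x + y)) n = mode L n y * fcoef L h n := by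
  rw [fcoef, fcoef, mul_left_comm]
  congr 1
  have h1 : ∀ x : ℝ, h (x + y) * mode L (-n) x
      = mode L n y * (fun s : ℝ => h s * mode L (-n) s) (x + y) := fun x => by
    have := mode_mul_neg L n y
    simp only
    push_cast
    rw [mode_add]
    linear_combination (-(h (x + y) * mode L (-n) x)) * this
  simp only [h1]
  rw [intervalIntegral.integral_const_mul, intervalIntegral.integral_comp_add_right
    (fun s : ℝ => h s * mode L (-n) s)]
  congr 1
  have hper : Function.Periodic (fun s : ℝ => h s * mode L (-n) s) L := fun s => by
    simp only
    push_cast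
    rw [hp s, mode_add_period hL]
  have h2 := hper.intervalIntegral_add_eq (-(L / 2) + y) (-(L / 2))
  have e1 : -(L / 2) + y + L = L / 2 + y := by ring
  have e2 : -(L / 2) + L = L / 2 := by ring
  rwa [e1, e2] at h2

/-- The integrand of the principal value integral, folded about the pole. -/
def foldT (L δ : ℝ) (h : ℝ → ℂ) (x y : ℝ) : ℂ := zeta1 L δ y * (h (x + y) - h (x - y))

section

variable {L δ : ℝ} {h : ℝ → ℂ}

/-- The difference `h(x+y) - h(x-y)` is `O(y)` uniformly in `x`, which absorbs the simple pole.
Hence the principal value is an ordinary integral of a bounded function. -/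
theorem exists_foldT_bound (hL : 0 < L) (hδ : 0 < δ) (hp : Function.Periodic h L)
    (hh : ContDiff ℝ 1 h) :
    ∃ K : ℝ, 0 ≤ K ∧ ∀ x, ∀ y ∈ Set.Ioc 0 (L / 2), ‖foldT L δ h x y‖ ≤ K := by
  obtain ⟨A, hA⟩ := exists_zeta1_bound hL hδ
  obtain ⟨B, hB⟩ := exists_bound_of_periodic hL (periodic_deriv hp) hh.continuous_deriv_one
  have hA0 : 0 ≤ A := (by positivity : 0 ≤ ‖zeta1 L δ ((L / 2 : ℝ) : ℂ)‖ * (L / 2)).trans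
    (hA (L / 2) ⟨by positivity, le_rfl⟩)
  have hB0 : 0 ≤ B := (norm_nonneg _).trans (hB 0)
  refine ⟨A * (2 * B), by positivity, fun x y hy => ?_⟩
  have h1 : ‖h (x + y) - h (x - y)‖ ≤ B * ‖(x + y) - (x - y)‖ :=
    Convex.norm_image_sub_le_of_norm_deriv_le (s := Set.univ)
      (fun z _ => hh.differentiable one_ne_zero z) (fun z _ => hB z) convex_univ trivial trivial
  have h2 : (x + y) - (x - y) = 2 * y := by ring
  rw [h2, Real.norm_of_nonneg (by linarith [hy.1])] at h1
  rw [foldT, norm_mul]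
  calc ‖zeta1 L δ y‖ * ‖h (x + y) - h (x - y)‖ ≤ ‖zeta1 L δ y‖ * (B * (2 * y)) :=
        mul_le_mul_of_nonneg_left h1 (norm_nonneg _)
    _ = (‖zeta1 L δ y‖ * y) * (2 * B) := by ring
    _ ≤ A * (2 * B) := mul_le_mul_of_nonneg_right (hA y hy) (by positivity)

theorem continuousOn_foldT (hL : 0 < L) (hδ : 0 < δ) (hc : Continuous h) :
    ContinuousOn (Function.uncurry (foldT L δ h)) (Set.univ ×ˢ Set.Ioc 0 (L / 2)) := by
  have h1 : ContinuousOn (fun p : ℝ × ℝ => zeta1 L δ (p.2 : ℂ)) (Set.univ ×ˢ Set.Ioc 0 (L / 2)) :=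
    (continuousOn_zeta1 hL hδ).comp continuous_snd.continuousOn fun p hp =>
      ⟨hp.2.1, by linarith [hp.2.2]⟩
  have h2 : Continuous fun p : ℝ × ℝ => h (p.1 + p.2) - h (p.1 - p.2) := by fun_prop
  exact h1.mul h2.continuousOn

theorem intervalIntegrable_foldT (hL : 0 < L) (hδ : 0 < δ) (hp : Function.Periodic h L)
    (hh : ContDiff ℝ 1 h) (x : ℝ) {a b : ℝ} (ha : 0 ≤ a) (hab : a ≤ b) (hb : b ≤ L / 2) :
    IntervalIntegrable (foldT L δ h x) MeasureTheory.volume a b := by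
  obtain ⟨K, _, hK⟩ := exists_foldT_bound hL hδ hp hh
  have hsub : Set.Ioc a b ⊆ Set.Ioc 0 (L / 2) := fun y hy => ⟨ha.trans_lt hy.1, hy.2.trans hb⟩
  rw [intervalIntegrable_iff, Set.uIoc_of_le hab]
  have hc : ContinuousOn (foldT L δ h x) (Set.Ioc a b) :=
    (continuousOn_foldT hL hδ hh.continuous).comp (f := fun y : ℝ => (x, y))
      (by fun_prop) fun y hy => ⟨trivial, hsub hy⟩
  refine MeasureTheory.IntegrableOn.of_bound (by simp) (hc.aestronglyMeasurable measurableSet_Ioc) K ?_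
  exact (MeasureTheory.ae_restrict_iff' measurableSet_Ioc).mpr
    (Eventually.of_forall fun y hy => hK x y (hsub hy))

theorem truncT_eq (hL : 0 < L) (hδ : 0 < δ) (hc : Continuous h) (x : ℝ) {ε : ℝ} (hε : 0 < ε)
    (hεL : ε ≤ L / 2) :
    truncT L δ h x ε = (1 / π : ℂ) * ∫ y in ε..(L / 2), foldT L δ h x y := by
  have hz : ContinuousOn (fun y : ℝ => zeta1 L δ y) (Set.uIcc ε (L / 2)) :=
    (continuousOn_zeta1 hL hδ).mono fun y hy => by
      rw [Set.uIcc_of_le hεL] at hy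
      exact ⟨hε.trans_le hy.1, by linarith [hy.2]⟩
  have c1 : Continuous fun y => h (x + y) := by fun_prop
  have c2 : Continuous fun y => h (x - y) := by fun_prop
  have h1 : ∫ y in (x + ε)..(x + L / 2), zeta1 L δ ((y - x : ℝ) : ℂ) * h y
      = ∫ y in ε..(L / 2), zeta1 L δ y * h (x + y) := by
    rw [← intervalIntegral.integral_comp_add_left
      (fun y => zeta1 L δ ((y - x : ℝ) : ℂ) * h y) x]
    simp only [add_sub_cancel_left]
  have h2 : ∫ y in (x - L / 2)..(x - ε), zeta1 L δ ((y - x : ℝ) : ℂ) * h y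
      = ∫ y in ε..(L / 2), -(zeta1 L δ y * h (x - y)) := by
    rw [← intervalIntegral.integral_comp_sub_left
      (fun y => zeta1 L δ ((y - x : ℝ) : ℂ) * h y) x]
    refine intervalIntegral.integral_congr fun y _ => ?_
    have : x - y - x = -y := by ring
    simp only [this, zeta1_real_neg hL hδ, neg_mul]
  rw [truncT, h1, h2, ← intervalIntegral.integral_add]
  · congr 1
    refine intervalIntegral.integral_congr fun y _ => ?_
    simp only [foldT]
    ring
  · exact (hz.mul c2.continuousOn).neg.intervalIntegrable
  · exact (hz.mul c1.continuousOn).intervalIntegrable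

theorem tendsto_truncT (hL : 0 < L) (hδ : 0 < δ) (hp : Function.Periodic h L)
    (hh : ContDiff ℝ 1 h) (x : ℝ) :
    Tendsto (truncT L δ h x) (𝓝[>] 0)
      (𝓝 ((1 / π : ℂ) * ∫ y in (0 : ℝ)..(L / 2), foldT L δ h x y)) := by
  obtain ⟨K, hK0, hK⟩ := exists_foldT_bound hL hδ hp hh
  have hev : ∀ᶠ ε : ℝ in 𝓝[>] 0, (1 / π : ℂ) * ((∫ y in (0 : ℝ)..(L / 2), foldT L δ h x y)
      - ∫ y in (0 : ℝ)..ε, foldT L δ h x y) = truncT L δ h x ε := by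
    filter_upwards [Ioo_mem_nhdsGT (by positivity : 0 < L / 2)] with ε hε
    rw [truncT_eq hL hδ hh.continuous x hε.1 hε.2.le,
      ← intervalIntegral.integral_add_adjacent_intervals (b := ε)
        (intervalIntegrable_foldT hL hδ hp hh x le_rfl hε.1.le hε.2.le)
        (intervalIntegrable_foldT hL hδ hp hh x hε.1.le hε.2.le le_rfl), add_sub_cancel_left]
  refine Tendsto.congr' hev ?_
  refine Tendsto.const_mul _ ?_
  have h0 : Tendsto (fun ε : ℝ => ∫ y in (0 : ℝ)..ε, foldT L δ h x y) (𝓝[>] 0) (𝓝 0) := by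
    refine squeeze_zero_norm' (a := fun ε => K * |ε - 0|) ?_ ?_
    · filter_upwards [Ioo_mem_nhdsGT (by positivity : 0 < L / 2)] with ε hε
      refine intervalIntegral.norm_integral_le_of_norm_le_const fun y hy => ?_
      rw [Set.uIoc_of_le hε.1.le] at hy
      exact hK x y ⟨hy.1, hy.2.trans hε.2.le⟩
    · have : Continuous fun ε : ℝ => K * |ε - 0| := by fun_prop
      have := this.tendsto 0
      simp only [sub_zero, abs_zero, mul_zero] at this
      simpa only [sub_zero] using this.mono_left nhdsWithin_le_nhds
  simpa using h0.const_sub (∫ y in (0 : ℝ)..(L / 2), foldT L δ h x y)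

theorem tConverges (hL : 0 < L) (hδ : 0 < δ) (hp : Function.Periodic h L)
    (hh : ContDiff ℝ 1 h) (x : ℝ) : TConverges L δ h x :=
  ⟨_, tendsto_truncT hL hδ hp hh x⟩

theorem opT_eq_integral (hL : 0 < L) (hδ : 0 < δ) (hp : Function.Periodic h L)
    (hh : ContDiff ℝ 1 h) (x : ℝ) :
    opT L δ h x = (1 / π : ℂ) * ∫ y in (0 : ℝ)..(L / 2), foldT L δ h x y :=
  (tendsto_truncT hL hδ hp hh x).limUnder_eq

theorem continuous_integral_foldT (hL : 0 < L) (hδ : 0 < δ) (hp : Function.Periodic h L)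
    (hh : ContDiff ℝ 1 h) :
    Continuous fun x => (1 / π : ℂ) * ∫ y in (0 : ℝ)..(L / 2), foldT L δ h x y := by
  obtain ⟨K, hK0, hK⟩ := exists_foldT_bound hL hδ hp hh
  have hh0 := hh.continuous
  refine continuous_const.mul (intervalIntegral.continuous_of_dominated_interval
    (bound := fun _ => K) (fun x => ?_) (fun x => ?_) (by simp) ?_)
  · exact (intervalIntegrable_foldT hL hδ hp hh x le_rfl (by positivity) le_rfl).aestronglyMeasurable_restrict_uIoc
  · refine Eventually.of_forall fun y hy => ?_
    rw [Set.uIoc_of_le (by positivity)] at hy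
    exact hK x y hy
  · refine Eventually.of_forall fun y _ => ?_
    unfold foldT
    fun_prop

/-- After Fubini, a translation by `±y` multiplies the coefficient by `e_{±n}(y)`, and the remaining
integral over `y` is `integral_zeta1_modes`. -/
theorem fcoef_integral_foldT (hL : 0 < L) (hδ : 0 < δ) (hp : Function.Periodic h L)
    (hh : ContDiff ℝ 1 h) (n : ℤ) :
    fcoef L (fun x => (1 / π : ℂ) * ∫ y in (0 : ℝ)..(L / 2), foldT L δ h x y) n
      = I * cothSym L δ n * fcoef L h n := by
  obtain ⟨K, hK0, hK⟩ := exists_foldT_bound hL hδ hp hh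
  have hh0 := hh.continuous
  have hpi : (π : ℂ) ≠ 0 := by exact_mod_cast Real.pi_ne_zero
  rw [fcoef_const_mul]
  have key : fcoef L (fun x => ∫ y in (0 : ℝ)..(L / 2), foldT L δ h x y) n
      = ∫ y in (0 : ℝ)..(L / 2), fcoef L (fun x => foldT L δ h x y) n := by
    simp only [fcoef]
    rw [intervalIntegral.integral_const_mul]
    congr 1
    simp only [← intervalIntegral.integral_mul_const]
    rw [intervalIntegral.integral_of_le (by linarith : -(L / 2) ≤ L / 2)]
    simp only [intervalIntegral.integral_of_le (by linarith : -(L / 2) ≤ L / 2),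
      intervalIntegral.integral_of_le (by linarith : 0 ≤ L / 2)]
    refine MeasureTheory.integral_integral_swap ?_
    rw [MeasureTheory.Measure.prod_restrict]
    have hsub : Set.Ioc (-(L / 2)) (L / 2) ×ˢ Set.Ioc 0 (L / 2) ⊆
      (Set.univ : Set ℝ) ×ˢ Set.Ioc 0 (L / 2) := Set.prod_mono_left (Set.subset_univ _)
    have hm : MeasurableSet (Set.Ioc (-(L / 2)) (L / 2) ×ˢ Set.Ioc 0 (L / 2)) :=
      measurableSet_Ioc.prod measurableSet_Ioc
    have c1 : Continuous fun p : ℝ × ℝ => mode L (-n) (p.1 : ℂ) :=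
      (continuous_mode_real L (-n)).comp continuous_fst
    refine MeasureTheory.IntegrableOn.of_bound (C := K) ?_
      (((continuousOn_foldT hL hδ hh0).mono hsub).mul c1.continuousOn |>.aestronglyMeasurable hm) ?_
    · rw [← MeasureTheory.Measure.volume_eq_prod, MeasureTheory.Measure.volume_eq_prod,
        MeasureTheory.Measure.prod_prod]
      simp only [Real.volume_Ioc]
      exact ENNReal.mul_lt_top ENNReal.ofReal_lt_top ENNReal.ofReal_lt_top
    · refine (MeasureTheory.ae_restrict_iff' hm).mpr (Eventually.of_forall fun p hp => ?_)
      simp only [Function.uncurry]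
      rw [norm_mul, norm_mode_real, mul_one]
      exact hK p.1 p.2 hp.2
  have h2 : ∀ y : ℝ, fcoef L (fun x => foldT L δ h x y) n
      = fcoef L h n * (zeta1 L δ y * (mode L n y - mode L (-n) y)) := fun y => by
    have e1 : (fun x => foldT L δ h x y)
        = fun x => zeta1 L δ y * (h (x + y) - h (x + -y)) := by
      funext x; rw [foldT, sub_eq_add_neg x y]
    rw [e1, fcoef_const_mul, fcoef_sub (by fun_prop) (by fun_prop), fcoef_shift hL hp,
      fcoef_shift hL hp]
    push_cast
    rw [mode_neg_arg]
    ring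
  rw [key]
  simp only [h2]
  rw [intervalIntegral.integral_const_mul, integral_zeta1_modes hL hδ]
  field_simp

theorem sinh_freq_ge (hL : 0 < L) (hδ : 0 < δ) {n : ℤ} (hn : n ≠ 0) :
    Real.sinh (2 * π * δ / L) ≤ |Real.sinh (freq L δ n)| := by
  rw [Real.abs_sinh]
  refine Real.sinh_le_sinh.mpr ?_
  have h1 : freq L δ n = 2 * π * δ / L * n := by rw [freq]; ring
  rw [h1, abs_mul, abs_of_pos (by positivity)]
  refine le_mul_of_one_le_right (by positivity) ?_
  exact_mod_cast Int.one_le_abs hn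

theorem sinh_base_pos (hL : 0 < L) (hδ : 0 < δ) : 0 < Real.sinh (2 * π * δ / L) :=
  Real.sinh_pos_iff.mpr (by positivity)

theorem norm_cschSym_le (hL : 0 < L) (hδ : 0 < δ) (n : ℤ) :
    ‖cschSym L δ n‖ ≤ 1 / Real.sinh (2 * π * δ / L) := by
  have hb := sinh_base_pos hL hδ
  by_cases hn : n = 0
  · rw [hn, cschSym_zero, norm_zero]; positivity
  · rw [cschSym, Complex.norm_real, norm_div, norm_one, Real.norm_eq_abs]
    exact one_div_le_one_div_of_le hb (sinh_freq_ge hL hδ hn)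

theorem norm_cothSym_le (hL : 0 < L) (hδ : 0 < δ) (n : ℤ) :
    ‖cothSym L δ n‖ ≤ 1 + 1 / Real.sinh (2 * π * δ / L) := by
  have hb := sinh_base_pos hL hδ
  by_cases hn : n = 0
  · rw [hn, cothSym_zero, norm_zero]; positivity
  · have h1 := sinh_freq_ge hL hδ hn
    rw [cothSym, Complex.norm_real, norm_div, Real.norm_eq_abs, Real.norm_eq_abs]
    have h2 : |Real.cosh (freq L δ n)| ≤ |Real.sinh (freq L δ n)| + 1 := by
      rw [abs_of_pos (Real.cosh_pos _), Real.abs_sinh, ← Real.cosh_abs]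
      have e1 := Real.cosh_sub_sinh |freq L δ n|
      have e2 : Real.exp (-|freq L δ n|) ≤ 1 := Real.exp_le_one_iff.mpr (by simp)
      linarith
    have h3 : 0 < |Real.sinh (freq L δ n)| := hb.trans_le h1
    rw [div_le_iff₀ h3, add_mul, one_mul]
    have h4 : 1 ≤ 1 / Real.sinh (2 * π * δ / L) * |Real.sinh (freq L δ n)| := by
      rw [one_div, ← div_eq_inv_mul, le_div_iff₀ hb, one_mul]; exact h1
    linarith

theorem norm_I_mul_cothSym_le (hL : 0 < L) (hδ : 0 < δ) (n : ℤ) :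
    ‖I * cothSym L δ n‖ ≤ 1 + 1 / Real.sinh (2 * π * δ / L) := by
  rw [norm_mul, norm_I, one_mul]; exact norm_cothSym_le hL hδ n

theorem norm_I_mul_cschSym_le (hL : 0 < L) (hδ : 0 < δ) (n : ℤ) :
    ‖I * cschSym L δ n‖ ≤ 1 / Real.sinh (2 * π * δ / L) := by
  rw [norm_mul, norm_I, one_mul]; exact norm_cschSym_le hL hδ n

theorem opT_eq_mulOp (hL : 0 < L) (hδ : 0 < δ) (hp : Function.Periodic h L)
    (hh : ContDiff ℝ 1 h) (x : ℝ) :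
    opT L δ h x = mulOp L (fun n => I * cothSym L δ n) h x := by
  rw [opT_eq_integral hL hδ hp hh]
  refine eq_mulOp_of_fcoef (f := fun x => (1 / π : ℂ) * ∫ y in (0 : ℝ)..(L / 2), foldT L δ h x y)
    hL ?_ (continuous_integral_foldT hL hδ hp hh) hp hh (norm_I_mul_cothSym_le hL hδ)
    (fcoef_integral_foldT hL hδ hp hh) x
  intro x
  simp only [foldT]
  have e1 : ∀ y, h (x + L + y) = h (x + y) := fun y => by rw [add_right_comm]; exact hp _
  have e2 : ∀ y, h (x + L - y) = h (x - y) := fun y => by rw [add_sub_right_comm]; exact hp _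
  simp only [e1, e2]

/-- Integration of a continuous function against an absolutely convergent Fourier series. -/
theorem integral_series_mul {K : ℝ → ℂ} {a : ℤ → ℂ} {w : ℂ}
    (hK : ∀ y : ℝ, HasSum (fun n => a n * mode L n (y - w)) (K y)) (hc : Continuous h) (hL : 0 < L) :
    HasSum (fun n => L * a n * mode L n (-w) * fcoef L h (-n))
      (∫ y in (-(L / 2))..(L / 2), K y * h y) := by
  have hL' : (L : ℂ) ≠ 0 := by exact_mod_cast hL.ne'
  have h0 : ∀ (y : ℝ) n, a n * mode L n (y - w) = a n * mode L n (-w) * mode L n y := fun y n => by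
    rw [sub_eq_add_neg, mode_add]; ring
  simp only [h0] at hK
  have hs : Summable fun n => ‖a n * mode L n (-w)‖ := by
    have := (hK 0).summable.norm
    simpa [mode_zero] using this
  have h1 := hasSum_integral_series hs hc (continuous_mode_real L) (norm_mode_real_le L)
    (-(L / 2)) (L / 2)
  simp only [(hK _).tsum_eq] at h1
  refine h1.congr_fun fun n => ?_
  rw [fcoef, neg_neg]
  simp only [mul_comm (h _)]
  field_simp

/-- The shifted kernel lies off the poles, so its Fourier series is integrated termwise. Mean zero
is needed: the true symbol of `T̃` at `n = 0` is `-i`, whereas `cschSym` is `0` there. -/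
theorem opTt_eq_mulOp (hL : 0 < L) (hδ : 0 < δ) (hc : Continuous h) (h0 : fcoef L h 0 = 0) (x : ℝ) :
    opTt L δ h x = mulOp L (fun n => I * cschSym L δ n) h x := by
  have hpi : (π : ℂ) ≠ 0 := by exact_mod_cast Real.pi_ne_zero
  have hL' : (L : ℂ) ≠ 0 := by exact_mod_cast hL.ne'
  have hK : ∀ y : ℝ, HasSum (fun n => -(π * I / L) * (cothSym L δ n + 1) * mode L n (y - (x - I * δ)))
      (zeta1 L δ (((y - x : ℝ) : ℂ) + I * δ)) := fun y => by
    have h1 := hasSum_zeta1_upper hL hδ (z := ((y - x : ℝ) : ℂ) + I * δ)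
      (by simpa using by linarith) (by simpa using hδ)
    have e : (y : ℂ) - (x - I * δ) = ((y - x : ℝ) : ℂ) + I * δ := by push_cast; ring
    simpa only [e] using h1
  -- Integrating `h` against `e_n` produces the coefficient of index `-n`; hence the reindexing.
  have h2 := ((Equiv.neg ℤ).hasSum_iff.mpr (integral_series_mul hK hc hL)).mul_left (1 / π : ℂ)
  rw [opTt, ← h2.tsum_eq, mulOp]
  refine tsum_congr fun n => ?_
  simp only [Function.comp_apply, Equiv.neg_apply, neg_neg]
  by_cases hn : n = 0
  · rw [hn, h0]; simp
  · have hs := freq_ne_zero hL hδ hn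
    have e1 : mode L (-n) (-(x - I * δ)) = mode L n x * Real.exp (freq L δ n) := by
      rw [mode_neg_arg, neg_neg, sub_eq_add_neg, mode_add]
      congr 1
      rw [mode, freq, Complex.ofReal_exp]
      congr 1
      push_cast
      linear_combination (-(2 * π * n * δ / L : ℂ)) * I_sq
    rw [e1, cothSym_neg, cothSym, cschSym, coth_eq_exp hs, csch_eq_exp hs]
    have h3 := exp_two_mul_ne_one hs
    generalize Real.exp (freq L δ n) = E at *
    generalize Real.exp (2 * freq L δ n) = E2 at *
    have h3' : (1 - E2 : ℂ) ≠ 0 := by exact_mod_cast h3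
    push_cast
    field_simp
    ring

end

end

end NcILW

namespace NcILW

noncomputable section

/-! ### The strip and analytic logarithms -/

theorem isOpen_openStrip (δ : ℝ) : IsOpen (openStrip δ) :=
  (isOpen_lt continuous_const Complex.continuous_im).inter
    (isOpen_lt Complex.continuous_im continuous_const)

theorem convex_openStrip (δ : ℝ) : Convex ℝ (openStrip δ) := by
  have : openStrip δ = Complex.imLm ⁻¹' Set.Ioo (-(δ / 2)) (δ / 2) := rfl
  rw [this]
  exact (convex_Ioo _ _).linear_preimage _

theorem openStrip_subset (δ : ℝ) : openStrip δ ⊆ closedStrip δ := fun _ hz => ⟨hz.1.le, hz.2.le⟩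

theorem closedStrip_eq_closure {δ : ℝ} (hδ : 0 < δ) : closedStrip δ = closure (openStrip δ) := by
  have h1 : openStrip δ = Complex.im ⁻¹' Set.Ioo (-(δ / 2)) (δ / 2) := rfl
  have h2 : closedStrip δ = Complex.im ⁻¹' Set.Icc (-(δ / 2)) (δ / 2) := rfl
  rw [h1, h2, Complex.closure_preimage_im, closure_Ioo (by linarith)]

theorem zero_mem_openStrip {δ : ℝ} (hδ : 0 < δ) : (0 : ℂ) ∈ openStrip δ := by
  constructor <;> simp <;> linarith

theorem bdryPlus_mem {δ : ℝ} (hδ : 0 < δ) (x : ℝ) : (x : ℂ) + I * (δ / 2) ∈ closedStrip δ := by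
  have : ((x : ℂ) + I * (δ / 2)).im = δ / 2 := by simp
  exact ⟨by rw [this]; linarith, this.le⟩

theorem bdryMinus_mem {δ : ℝ} (hδ : 0 < δ) (x : ℝ) : (x : ℂ) - I * (δ / 2) ∈ closedStrip δ := by
  have : ((x : ℂ) - I * (δ / 2)).im = -(δ / 2) := by simp
  exact ⟨this.ge, by rw [this]; linarith⟩

theorem logDeriv_of_eq_exp {δ : ℝ} {F f : ℂ → ℂ} (hF : ∀ z ∈ closedStrip δ, F z = exp (f z))
    (hf : DifferentiableOn ℂ f (openStrip δ)) {z : ℂ} (hz : z ∈ openStrip δ) :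
    logDeriv F z = deriv f z := by
  have hn := (isOpen_openStrip δ).mem_nhds hz
  have h1 : F =ᶠ[𝓝 z] fun w => exp (f w) := by
    filter_upwards [hn] with w hw using hF w (openStrip_subset δ hw)
  have h2 := ((hf z hz).differentiableAt hn).hasDerivAt.cexp
  rw [logDeriv_apply, h1.deriv_eq, h1.eq_of_nhds, h2.deriv]
  exact mul_div_cancel_left₀ _ (exp_ne_zero _)

/-- The difference of the two logarithms has zero derivative on the connected open strip, so it is
constant there, and by continuity also on the closure. -/
theorem eq_const_mul_of_logDeriv {δ : ℝ} (hδ : 0 < δ) {F₁ F₂ : ℂ → ℂ} (h₁ : HasAnalyticLog δ F₁)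
    (h₂ : HasAnalyticLog δ F₂) (h : ∀ z ∈ openStrip δ, logDeriv F₁ z = logDeriv F₂ z) :
    ∃ c : ℂ, c ≠ 0 ∧ ∀ z ∈ closedStrip δ, F₂ z = c * F₁ z := by
  obtain ⟨f, hf, hfd, hfc⟩ := h₁
  obtain ⟨g, hg, hgd, hgc⟩ := h₂
  have hconst : ∀ z ∈ openStrip δ, g z - f z = g 0 - f 0 := by
    intro z hz
    refine (isOpen_openStrip δ).is_const_of_deriv_eq_zero (f := fun w => g w - f w)
      (convex_openStrip δ).isPreconnected (hgd.sub hfd) ?_ hz (zero_mem_openStrip hδ)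
    intro w hw
    have hn := (isOpen_openStrip δ).mem_nhds hw
    have d1 := ((hgd w hw).differentiableAt hn).hasDerivAt.sub
      ((hfd w hw).differentiableAt hn).hasDerivAt
    have e := h w hw
    rw [logDeriv_of_eq_exp hf hfd hw, logDeriv_of_eq_exp hg hgd hw] at e
    rw [e, sub_self] at d1
    exact d1.deriv
  have hcl : ∀ z ∈ closedStrip δ, g z - f z = g 0 - f 0 := by
    have : Set.EqOn (fun z => g z - f z) (fun _ => g 0 - f 0) (closedStrip δ) :=
      Set.EqOn.of_subset_closure (s := openStrip δ) hconst (hgc.sub hfc) continuousOn_const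
        (openStrip_subset δ) (closedStrip_eq_closure hδ).le
    exact this
  refine ⟨exp (g 0 - f 0), exp_ne_zero _, fun z hz => ?_⟩
  rw [hf z hz, hg z hz, ← hcl z hz, ← Complex.exp_add, sub_add_cancel]

/-! ### Potentials -/

/-- The symbol of `J ↦ i ∂_z log F`. -/
def potD (L δ : ℝ) (z : ℂ) (n : ℤ) : ℂ := mode L n z / (2 * (Real.sinh (freq L (δ / 2) n) : ℂ))

/-- The symbol of `J ↦ log F`. -/
def potSym (L δ : ℝ) (z : ℂ) (n : ℤ) : ℂ := -(L / (2 * π * n)) * potD L δ z n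

/-- The logarithm `log F` of a solution `F` of `i ∂_z log F = (1/(2πi)) ∫ ζ₁ J`. -/
def potential (L δ : ℝ) (J : ℝ → ℂ) (z : ℂ) : ℂ := ∑' n : ℤ, potSym L δ z n * fcoef L J n

section

variable {L δ : ℝ} {J : ℝ → ℂ}

/-- A bound for the symbols `potD` on the closed strip. -/
def potBound (L δ : ℝ) : ℝ := 1 + 1 / Real.sinh (2 * π * (δ / 2) / L)

theorem potBound_pos (hL : 0 < L) (hδ : 0 < δ) : 0 < potBound L δ := by
  have := sinh_base_pos hL (half_pos hδ)
  rw [potBound]; positivity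

/-- For `|Im z| ≤ δ/2` the mode grows at most like `exp|s|` with `s = πnδ/L`, and `exp|s| ≤ 2|sinh
s| + 1`. The bound holds up to the boundary, so the series yields boundary values. At `n = 0` the
quotient is `0` by convention. -/
theorem norm_potD_le (hL : 0 < L) (hδ : 0 < δ) {z : ℂ} (hz : z ∈ closedStrip δ) (n : ℤ) :
    ‖potD L δ z n‖ ≤ potBound L δ := by
  have hb := sinh_base_pos hL (half_pos hδ)
  by_cases hn : n = 0
  · rw [hn, potD]
    simpa [freq] using (potBound_pos hL hδ).le
  · have h1 := sinh_freq_ge hL (half_pos hδ) hn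
    have h3 : 0 < |Real.sinh (freq L (δ / 2) n)| := hb.trans_le h1
    rw [potD, norm_div, norm_mul, Complex.norm_real, Real.norm_eq_abs, norm_mode]
    have e0 : ‖(2 : ℂ)‖ = 2 := by simp
    rw [e0]
    have h2 : Real.exp (-(2 * π * n / L * z.im)) ≤ Real.exp |freq L (δ / 2) n| := by
      refine Real.exp_le_exp.mpr ((neg_le_abs _).trans ?_)
      rw [freq]
      have e1 : 2 * π * n * (δ / 2) / L = 2 * π * n / L * (δ / 2) := by ring
      rw [e1, abs_mul, abs_mul _ (δ / 2)]
      refine mul_le_mul_of_nonneg_left ?_ (abs_nonneg _)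
      rw [abs_of_pos (half_pos hδ)]
      exact abs_le.mpr hz
    have h4 : Real.exp |freq L (δ / 2) n| ≤ 2 * |Real.sinh (freq L (δ / 2) n)| + 1 := by
      rw [Real.abs_sinh]
      have e1 := Real.cosh_sub_sinh |freq L (δ / 2) n|
      have e2 : Real.exp (-|freq L (δ / 2) n|) ≤ 1 := Real.exp_le_one_iff.mpr (by simp)
      have e3 := Real.cosh_add_sinh |freq L (δ / 2) n|
      linarith
    rw [div_le_iff₀ (by positivity), potBound, add_mul, one_mul]
    have h5 : 1 ≤ 1 / Real.sinh (2 * π * (δ / 2) / L) * |Real.sinh (freq L (δ / 2) n)| := by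
      rw [one_div, ← div_eq_inv_mul, le_div_iff₀ hb, one_mul]; exact h1
    nlinarith

theorem norm_potSym_le (hL : 0 < L) (hδ : 0 < δ) {z : ℂ} (hz : z ∈ closedStrip δ) (n : ℤ) :
    ‖potSym L δ z n‖ ≤ L / (2 * π) * potBound L δ := by
  have hB := potBound_pos hL hδ
  rw [potSym, norm_mul]
  refine mul_le_mul ?_ (norm_potD_le hL hδ hz n) (norm_nonneg _) (by positivity)
  by_cases hn : n = 0
  · rw [hn]; simp; positivity
  · have e : ‖-((L : ℂ) / (2 * π * n))‖ = L / (2 * π) / |(n : ℝ)| := by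
      simp [abs_of_pos hL, abs_of_pos Real.pi_pos]
      field_simp
    rw [e]
    refine div_le_self (by positivity) ?_
    exact_mod_cast Int.one_le_abs hn

theorem continuous_potSym (L δ : ℝ) (n : ℤ) : Continuous fun z => potSym L δ z n := by
  have := continuous_mode L n
  unfold potSym potD
  fun_prop

/-- The factor `-L/(2πn)` is chosen so that multiplication by `2πin/L` leaves `-i`; thus `potSym`
integrates the equation for `i ∂_z log F`. -/
theorem hasDerivAt_potSym (hL : 0 < L) (n : ℤ) (z : ℂ) :
    HasDerivAt (fun z => potSym L δ z n) (-I * potD L δ z n) z := by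
  have hpi : (π : ℂ) ≠ 0 := by exact_mod_cast Real.pi_ne_zero
  have hL' : (L : ℂ) ≠ 0 := by exact_mod_cast hL.ne'
  have h := ((hasDerivAt_mode L n z).div_const
    (2 * (Real.sinh (freq L (δ / 2) n) : ℂ))).const_mul (-(L / (2 * π * n) : ℂ))
  refine h.congr_deriv ?_
  by_cases hn : n = 0
  · rw [hn, potD]; simp [freq]
  · have hn' : (n : ℂ) ≠ 0 := by exact_mod_cast hn
    rw [potD]
    field_simp

theorem summable_potential (hL : 0 < L) (hδ : 0 < δ) (hs : Summable fun n => ‖fcoef L J n‖)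
    {z : ℂ} (hz : z ∈ closedStrip δ) : Summable fun n => potSym L δ z n * fcoef L J n :=
  Summable.of_norm_bounded (hs.mul_left _) fun n => by
    rw [norm_mul]
    exact mul_le_mul_of_nonneg_right (norm_potSym_le hL hδ hz n) (norm_nonneg _)

theorem continuousOn_potential (hL : 0 < L) (hδ : 0 < δ) (hs : Summable fun n => ‖fcoef L J n‖) :
    ContinuousOn (potential L δ J) (closedStrip δ) :=
  continuousOn_tsum
    (fun n => ((continuous_potSym L δ n).mul continuous_const).continuousOn)
    (hs.mul_left (L / (2 * π) * potBound L δ)) fun n z hz => by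
      rw [norm_mul]
      exact mul_le_mul_of_nonneg_right (norm_potSym_le hL hδ hz n) (norm_nonneg _)

theorem hasDerivAt_potential (hL : 0 < L) (hδ : 0 < δ) (hs : Summable fun n => ‖fcoef L J n‖)
    {z : ℂ} (hz : z ∈ openStrip δ) :
    HasDerivAt (potential L δ J) (∑' n, -I * potD L δ z n * fcoef L J n) z :=
  hasDerivAt_tsum_of_isPreconnected (hs.mul_left (potBound L δ)) (isOpen_openStrip δ)
    (convex_openStrip δ).isPreconnected
    (fun n w _ => (hasDerivAt_potSym hL n w).mul_const _)
    (fun n w hw => by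
      rw [norm_mul, norm_mul, norm_neg, norm_I, one_mul]
      exact mul_le_mul_of_nonneg_right (norm_potD_le hL hδ (openStrip_subset δ hw) n)
        (norm_nonneg _))
    hz (summable_potential hL hδ hs (openStrip_subset δ hz)) hz

/-- The kernel argument has imaginary part `-Im z - δ/2`, between `-δ` and `0`: the lower expansion
of `ζ₁` for the parameter `δ/2`. Mean zero of `J` removes the mode `n = 0`, where the kernel
coefficient is nonzero but `potD` is `0`. -/
theorem integral_kernel_eq (hL : 0 < L) (hδ : 0 < δ) (hc : Continuous J) (h0 : fcoef L J 0 = 0)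
    {z : ℂ} (hz : z ∈ openStrip δ) :
    1 / (2 * π * I) * ∫ y in (-(L / 2))..(L / 2), zeta1 L (δ / 2) ((y : ℂ) - z - I * (δ / 2)) * J y
      = ∑' n, potD L δ z n * fcoef L J n := by
  have hpi : (π : ℂ) ≠ 0 := by exact_mod_cast Real.pi_ne_zero
  have hL' : (L : ℂ) ≠ 0 := by exact_mod_cast hL.ne'
  have hK : ∀ y : ℝ, HasSum
      (fun n => lowerCoef L (δ / 2) n * mode L n (y - (z + I * (δ / 2))))
      (zeta1 L (δ / 2) ((y : ℂ) - z - I * (δ / 2))) := fun y => by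
    have him : ((y : ℂ) - z - I * (δ / 2)).im = -z.im - δ / 2 := by simp
    have h1 := hasSum_zeta1_lower hL (half_pos hδ) (z := (y : ℂ) - z - I * (δ / 2))
      (by rw [him]; linarith [hz.2]) (by rw [him]; linarith [hz.1])
    have e : (y : ℂ) - (z + I * (δ / 2)) = y - z - I * (δ / 2) := by ring
    simpa only [e] using h1
  have h2 := ((Equiv.neg ℤ).hasSum_iff.mpr (integral_series_mul hK hc hL)).mul_left
    (1 / (2 * π * I) : ℂ)
  rw [← h2.tsum_eq]
  refine tsum_congr fun n => ?_
  simp only [Function.comp_apply, Equiv.neg_apply, neg_neg]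
  by_cases hn : n = 0
  · rw [hn, h0]; simp
  · have hs := freq_ne_zero hL (half_pos hδ) hn
    have e1 : mode L (-n) (-(z + I * (δ / 2))) = mode L n z * Real.exp (-freq L (δ / 2) n) := by
      rw [mode_neg_arg, neg_neg, mode_add]
      congr 1
      rw [mode, freq, Complex.ofReal_exp]
      congr 1
      push_cast
      linear_combination (π * n * δ / L : ℂ) * I_sq
    have h3 := sinh_freq_ne_zero hL (half_pos hδ) hn
    have h4 := Real.cosh_add_sinh (freq L (δ / 2) n)
    rw [e1, lowerCoef, cothSym_neg, cothSym, potD, Real.exp_neg, ← h4]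
    have h5 : Real.cosh (freq L (δ / 2) n) + Real.sinh (freq L (δ / 2) n) ≠ 0 := by
      rw [h4]; exact (Real.exp_pos _).ne'
    generalize Real.sinh (freq L (δ / 2) n) = S at *
    generalize Real.cosh (freq L (δ / 2) n) = C at *
    have h3' : (S : ℂ) ≠ 0 := by exact_mod_cast h3
    have h5' : (C + S : ℂ) ≠ 0 := by exact_mod_cast h5
    push_cast
    field_simp
    ring

theorem hasAnalyticLog_potential (hL : 0 < L) (hδ : 0 < δ)
    (hs : Summable fun n => ‖fcoef L J n‖) (c : ℂ) :
    HasAnalyticLog δ (fun z => exp (c + potential L δ J z)) :=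
  ⟨fun z => c + potential L δ J z, fun _ _ => rfl,
    fun _ hz => ((hasDerivAt_potential hL hδ hs hz).const_add c).differentiableAt.differentiableWithinAt,
    continuousOn_const.add (continuousOn_potential hL hδ hs)⟩

theorem I_mul_logDeriv_potential (hL : 0 < L) (hδ : 0 < δ) (hc : Continuous J)
    (h0 : fcoef L J 0 = 0) (hs : Summable fun n => ‖fcoef L J n‖) (c : ℂ) {z : ℂ}
    (hz : z ∈ openStrip δ) :
    I * logDeriv (fun w => exp (c + potential L δ J w)) z =
      1 / (2 * π * I) * ∫ y in (-(L / 2))..(L / 2),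
        zeta1 L (δ / 2) ((y : ℂ) - z - I * (δ / 2)) * J y := by
  have h1 := (hasDerivAt_potential hL hδ hs hz).const_add c
  rw [integral_kernel_eq hL hδ hc h0 hz, logDeriv_apply, h1.cexp.deriv,
    mul_div_cancel_left₀ _ (exp_ne_zero _)]
  simp only [mul_assoc]
  rw [tsum_mul_left, ← mul_assoc]
  simp

theorem potential_add_period (hL : 0 < L) (z : ℂ) :
    potential L δ J (z + L) = potential L δ J z := by
  simp only [potential, potSym, potD, mode_add_period hL]

theorem isHirotaPotential_unique (hδ : 0 < δ) {K : ℝ → ℝ → ℂ} {F₁ F₂ : ℂ → ℝ → ℂ}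
    (h₁ : IsHirotaPotential L δ K F₁) (h₂ : IsHirotaPotential L δ K F₂) :
    ∃ c : ℝ → ℂ, ∀ t, c t ≠ 0 ∧ ∀ z ∈ closedStrip δ, F₂ z t = c t * F₁ z t := by
  have : ∀ t, ∃ c : ℂ, c ≠ 0 ∧ ∀ z ∈ closedStrip δ, F₂ z t = c * F₁ z t := fun t =>
    eq_const_mul_of_logDeriv hδ (h₁ t).1 (h₂ t).1 fun z hz =>
      mul_left_cancel₀ I_ne_zero (((h₁ t).2 z hz).trans ((h₂ t).2 z hz).symm)
  choose c hc using this
  exact ⟨c, hc⟩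

/-- Admissible right-hand sides: continuous, of mean zero, with summable Fourier coefficients. -/
def Admissible (L : ℝ) (J : ℝ → ℂ) : Prop :=
  Continuous J ∧ fcoef L J 0 = 0 ∧ Summable fun n => ‖fcoef L J n‖

theorem exists_isHirotaPotential (hL : 0 < L) (hδ : 0 < δ) {K : ℝ → ℝ → ℂ}
    (hK : ∀ t, Admissible L (fun y => K y t)) (c : ℝ → ℂ) (hc : ∀ t, c t ≠ 0) :
    ∃ F : ℂ → ℝ → ℂ, IsHirotaPotential L δ K F ∧ ∀ t, F 0 t = c t := by
  refine ⟨fun z t => exp ((Complex.log (c t) - potential L δ (fun y => K y t) 0)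
    + potential L δ (fun y => K y t) z), fun t => ⟨?_, fun z hz => ?_⟩, fun t => ?_⟩
  · exact hasAnalyticLog_potential hL hδ (hK t).2.2 _
  · exact I_mul_logDeriv_potential hL hδ (hK t).1 (hK t).2.1 (hK t).2.2 _ hz
  · beta_reduce
    rw [sub_add_cancel, Complex.exp_log (hc t)]

/-- Uniqueness, applied against the explicit series solution, makes every solution explicit once its
value at `z = 0` is given. -/
theorem isHirotaPotential_eq (hL : 0 < L) (hδ : 0 < δ) {K : ℝ → ℝ → ℂ} {F : ℂ → ℝ → ℂ}
    (hK : ∀ t, Admissible L (fun y => K y t)) (hF : IsHirotaPotential L δ K F) :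
    ∀ t, F 0 t ≠ 0 ∧ ∀ z ∈ closedStrip δ, F z t = F 0 t *
      exp (potential L δ (fun y => K y t) z - potential L δ (fun y => K y t) 0) := by
  have key : IsHirotaPotential L δ K fun z t => exp (0 + potential L δ (fun y => K y t) z) :=
    fun t => ⟨hasAnalyticLog_potential hL hδ (hK t).2.2 _, fun z hz =>
      I_mul_logDeriv_potential hL hδ (hK t).1 (hK t).2.1 (hK t).2.2 _ hz⟩
  obtain ⟨c, hc⟩ := isHirotaPotential_unique hδ key hF
  intro t
  have h0 := (hc t).2 0 (openStrip_subset δ (zero_mem_openStrip hδ))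
  refine ⟨by rw [h0]; exact mul_ne_zero (hc t).1 (exp_ne_zero _), fun z hz => ?_⟩
  rw [h0, (hc t).2 z hz, mul_assoc, ← Complex.exp_add]
  congr 2
  ring

end

end

end NcILW

namespace NcILW

noncomputable section

/-! ### Partial derivatives of functions on the plane -/

section Partial

variable {u w : ℝ → ℝ → ℂ}

theorem contDiff_slice_x {n : WithTop ℕ∞} (hu : ContDiff ℝ n fun p : ℝ × ℝ => u p.1 p.2) (t : ℝ) :
    ContDiff ℝ n fun x => u x t :=
  hu.comp (contDiff_id.prodMk contDiff_const)

theorem contDiff_slice_t {n : WithTop ℕ∞} (hu : ContDiff ℝ n fun p : ℝ × ℝ => u p.1 p.2) (x : ℝ) :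
    ContDiff ℝ n fun t => u x t :=
  hu.comp (contDiff_const.prodMk contDiff_id)

theorem hasDerivAt_dx (hu : ContDiff ℝ 1 fun p : ℝ × ℝ => u p.1 p.2) (x t : ℝ) :
    HasDerivAt (fun y => u y t) (dx u x t) x :=
  ((contDiff_slice_x hu t).differentiable one_ne_zero x).hasDerivAt

theorem hasDerivAt_dt (hu : ContDiff ℝ 1 fun p : ℝ × ℝ => u p.1 p.2) (x t : ℝ) :
    HasDerivAt (fun s => u x s) (dt u x t) t :=
  ((contDiff_slice_t hu x).differentiable one_ne_zero t).hasDerivAt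

theorem dx_eq_fderiv (hu : ContDiff ℝ 1 fun p : ℝ × ℝ => u p.1 p.2) (x t : ℝ) :
    dx u x t = fderiv ℝ (fun p : ℝ × ℝ => u p.1 p.2) (x, t) (1, 0) := by
  have h1 := (hu.differentiable one_ne_zero (x, t)).hasFDerivAt
  have h2 : HasDerivAt (fun y : ℝ => (y, t)) (1, 0) x :=
    (hasDerivAt_id x).prodMk (hasDerivAt_const x t)
  exact (h1.comp_hasDerivAt x h2).deriv

theorem dt_eq_fderiv (hu : ContDiff ℝ 1 fun p : ℝ × ℝ => u p.1 p.2) (x t : ℝ) :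
    dt u x t = fderiv ℝ (fun p : ℝ × ℝ => u p.1 p.2) (x, t) (0, 1) := by
  have h1 := (hu.differentiable one_ne_zero (x, t)).hasFDerivAt
  have h2 : HasDerivAt (fun s : ℝ => (x, s)) (0, 1) t :=
    (hasDerivAt_const t x).prodMk (hasDerivAt_id t)
  exact (h1.comp_hasDerivAt t h2).deriv

theorem contDiff_dx {n : ℕ} (hu : ContDiff ℝ ((n + 1 : ℕ) : WithTop ℕ∞) fun p : ℝ × ℝ => u p.1 p.2) :
    ContDiff ℝ n fun p : ℝ × ℝ => dx u p.1 p.2 := by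
  have h1 : ContDiff ℝ 1 fun p : ℝ × ℝ => u p.1 p.2 := hu.of_le (by
    push_cast; exact le_add_self)
  have h2 : (fun p : ℝ × ℝ => dx u p.1 p.2)
      = fun p => fderiv ℝ (fun p : ℝ × ℝ => u p.1 p.2) p (1, 0) := by
    funext p; exact dx_eq_fderiv h1 p.1 p.2
  rw [h2]
  exact (hu.fderiv_right (m := n) (by push_cast; rfl)).clm_apply contDiff_const

theorem contDiff_dt {n : ℕ} (hu : ContDiff ℝ ((n + 1 : ℕ) : WithTop ℕ∞) fun p : ℝ × ℝ => u p.1 p.2) :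
    ContDiff ℝ n fun p : ℝ × ℝ => dt u p.1 p.2 := by
  have h1 : ContDiff ℝ 1 fun p : ℝ × ℝ => u p.1 p.2 := hu.of_le (by
    push_cast; exact le_add_self)
  have h2 : (fun p : ℝ × ℝ => dt u p.1 p.2)
      = fun p => fderiv ℝ (fun p : ℝ × ℝ => u p.1 p.2) p (0, 1) := by
    funext p; exact dt_eq_fderiv h1 p.1 p.2
  rw [h2]
  exact (hu.fderiv_right (m := n) (by push_cast; rfl)).clm_apply contDiff_const

theorem dt_dx_comm (hu : ContDiff ℝ 2 fun p : ℝ × ℝ => u p.1 p.2) (x t : ℝ) :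
    dt (dx u) x t = dx (dt u) x t := by
  have h1 : ContDiff ℝ 1 fun p : ℝ × ℝ => u p.1 p.2 := hu.of_le (by norm_num)
  have hf : ContDiff ℝ 1 (fderiv ℝ fun p : ℝ × ℝ => u p.1 p.2) :=
    hu.fderiv_right (m := 1) (by norm_num)
  have hx : ContDiff ℝ 1 fun p : ℝ × ℝ => dx u p.1 p.2 := contDiff_dx (n := 1) hu
  have ht : ContDiff ℝ 1 fun p : ℝ × ℝ => dt u p.1 p.2 := contDiff_dt (n := 1) hu
  have hd := (hf.differentiable one_ne_zero (x, t)).hasFDerivAt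
  have ex : (fun p : ℝ × ℝ => dx u p.1 p.2)
      = fun p => fderiv ℝ (fun p : ℝ × ℝ => u p.1 p.2) p (1, 0) := by
    funext p; exact dx_eq_fderiv h1 p.1 p.2
  have et : (fun p : ℝ × ℝ => dt u p.1 p.2)
      = fun p => fderiv ℝ (fun p : ℝ × ℝ => u p.1 p.2) p (0, 1) := by
    funext p; exact dt_eq_fderiv h1 p.1 p.2
  rw [dt_eq_fderiv hx, dx_eq_fderiv ht, ex, et]
  have e1 := (hd.clm_apply (hasFDerivAt_const ((1, 0) : ℝ × ℝ) (x, t))).fderiv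
  have e2 := (hd.clm_apply (hasFDerivAt_const ((0, 1) : ℝ × ℝ) (x, t))).fderiv
  rw [e1, e2]
  have hsymm := (hu.contDiffAt (x := (x, t))).isSymmSndFDerivAt (by simp)
  simpa using hsymm.eq (0, 1) (1, 0)

end Partial

/-! ### Time derivatives of Fourier multipliers -/

section Time

variable {L : ℝ} {u : ℝ → ℝ → ℂ}

theorem hasDerivAt_fcoef_time (hu : ContDiff ℝ 2 fun p : ℝ × ℝ => u p.1 p.2) (n : ℤ) (t : ℝ) :
    HasDerivAt (fun s => fcoef L (fun x => u x s) n) (fcoef L (fun x => dt u x t) n) t := by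
  have h1 : ContDiff ℝ 1 fun p : ℝ × ℝ => u p.1 p.2 := hu.of_le (by norm_num)
  have ht : ContDiff ℝ 1 fun p : ℝ × ℝ => dt u p.1 p.2 := contDiff_dt (n := 1) hu
  obtain ⟨K, hK⟩ := ((isCompact_uIcc (a := -(L / 2)) (b := L / 2)).prod
    (isCompact_Icc (a := t - 1) (b := t + 1))).exists_bound_of_continuousOn
      ht.continuous.continuousOn
  have hm := continuous_mode_real L (-n)
  refine HasDerivAt.const_mul _ ?_
  refine (intervalIntegral.hasDerivAt_integral_of_dominated_loc_of_deriv_le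
    (F := fun s x => u x s * mode L (-n) x) (F' := fun s x => dt u x s * mode L (-n) x)
    (s := Set.Ioo (t - 1) (t + 1)) (bound := fun _ => K) (Ioo_mem_nhds (by linarith) (by linarith))
    ?_ ?_ ?_ ?_ ?_ ?_).2
  · refine Eventually.of_forall fun s => ?_
    have := (contDiff_slice_x h1 s).continuous
    exact (this.mul hm).aestronglyMeasurable
  · exact (((contDiff_slice_x h1 t).continuous).mul hm).intervalIntegrable _ _
  · exact (((contDiff_slice_x ht t).continuous).mul hm).aestronglyMeasurable
  · refine Eventually.of_forall fun x hx s hs => ?_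
    rw [norm_mul, norm_mode_real, mul_one]
    exact hK (x, s) ⟨Set.uIoc_subset_uIcc hx, hs.1.le, hs.2.le⟩
  · simp
  · exact Eventually.of_forall fun x _ s _ => (hasDerivAt_dt h1 x s).mul_const _

/-- A summable majorant for the Fourier coefficients of `C²` functions. -/
def decay (L : ℝ) (n : ℤ) : ℝ := (if n = 0 then 1 else 0) + (L / (2 * π)) ^ 2 * (1 / (n : ℝ) ^ 2)

theorem summable_decay (L : ℝ) : Summable (decay L) :=
  (summable_of_ne_finset_zero (s := {0}) fun n hn => by simp at hn; simp [hn]).add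
    (summable_one_div_int_sq.mul_left _)

theorem norm_fcoef_le_decay (hL : 0 < L) {h : ℝ → ℂ} (hp : Function.Periodic h L)
    (hh : ContDiff ℝ 2 h) {K : ℝ} (hK : ∀ x ∈ Set.Icc (-(L / 2)) (L / 2), ‖h x‖ ≤ K)
    (hK2 : ∀ x ∈ Set.Icc (-(L / 2)) (L / 2), ‖deriv (deriv h) x‖ ≤ K) (n : ℤ) :
    ‖fcoef L h n‖ ≤ K * decay L n := by
  have hK0 : 0 ≤ K := (norm_nonneg _).trans (hK 0 ⟨by linarith, by linarith⟩)
  by_cases hn : n = 0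
  · have := norm_fcoef_le hL hK n
    simpa [hn, decay] using this
  · have h1 := fcoef_deriv hL hp (hh.of_le (by norm_num)) n
    have h2 := fcoef_deriv hL (periodic_deriv hp) (hh.deriv' (n := 1)) n
    have h3 := norm_fcoef_le hL hK2 n
    rw [h2, h1, norm_mul, norm_mul, norm_symbol hL] at h3
    have hn' : 0 < |(n : ℝ)| := abs_pos.mpr (by exact_mod_cast hn)
    rw [decay, if_neg hn, zero_add, ← sq_abs (n : ℝ)]
    have e : K * ((L / (2 * π)) ^ 2 * (1 / |(n : ℝ)| ^ 2)) = K / (2 * π / L * |(n : ℝ)|) ^ 2 := by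
      field_simp
    rw [e, le_div_iff₀ (by positivity)]
    linarith

/-- Termwise differentiation in `t`. Since `u` is `C³`, `u_t` is `C²` in `x` with bounds uniform for
`s` near `t`, so its coefficients are `O(n⁻²)` uniformly there. -/
theorem hasDerivAt_tsum_fcoef_time (hL : 0 < L) (hu : ContDiff ℝ 3 fun p : ℝ × ℝ => u p.1 p.2)
    (hp : ∀ t, Function.Periodic (fun x => u x t) L) {m : ℤ → ℂ} {B : ℝ} (hm : ∀ n, ‖m n‖ ≤ B)
    (t : ℝ) :
    HasDerivAt (fun s => ∑' n, m n * fcoef L (fun x => u x s) n)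
      (∑' n, m n * fcoef L (fun x => dt u x t) n) t := by
  have hu2 : ContDiff ℝ 2 fun p : ℝ × ℝ => u p.1 p.2 := hu.of_le (by norm_num)
  have ht : ContDiff ℝ 2 fun p : ℝ × ℝ => dt u p.1 p.2 := contDiff_dt (n := 2) hu
  have htx : ContDiff ℝ 1 fun p : ℝ × ℝ => dx (dt u) p.1 p.2 := contDiff_dx (n := 1) ht
  have htxx : ContDiff ℝ 0 fun p : ℝ × ℝ => dx (dx (dt u)) p.1 p.2 := contDiff_dx (n := 0) htx
  have hcpt := ((isCompact_Icc (a := -(L / 2)) (b := L / 2)).prod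
    (isCompact_Icc (a := t - 1) (b := t + 1)))
  obtain ⟨K, hK⟩ := hcpt.exists_bound_of_continuousOn ht.continuous.continuousOn
  obtain ⟨K', hK'⟩ := hcpt.exists_bound_of_continuousOn htxx.continuous.continuousOn
  have hpt : ∀ s, Function.Periodic (fun x => dt u x s) L := fun s x => by
    simp only [dt]
    congr 1
    funext r
    exact hp r x
  have hB0 : 0 ≤ B := (norm_nonneg _).trans (hm 0)
  have hbd : ∀ s ∈ Set.Ioo (t - 1) (t + 1), ∀ n,
      ‖fcoef L (fun x => dt u x s) n‖ ≤ max K K' * decay L n := fun s hs n =>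
    norm_fcoef_le_decay hL (hpt s) (contDiff_slice_x ht s)
      (fun x hx => (hK (x, s) ⟨hx, hs.1.le, hs.2.le⟩).trans (le_max_left _ _))
      (fun x hx => (hK' (x, s) ⟨hx, hs.1.le, hs.2.le⟩).trans (le_max_right _ _)) n
  have hmem : t ∈ Set.Ioo (t - 1) (t + 1) := ⟨by linarith, by linarith⟩
  refine hasDerivAt_tsum_of_isPreconnected (𝕜 := ℝ)
    (g := fun n s => m n * fcoef L (fun x => u x s) n)
    (g' := fun n s => m n * fcoef L (fun x => dt u x s) n)
    (((summable_decay L).mul_left (max K K')).mul_left B)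
    isOpen_Ioo isPreconnected_Ioo (fun n s _ => (hasDerivAt_fcoef_time hu2 n s).const_mul _)
    (fun n s hs => ?_) hmem ?_ hmem
  · rw [norm_mul]
    exact mul_le_mul (hm n) (hbd s hs n) (norm_nonneg _) hB0
  · exact (summable_mul_fcoef hL (hp t) ((contDiff_slice_x hu2 t).of_le (by norm_num)) hm).of_norm

end Time

end

end NcILW

namespace NcILW

noncomputable section

/-! ### The bilinear equations in logarithmic variables -/

/-- `∂ₓ log P`. -/
def ld (P : ℝ → ℝ → ℂ) (x t : ℝ) : ℂ := dx P x t / P x t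

/-- `ū + i ∂ₓ log (P / Q)`. -/
def uLog (a : ℂ) (P Q : ℝ → ℝ → ℂ) (x t : ℝ) : ℂ := a + I * (ld P x t - ld Q x t)

/-- The expression whose independence of `x` is the bilinear equation. -/
def hirotaE (a : ℂ) (P Q : ℝ → ℝ → ℂ) (x t : ℝ) : ℂ :=
  I * (dt P x t / P x t - dt Q x t / Q x t) + uLog a P Q x t ^ 2 - (dx (ld P) x t + dx (ld Q) x t)

/-- The left-hand side of one bilinear equation. -/
def hirotaForm (a l : ℂ) (P Q : ℝ → ℝ → ℂ) (x t : ℝ) : ℂ :=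
  I * hirotaDt P Q x t - hirotaDxx P Q x t + 2 * I * a * hirotaDx P Q x t
    + (-l + a ^ 2) * (P x t * Q x t)

section

variable {P Q : ℝ → ℝ → ℂ} {a : ℂ}

theorem hasDerivAt_ld {x t : ℝ} (hP : ContDiff ℝ 2 fun y => P y t) (h0 : P x t ≠ 0) :
    HasDerivAt (fun y => ld P y t) (dxx P x t / P x t - ld P x t ^ 2) x := by
  have h1 : HasDerivAt (fun y => P y t) (dx P x t) x :=
    (hP.differentiable two_ne_zero x).hasDerivAt
  have h2 : HasDerivAt (fun y => dx P y t) (dxx P x t) x :=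
    ((hP.deriv' (n := 1)).differentiable one_ne_zero x).hasDerivAt
  refine (h2.div h1 h0).congr_deriv ?_
  rw [ld]
  field_simp

/-- With `p = ∂ₓ log P` and `q = ∂ₓ log Q`, division by `PQ` turns `-D_x² + 2iaD_x + a²` into
`-(p+q)_x - (p-q)² + 2ia(p-q) + a²`. The last three terms are the square `(a + i(p-q))²`. -/
theorem hirotaForm_eq {x t : ℝ} (hP : ContDiff ℝ 2 fun y => P y t)
    (hQ : ContDiff ℝ 2 fun y => Q y t) (hP0 : P x t ≠ 0) (hQ0 : Q x t ≠ 0) (l : ℂ) :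
    hirotaForm a l P Q x t = P x t * Q x t * (hirotaE a P Q x t - l) := by
  have e1 : dx (ld P) x t = dxx P x t / P x t - ld P x t ^ 2 := (hasDerivAt_ld hP hP0).deriv
  have e2 : dx (ld Q) x t = dxx Q x t / Q x t - ld Q x t ^ 2 := (hasDerivAt_ld hQ hQ0).deriv
  rw [hirotaForm, hirotaE, e1, e2, uLog, ld, ld, hirotaDt, hirotaDxx, hirotaDx]
  field_simp
  linear_combination (-(dx P x t * Q x t - P x t * dx Q x t) ^ 2) * I_sq

theorem contDiff_ld {n : ℕ} (hP : ContDiff ℝ ((n + 1 : ℕ) : WithTop ℕ∞) fun p : ℝ × ℝ => P p.1 p.2)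
    (h0 : ∀ x t, P x t ≠ 0) : ContDiff ℝ n fun p : ℝ × ℝ => ld P p.1 p.2 := by
  simp only [ld, div_eq_mul_inv]
  exact (contDiff_dx hP).mul ((hP.of_le (by push_cast; exact le_self_add)).inv fun p => h0 p.1 p.2)

theorem hasDerivAt_dt_log (hP : ContDiff ℝ 2 fun p : ℝ × ℝ => P p.1 p.2)
    (h0 : ∀ x t, P x t ≠ 0) (x t : ℝ) :
    HasDerivAt (fun y => dt P y t / P y t) (dt (ld P) x t) x := by
  have hP1 : ContDiff ℝ 1 fun p : ℝ × ℝ => P p.1 p.2 := hP.of_le (by norm_num)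
  have hx : ContDiff ℝ 1 fun p : ℝ × ℝ => dx P p.1 p.2 := contDiff_dx (n := 1) hP
  have ht : ContDiff ℝ 1 fun p : ℝ × ℝ => dt P p.1 p.2 := contDiff_dt (n := 1) hP
  have e1 := (hasDerivAt_dx ht x t).div (hasDerivAt_dx hP1 x t) (h0 x t)
  have e2 := (hasDerivAt_dt hx x t).div (hasDerivAt_dt hP1 x t) (h0 x t)
  refine e1.congr_deriv ?_
  have e3 : dt (ld P) x t = _ := e2.deriv
  rw [e3, dt_dx_comm hP]
  ring

theorem contDiff_uLog {n : ℕ}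
    (hP : ContDiff ℝ ((n + 1 : ℕ) : WithTop ℕ∞) fun p : ℝ × ℝ => P p.1 p.2)
    (hQ : ContDiff ℝ ((n + 1 : ℕ) : WithTop ℕ∞) fun p : ℝ × ℝ => Q p.1 p.2)
    (hP0 : ∀ x t, P x t ≠ 0) (hQ0 : ∀ x t, Q x t ≠ 0) :
    ContDiff ℝ n fun p : ℝ × ℝ => uLog a P Q p.1 p.2 :=
  contDiff_const.add (contDiff_const.mul ((contDiff_ld hP hP0).sub (contDiff_ld hQ hQ0)))

theorem hasDerivAt_hirotaE (hP : ContDiff ℝ 4 fun p : ℝ × ℝ => P p.1 p.2)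
    (hQ : ContDiff ℝ 4 fun p : ℝ × ℝ => Q p.1 p.2) (hP0 : ∀ x t, P x t ≠ 0)
    (hQ0 : ∀ x t, Q x t ≠ 0) (x t : ℝ) :
    HasDerivAt (fun y => hirotaE a P Q y t)
      (dt (uLog a P Q) x t + 2 * uLog a P Q x t * dx (uLog a P Q) x t
        - (dxx (ld P) x t + dxx (ld Q) x t)) x := by
  have hp : ContDiff ℝ 3 fun p : ℝ × ℝ => ld P p.1 p.2 := contDiff_ld (n := 3) hP hP0
  have hq : ContDiff ℝ 3 fun p : ℝ × ℝ => ld Q p.1 p.2 := contDiff_ld (n := 3) hQ hQ0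
  have hp1 := hp.of_le (m := 1) (by norm_num)
  have hq1 := hq.of_le (m := 1) (by norm_num)
  have hu : ContDiff ℝ 3 fun p : ℝ × ℝ => uLog a P Q p.1 p.2 := contDiff_uLog (n := 3) hP hQ hP0 hQ0
  have hpx : ContDiff ℝ 2 fun p : ℝ × ℝ => dx (ld P) p.1 p.2 := contDiff_dx (n := 2) hp
  have hqx : ContDiff ℝ 2 fun p : ℝ × ℝ => dx (ld Q) p.1 p.2 := contDiff_dx (n := 2) hq
  have d1 := hasDerivAt_dt_log (hP.of_le (by norm_num)) hP0 x t
  have d2 := hasDerivAt_dt_log (hQ.of_le (by norm_num)) hQ0 x t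
  have d3 := hasDerivAt_dx (hu.of_le (by norm_num)) x t
  have d4 := hasDerivAt_dx (hpx.of_le (by norm_num)) x t
  have d5 := hasDerivAt_dx (hqx.of_le (by norm_num)) x t
  have e : dt (uLog a P Q) x t = I * (dt (ld P) x t - dt (ld Q) x t) :=
    ((((hasDerivAt_dt hp1 x t).sub (hasDerivAt_dt hq1 x t)).const_mul I).const_add a).deriv
  refine ((((d1.sub d2).const_mul I).add (d3.pow 2)).sub (d4.add d5)).congr_deriv ?_
  rw [e]
  simp only [dxx]
  simp only [dx]
  push_cast
  ring

/-- The bilinear equation says that `hirotaE` is a function of `t` alone, which its vanishing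
`x`-derivative characterizes. In the converse direction `λ(t)` is the value at `x = 0`. -/
theorem hirotaForm_iff (hP : ContDiff ℝ 4 fun p : ℝ × ℝ => P p.1 p.2)
    (hQ : ContDiff ℝ 4 fun p : ℝ × ℝ => Q p.1 p.2) (hP0 : ∀ x t, P x t ≠ 0)
    (hQ0 : ∀ x t, Q x t ≠ 0) :
    (∃ l : ℝ → ℂ, ∀ x t, hirotaForm a (l t) P Q x t = 0) ↔
      ∀ x t, dt (uLog a P Q) x t + 2 * uLog a P Q x t * dx (uLog a P Q) x t
        - (dxx (ld P) x t + dxx (ld Q) x t) = 0 := by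
  have key : ∀ l : ℝ → ℂ, ∀ x t, hirotaForm a (l t) P Q x t = 0 ↔ hirotaE a P Q x t = l t := by
    intro l x t
    rw [hirotaForm_eq ((contDiff_slice_x hP t).of_le (by norm_num))
      ((contDiff_slice_x hQ t).of_le (by norm_num)) (hP0 x t) (hQ0 x t), mul_eq_zero,
      or_iff_right (mul_ne_zero (hP0 x t) (hQ0 x t)), sub_eq_zero]
  have hd := hasDerivAt_hirotaE (a := a) hP hQ hP0 hQ0
  constructor
  · rintro ⟨l, hl⟩ x t
    have h1 : (fun y => hirotaE a P Q y t) = fun _ => l t := by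
      funext y; exact (key l y t).mp (hl y t)
    have h2 := hd x t
    rw [h1] at h2
    exact h2.unique (hasDerivAt_const x (l t))
  · intro h
    refine ⟨fun t => hirotaE a P Q 0 t, fun x t => (key _ x t).mpr ?_⟩
    refine is_const_of_deriv_eq_zero (f := fun y => hirotaE a P Q y t)
      (fun y => (hd y t).differentiableAt) (fun y => ?_) x 0
    rw [(hd y t).deriv, h y t]

theorem logDeriv_div_eq {x t : ℝ} (hP : DifferentiableAt ℝ (fun y => P y t) x)
    (hQ : DifferentiableAt ℝ (fun y => Q y t) x) (hP0 : P x t ≠ 0) (hQ0 : Q x t ≠ 0) :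
    logDeriv (fun y => P y t / Q y t) x = ld P x t - ld Q x t := by
  have h := hP.hasDerivAt.div hQ.hasDerivAt hQ0
  rw [logDeriv_apply, show (fun y => P y t / Q y t) = (fun y => P y t) / fun y => Q y t from rfl,
    h.deriv, ld, ld, dx, dx]
  field_simp

end

/-! ### Boundary values of analytic logarithms -/

/-- On the boundary lines `log F` is only known to be continuous. Near `x` a continuous logarithm is
`f x` plus the principal logarithm of `F y / F x`, so it inherits differentiability from `F`. -/
theorem hasDerivAt_of_exp {f F : ℝ → ℂ} (hF : ∀ x, F x = exp (f x)) (hf : Continuous f) {x : ℝ}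
    {F' : ℂ} (hd : HasDerivAt F F' x) : HasDerivAt f (F' / F x) x := by
  have hx0 : F x ≠ 0 := by rw [hF]; exact exp_ne_zero _
  have h1 : HasDerivAt (fun y => F y / F x) (F' / F x) x := hd.div_const _
  have h2 : HasDerivAt (fun y => Complex.log (F y / F x)) (F' / F x) x := by
    have := h1.clog_real (by simp [div_self hx0, Complex.one_mem_slitPlane])
    simpa [div_self hx0] using this
  have h3 : f =ᶠ[𝓝 x] fun y => f x + Complex.log (F y / F x) := by
    have hc : Tendsto (fun y => (f y - f x).im) (𝓝 x) (𝓝 0) := by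
      have : Continuous fun y => (f y - f x).im := by fun_prop
      simpa using this.tendsto x
    filter_upwards [hc (Ioo_mem_nhds (neg_lt_zero.mpr Real.pi_pos) Real.pi_pos)] with y hy
    rw [hF, hF, ← Complex.exp_sub, Complex.log_exp hy.1 hy.2.le]
    ring
  exact (h2.const_add (f x)).congr_of_eventuallyEq h3

theorem mode_bdry (L δ : ℝ) (n : ℤ) (x : ℂ) :
    mode L n (x + I * (δ / 2)) = mode L n x * Real.exp (-freq L (δ / 2) n) ∧
    mode L n (x - I * (δ / 2)) = mode L n x * Real.exp (freq L (δ / 2) n) := by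
  rw [sub_eq_add_neg, mode_add, mode_add, mode, mode, mode, freq, Complex.ofReal_exp,
    Complex.ofReal_exp]
  constructor
  · congr 2
    push_cast
    linear_combination (π * n * δ / L : ℂ) * I_sq
  · congr 2
    push_cast
    linear_combination (-(π * n * δ / L : ℂ)) * I_sq

theorem two_mul_freq_half (L δ : ℝ) (n : ℤ) :
    freq L (δ / 2) n + freq L (δ / 2) n = freq L δ n := by
  rw [freq, freq]; ring

/-- Cauchy's theorem for `f · e_{-n}` on one period of the strip. The vertical sides cancel by
periodicity, and `e_{-n}` contributes a factor `exp(±πnδ/L)` on the horizontal sides. -/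
theorem fcoef_bdry {L δ : ℝ} (hL : 0 < L) (hδ : 0 < δ) {f : ℂ → ℂ}
    (hd : DifferentiableOn ℂ f (openStrip δ)) (hc : ContinuousOn f (closedStrip δ))
    (hp : ∀ z ∈ closedStrip δ, f (z + L) = f z) (n : ℤ) :
    fcoef L (fun x => f (x + I * (δ / 2))) n
      = Real.exp (-freq L δ n) * fcoef L (fun x => f (x - I * (δ / 2))) n := by
  set g : ℂ → ℂ := fun z => f z * mode L (-n) z with hg
  set z0 : ℂ := ⟨-(L / 2), -(δ / 2)⟩
  set w0 : ℂ := ⟨L / 2, δ / 2⟩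
  have hle : -(δ / 2) ≤ δ / 2 := by linarith
  have hlt : -(L / 2) ≤ L / 2 := by linarith
  have hmc := continuous_mode L (-n)
  have key := Complex.integral_boundary_rect_eq_zero_of_continuousOn_of_differentiableOn g z0 w0
    (by
      refine ((hc.mul hmc.continuousOn)).mono fun z hz => ?_
      have h2 := hz.2
      simp only [z0, w0, Set.uIcc_of_le hle, Set.mem_preimage] at h2
      exact h2)
    (by
      refine (hd.mul fun z _ => (hasDerivAt_mode L (-n) z).differentiableAt.differentiableWithinAt).mono
        fun z hz => ?_
      have h2 := hz.2
      simp only [z0, w0, min_eq_left hle, max_eq_right hle, Set.mem_preimage] at h2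
      exact h2)
  have hside : ∫ y : ℝ in z0.im..w0.im, g (re w0 + y * I) = ∫ y : ℝ in z0.im..w0.im, g (re z0 + y * I) := by
    refine intervalIntegral.integral_congr fun y hy => ?_
    simp only [z0, w0, Set.uIcc_of_le hle] at hy
    have e : ((re w0 : ℝ) : ℂ) + y * I = ((re z0 : ℝ) : ℂ) + y * I + L := by
      simp only [z0, w0]; push_cast; ring
    simp only [hg, e]
    rw [mode_add_period hL, hp]
    constructor
    · simpa using hy.1
    · simpa using hy.2
  rw [hside] at key
  have k2 : ∫ x : ℝ in (-(L / 2))..(L / 2), g (x + z0.im * I)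
      = ∫ x : ℝ in (-(L / 2))..(L / 2), g (x + w0.im * I) := by
    linear_combination key
  have em : ∀ x : ℝ, g (x + z0.im * I) = (Real.exp (-freq L (δ / 2) n) : ℂ) *
      (f (x - I * (δ / 2)) * mode L (-n) x) := fun x => by
    have e : (x : ℂ) + z0.im * I = x - I * (δ / 2) := by simp only [z0]; push_cast; ring
    simp only [hg, e]
    rw [(mode_bdry L δ (-n) x).2, freq_neg]
    ring
  have ep : ∀ x : ℝ, g (x + w0.im * I) = (Real.exp (freq L (δ / 2) n) : ℂ) *
      (f (x + I * (δ / 2)) * mode L (-n) x) := fun x => by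
    have e : (x : ℂ) + w0.im * I = x + I * (δ / 2) := by simp only [w0]; push_cast; ring
    simp only [hg, e]
    rw [(mode_bdry L δ (-n) x).1, freq_neg, neg_neg]
    ring
  simp only [em, ep] at k2
  rw [intervalIntegral.integral_const_mul, intervalIntegral.integral_const_mul] at k2
  rw [fcoef, fcoef, mul_left_comm]
  congr 1
  have h1 : (Real.exp (freq L (δ / 2) n) : ℂ) * Real.exp (-freq L (δ / 2) n) = 1 := by
    rw [← Complex.ofReal_mul, ← Real.exp_add]; simp
  have h2 : (Real.exp (-freq L δ n) : ℂ)
      = Real.exp (-freq L (δ / 2) n) * Real.exp (-freq L (δ / 2) n) := by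
    rw [← Complex.ofReal_mul, ← Real.exp_add, ← neg_add, two_mul_freq_half]
  rw [h2, mul_assoc, k2]
  linear_combination (-(∫ x : ℝ in (-(L / 2))..(L / 2), f (x + I * (δ / 2)) * mode L (-n) x)) * h1

end

end NcILW

/-! ### Quasi-periodic logarithms and the action of `T`, `T̃` on boundary values -/

namespace NcILW

noncomputable section

theorem add_period_mem_openStrip {L δ : ℝ} {z : ℂ} (hz : z ∈ openStrip δ) :
    z + L ∈ openStrip δ := by
  simpa [openStrip] using hz

theorem add_period_mem_closedStrip {L δ : ℝ} {z : ℂ} (hz : z ∈ closedStrip δ) :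
    z + L ∈ closedStrip δ := by
  simpa [closedStrip] using hz

/-- The exponential of `f(z+L) - f(z)` is identically `1`, so the difference has zero derivative.
The constant is `2πi` times a winding number and need not vanish. -/
theorem log_add_period {L δ : ℝ} (hδ : 0 < δ) {F f : ℂ → ℂ}
    (hF : ∀ z ∈ closedStrip δ, F z = exp (f z)) (hd : DifferentiableOn ℂ f (openStrip δ))
    (hc : ContinuousOn f (closedStrip δ)) (hp : ∀ z ∈ closedStrip δ, F (z + L) = F z) :
    ∃ c : ℂ, ∀ z ∈ closedStrip δ, f (z + L) = f z + c := by
  have hshift : ContinuousOn (fun z => f (z + L)) (closedStrip δ) :=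
    hc.comp (by fun_prop) fun z hz => add_period_mem_closedStrip hz
  have hsd : ∀ z ∈ openStrip δ, HasDerivAt (fun w => f (w + L) - f w)
      (deriv f (z + L) - deriv f z) z := fun z hz => by
    have h1 := ((hd _ (add_period_mem_openStrip (L := L) hz)).differentiableAt
      ((isOpen_openStrip δ).mem_nhds (add_period_mem_openStrip hz))).hasDerivAt
    have h2 := ((hd z hz).differentiableAt ((isOpen_openStrip δ).mem_nhds hz)).hasDerivAt
    exact (h1.comp_add_const z (L : ℂ)).sub h2
  have hz : ∀ z ∈ openStrip δ, deriv f (z + L) - deriv f z = 0 := fun z hz => by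
    have h1 : (fun w => exp (f (w + L) - f w)) =ᶠ[𝓝 z] fun _ => 1 := by
      filter_upwards [(isOpen_openStrip δ).mem_nhds hz] with w hw
      have hw' := openStrip_subset δ hw
      rw [Complex.exp_sub, ← hF w hw', ← hF _ (add_period_mem_closedStrip hw'), hp w hw']
      refine div_self ?_
      rw [hF w hw']; exact exp_ne_zero _
    have h2 := (hsd z hz).cexp.congr_of_eventuallyEq h1.symm
    have h3 := h2.unique (hasDerivAt_const z (1 : ℂ))
    exact (mul_eq_zero.mp h3).resolve_left (exp_ne_zero _)
  refine ⟨f (0 + L) - f 0, ?_⟩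
  have hopen : Set.EqOn (fun z => f (z + L) - f z) (fun _ => f (0 + L) - f 0) (openStrip δ) := by
    intro z hz'
    refine (isOpen_openStrip δ).is_const_of_deriv_eq_zero (f := fun w => f (w + L) - f w)
      (convex_openStrip δ).isPreconnected
      (fun w hw => (hsd w hw).differentiableAt.differentiableWithinAt) ?_ hz'
      (zero_mem_openStrip hδ)
    intro w hw
    rw [(hsd w hw).deriv, hz w hw]
    rfl
  have hcl : Set.EqOn (fun z => f (z + L) - f z) (fun _ => f (0 + L) - f 0) (closedStrip δ) :=
    hopen.of_subset_closure (hshift.sub hc) continuousOn_const (openStrip_subset δ)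
      (closedStrip_eq_closure hδ).le
  intro z hz'
  have := hcl hz'
  simp only at this
  rw [← this]
  ring

theorem contDiff_real_slice_ld {P : ℝ → ℝ → ℂ} {n : ℕ}
    (hP : ContDiff ℝ ((n + 1 : ℕ) : WithTop ℕ∞) fun p : ℝ × ℝ => P p.1 p.2)
    (h0 : ∀ x t, P x t ≠ 0) (t : ℝ) : ContDiff ℝ n fun x => ld P x t :=
  contDiff_slice_x (contDiff_ld hP h0) t

theorem fcoef_deriv_three {L : ℝ} (hL : 0 < L) {h : ℝ → ℂ} (hp : Function.Periodic h L)
    (hh : ContDiff ℝ 3 h) (n : ℤ) :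
    fcoef L (deriv (deriv (deriv h))) n = (2 * π * I * n / L) ^ 3 * fcoef L h n := by
  have h1 : ContDiff ℝ 2 (deriv h) := hh.deriv' (n := 2)
  have h2 : ContDiff ℝ 1 (deriv (deriv h)) := h1.deriv' (n := 1)
  rw [fcoef_deriv hL (periodic_deriv (periodic_deriv hp)) h2,
    fcoef_deriv hL (periodic_deriv hp) (h1.of_le (by norm_num)),
    fcoef_deriv hL hp (hh.of_le (by norm_num))]
  ring

section

variable {L δ : ℝ} {F : ℂ → ℝ → ℂ}

theorem bdry_ne_zero (hδ : 0 < δ) (hlog : ∀ t, HasAnalyticLog δ (fun z => F z t)) (x t : ℝ) :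
    bdryPlus δ F x t ≠ 0 ∧ bdryMinus δ F x t ≠ 0 := by
  obtain ⟨f, hf, -⟩ := hlog t
  beta_reduce at hf
  exact ⟨by rw [bdryPlus, hf _ (bdryPlus_mem hδ x)]; exact exp_ne_zero _,
    by rw [bdryMinus, hf _ (bdryMinus_mem hδ x)]; exact exp_ne_zero _⟩

theorem bdry_periodic (hδ : 0 < δ) (hper : StripPeriodic L δ F) (t : ℝ) :
    Function.Periodic (fun x => bdryPlus δ F x t) L ∧
    Function.Periodic (fun x => bdryMinus δ F x t) L := by
  constructor
  · intro x
    have := hper t _ (bdryPlus_mem hδ x)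
    simp only [bdryPlus]
    rw [← this]
    congr 1; push_cast; ring
  · intro x
    have := hper t _ (bdryMinus_mem hδ x)
    simp only [bdryMinus]
    rw [← this]
    congr 1; push_cast; ring

theorem ld_periodic {P : ℝ → ℝ → ℂ} {t : ℝ} (hp : Function.Periodic (fun x => P x t) L) :
    Function.Periodic (fun x => ld P x t) L := fun x => by
  have h1 := periodic_deriv hp x
  have h2 := hp x
  simp only [ld, dx]
  rw [h1]
  simp only at h2
  rw [h2]

/-- The Fourier coefficients of `∂ₓ³ log F` on the two boundary lines of the strip. -/
theorem fcoef_log_bdry (hL : 0 < L) (hδ : 0 < δ) (hper : StripPeriodic L δ F)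
    (hlog : ∀ t, HasAnalyticLog δ (fun z => F z t)) (hF : BdryContDiff δ 4 F) (t : ℝ) :
    fcoef L (fun y => dxx (ld (bdryMinus δ F)) y t) 0 = 0 ∧
    ∀ n, fcoef L (fun y => dxx (ld (bdryPlus δ F)) y t) n
      = Real.exp (-freq L δ n) * fcoef L (fun y => dxx (ld (bdryMinus δ F)) y t) n := by
  obtain ⟨f, hf, hfd, hfc⟩ := hlog t
  obtain ⟨c, hcp⟩ := log_add_period hδ hf hfd hfc (hper t)
  have hL' : (L : ℂ) ≠ 0 := by exact_mod_cast hL.ne'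
  have hbp : Continuous fun x : ℝ => (x : ℂ) + I * (δ / 2) := by fun_prop
  have hbm : Continuous fun x : ℝ => (x : ℂ) - I * (δ / 2) := by fun_prop
  -- Subtracting the linear function makes the logarithm truly periodic, as `fcoef_bdry` requires.
  -- Higher `x`-derivatives do not see the correction.
  set g : ℂ → ℂ := fun z => f z - c / L * z with hg
  have hgd : DifferentiableOn ℂ g (openStrip δ) := hfd.sub (by fun_prop)
  have hgc : ContinuousOn g (closedStrip δ) := hfc.sub (by fun_prop)
  have hgp : ∀ z ∈ closedStrip δ, g (z + L) = g z := fun z hz => by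
    simp only [hg]; rw [hcp z hz]; field_simp; ring
  have hP : ContDiff ℝ 1 fun p : ℝ × ℝ => bdryPlus δ F p.1 p.2 := hF.1.of_le (by norm_num)
  have hM : ContDiff ℝ 1 fun p : ℝ × ℝ => bdryMinus δ F p.1 p.2 := hF.2.of_le (by norm_num)
  have hlp : ContDiff ℝ 3 fun x => ld (bdryPlus δ F) x t :=
    contDiff_real_slice_ld (n := 3) hF.1 (fun x t => (bdry_ne_zero hδ hlog x t).1) t
  have hlm : ContDiff ℝ 3 fun x => ld (bdryMinus δ F) x t :=
    contDiff_real_slice_ld (n := 3) hF.2 (fun x t => (bdry_ne_zero hδ hlog x t).2) t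
  have hdp : ∀ x : ℝ, HasDerivAt (fun y : ℝ => g (y + I * (δ / 2)))
      (ld (bdryPlus δ F) x t - c / L) x := fun x => by
    have h1 := hasDerivAt_of_exp (F := fun y => bdryPlus δ F y t)
      (f := fun y : ℝ => f (y + I * (δ / 2))) (fun y => hf _ (bdryPlus_mem hδ y))
      (hfc.comp_continuous hbp (bdryPlus_mem hδ)) (hasDerivAt_dx hP x t)
    have h2 : HasDerivAt (fun y : ℝ => c / L * ((y : ℂ) + I * (δ / 2))) (c / L) x := by
      simpa using ((Complex.ofRealCLM.hasDerivAt (x := x)).add_const (I * (δ / 2))).const_mul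
        (c / L : ℂ)
    exact h1.sub h2
  have hdm : ∀ x : ℝ, HasDerivAt (fun y : ℝ => g (y - I * (δ / 2)))
      (ld (bdryMinus δ F) x t - c / L) x := fun x => by
    have h1 := hasDerivAt_of_exp (F := fun y => bdryMinus δ F y t)
      (f := fun y : ℝ => f (y - I * (δ / 2))) (fun y => hf _ (bdryMinus_mem hδ y))
      (hfc.comp_continuous hbm (bdryMinus_mem hδ)) (hasDerivAt_dx hM x t)
    have h2 : HasDerivAt (fun y : ℝ => c / L * ((y : ℂ) - I * (δ / 2))) (c / L) x := by
      simpa using ((Complex.ofRealCLM.hasDerivAt (x := x)).sub_const (I * (δ / 2))).const_mul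
        (c / L : ℂ)
    exact h1.sub h2
  have gen : ∀ (G l : ℝ → ℂ), (∀ x, HasDerivAt G (l x - c / L) x) → ContDiff ℝ 3 l →
      ContDiff ℝ 3 G ∧ deriv (deriv (deriv G)) = deriv (deriv l) := fun G l hG hl => by
    have e1 : deriv G = fun x => l x - c / L := funext fun x => (hG x).deriv
    have e2 : deriv (fun x => l x - c / L) = deriv l := funext fun x => deriv_sub_const _
    refine ⟨?_, by rw [e1, e2]⟩
    have : (3 : WithTop ℕ∞) = 2 + 1 := by norm_num
    rw [this, contDiff_succ_iff_deriv]
    refine ⟨fun x => (hG x).differentiableAt, by simp, ?_⟩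
    rw [e1]
    exact (hl.of_le (by norm_num)).sub contDiff_const
  obtain ⟨gp1, gp2⟩ := gen _ _ hdp hlp
  obtain ⟨gm1, gm2⟩ := gen _ _ hdm hlm
  have pp : Function.Periodic (fun y : ℝ => g (y + I * (δ / 2))) L := fun x => by
    simp only
    rw [← hgp _ (bdryPlus_mem hδ x)]
    congr 1; push_cast; ring
  have pm : Function.Periodic (fun y : ℝ => g (y - I * (δ / 2))) L := fun x => by
    simp only
    rw [← hgp _ (bdryMinus_mem hδ x)]
    congr 1; push_cast; ring
  have cp := fun n => fcoef_deriv_three hL pp gp1 n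
  have cm := fun n => fcoef_deriv_three hL pm gm1 n
  rw [gp2] at cp
  rw [gm2] at cm
  have ep : (fun y => dxx (ld (bdryPlus δ F)) y t)
      = deriv (deriv fun y => ld (bdryPlus δ F) y t) := rfl
  have em : (fun y => dxx (ld (bdryMinus δ F)) y t)
      = deriv (deriv fun y => ld (bdryMinus δ F) y t) := rfl
  rw [ep, em]
  refine ⟨by rw [cm]; simp, fun n => ?_⟩
  rw [cp, cm, fcoef_bdry hL hδ hgd hgc hgp]
  ring

end

section

variable {L δ : ℝ} {f g : ℝ → ℂ} {m : ℤ → ℂ} {B : ℝ}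

theorem mulOp_const_mul (c : ℂ) (f : ℝ → ℂ) (x : ℝ) :
    mulOp L m (fun y => c * f y) x = c * mulOp L m f x := by
  rw [mulOp, mulOp, ← tsum_mul_left]
  refine tsum_congr fun n => ?_
  rw [fcoef_const_mul]; ring

theorem mulOp_sub (hL : 0 < L) (hfp : Function.Periodic f L) (hf : ContDiff ℝ 1 f)
    (hgp : Function.Periodic g L) (hg : ContDiff ℝ 1 g) (hm : ∀ n, ‖m n‖ ≤ B) (x : ℝ) :
    mulOp L m (fun y => f y - g y) x = mulOp L m f x - mulOp L m g x := by
  rw [mulOp, mulOp, mulOp, ← (summable_mulOp hL hfp hf hm x).tsum_sub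
    (summable_mulOp hL hgp hg hm x)]
  refine tsum_congr fun n => ?_
  rw [fcoef_sub hf.continuous hg.continuous]; ring

/-- Boundary values of functions analytic in the strip: `T h⁻ - T̃ h⁺ = i h⁻` and
`T̃ h⁻ - T h⁺ = i h⁺`. -/
theorem mulOp_bdry_relations (hL : 0 < L) (hδ : 0 < δ) (hfp : Function.Periodic f L)
    (hf : ContDiff ℝ 1 f) (hgp : Function.Periodic g L) (hg : ContDiff ℝ 1 g)
    (h0 : fcoef L f 0 = 0) (hfg : ∀ n, fcoef L g n = Real.exp (-freq L δ n) * fcoef L f n) (x : ℝ) :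
    mulOp L (fun n => I * cothSym L δ n) f x - mulOp L (fun n => I * cschSym L δ n) g x = I * f x ∧
    mulOp L (fun n => I * cschSym L δ n) f x - mulOp L (fun n => I * cothSym L δ n) g x
      = I * g x := by
  have hC := norm_I_mul_cothSym_le hL hδ
  have hS := norm_I_mul_cschSym_le hL hδ
  -- With `exp(-s) = cosh s - sinh s` the first relation is immediate and the second is `cosh² -
  -- sinh² = 1`.
  have hsymb : ∀ n : ℤ, n ≠ 0 →
      cothSym L δ n - cschSym L δ n * Real.exp (-freq L δ n) = 1 ∧
      cschSym L δ n - cothSym L δ n * Real.exp (-freq L δ n) = Real.exp (-freq L δ n) := by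
    intro n hn
    have h1 := sinh_freq_ne_zero hL hδ hn
    have h2 : Real.exp (-freq L δ n) = Real.cosh (freq L δ n) - Real.sinh (freq L δ n) :=
      (Real.cosh_sub_sinh _).symm
    have h3 := Real.cosh_sq (freq L δ n)
    rw [cothSym, cschSym, h2]
    constructor
    · norm_cast; field_simp; ring
    · norm_cast; field_simp; linear_combination -h3
  constructor
  · rw [← mulOp_one hL hfp hf x, ← mulOp_const_mul, mulOp, mulOp,
      ← (summable_mulOp hL hfp hf hC x).tsum_sub (summable_mulOp hL hgp hg hS x), mulOp]
    refine tsum_congr fun n => ?_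
    rw [fcoef_const_mul, hfg]
    by_cases hn : n = 0
    · rw [hn, h0]; ring
    · linear_combination (I * fcoef L f n * mode L n x) * (hsymb n hn).1
  · rw [← mulOp_one hL hgp hg x, ← mulOp_const_mul, mulOp, mulOp,
      ← (summable_mulOp hL hfp hf hS x).tsum_sub (summable_mulOp hL hgp hg hC x), mulOp]
    refine tsum_congr fun n => ?_
    rw [fcoef_const_mul, hfg]
    by_cases hn : n = 0
    · rw [hn, h0]; ring
    · linear_combination (I * fcoef L f n * mode L n x) * (hsymb n hn).2

end

end

end NcILW

namespace NcILW

noncomputable section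

/-! ### The bilinear system and the ncILW equation -/

theorem dxx_uLog {P Q : ℝ → ℝ → ℂ} {a : ℂ} {t : ℝ} (hP : ContDiff ℝ 3 fun x => ld P x t)
    (hQ : ContDiff ℝ 3 fun x => ld Q x t) :
    (fun y => dxx (uLog a P Q) y t) = fun y => I * (dxx (ld P) y t - dxx (ld Q) y t) := by
  have h1 : ∀ y, dx (uLog a P Q) y t = I * (dx (ld P) y t - dx (ld Q) y t) := fun y =>
    ((((hP.differentiable (by norm_num) y).hasDerivAt.sub
      (hQ.differentiable (by norm_num) y).hasDerivAt).const_mul I).const_add a).deriv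
  have hP' : ContDiff ℝ 2 fun y => dx (ld P) y t := hP.deriv' (n := 2)
  have hQ' : ContDiff ℝ 2 fun y => dx (ld Q) y t := hQ.deriv' (n := 2)
  funext y
  simp only [dxx]
  rw [funext h1]
  exact (((hP'.differentiable (by norm_num) y).hasDerivAt.sub
      (hQ'.differentiable (by norm_num) y).hasDerivAt).const_mul I).deriv

/-- The second bilinear equation is the first with `ū` replaced by `-v̄` and `(F⁻, G⁺)` by `(F⁺,
G⁻)`; the role of `u` then falls to `-v`. -/
theorem hirotaSystem_iff (δ : ℝ) (ubar vbar : ℂ) (lam1 lam2 : ℝ → ℂ) (F G : ℂ → ℝ → ℂ) :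
    HirotaSystem δ ubar vbar lam1 lam2 F G ↔
      (∀ x t, hirotaForm ubar (lam1 t) (bdryMinus δ F) (bdryPlus δ G) x t = 0) ∧
      ∀ x t, hirotaForm (-vbar) (lam2 t) (bdryPlus δ F) (bdryMinus δ G) x t = 0 := by
  have e2 : ∀ x t, hirotaForm (-vbar) (lam2 t) (bdryPlus δ F) (bdryMinus δ G) x t =
      I * hirotaDt (bdryPlus δ F) (bdryMinus δ G) x t
      - hirotaDxx (bdryPlus δ F) (bdryMinus δ G) x t
      - 2 * I * vbar * hirotaDx (bdryPlus δ F) (bdryMinus δ G) x t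
      + (-lam2 t + vbar ^ 2) * (bdryPlus δ F x t * bdryMinus δ G x t) := fun x t => by
    rw [hirotaForm]; ring
  constructor
  · intro h
    exact ⟨fun x t => (h x t).1, fun x t => (e2 x t).trans (h x t).2⟩
  · intro h x t
    exact ⟨h.1 x t, (e2 x t).symm.trans (h.2 x t)⟩

section

variable {L δ : ℝ} {F G : ℂ → ℝ → ℂ}

theorem uOfFG_eq {ubar : ℂ} (hF0 : ∀ x t, bdryMinus δ F x t ≠ 0)
    (hG0 : ∀ x t, bdryPlus δ G x t ≠ 0)
    (hF : ∀ t, Differentiable ℝ fun x => bdryMinus δ F x t)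
    (hG : ∀ t, Differentiable ℝ fun x => bdryPlus δ G x t) :
    uOfFG δ ubar F G = uLog ubar (bdryMinus δ F) (bdryPlus δ G) := by
  funext x t
  rw [uOfFG, uLog, logDeriv_div_eq (hF t x) (hG t x) (hF0 x t) (hG0 x t)]

theorem vOfFG_eq {vbar : ℂ} (hF0 : ∀ x t, bdryPlus δ F x t ≠ 0)
    (hG0 : ∀ x t, bdryMinus δ G x t ≠ 0)
    (hF : ∀ t, Differentiable ℝ fun x => bdryPlus δ F x t)
    (hG : ∀ t, Differentiable ℝ fun x => bdryMinus δ G x t) :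
    vOfFG δ vbar F G = uLog vbar (bdryMinus δ G) (bdryPlus δ F) := by
  funext x t
  rw [vOfFG, uLog, logDeriv_div_eq (hG t x) (hF t x) (hG0 x t) (hF0 x t)]

theorem uLog_neg_swap (a : ℂ) (P Q : ℝ → ℝ → ℂ) (x t : ℝ) :
    uLog (-a) P Q x t = -uLog a Q P x t := by
  rw [uLog, uLog]; ring

theorem dx_uLog_neg_swap (a : ℂ) (P Q : ℝ → ℝ → ℂ) (x t : ℝ) :
    dx (uLog (-a) P Q) x t = -dx (uLog a Q P) x t := by
  simp only [dx, uLog_neg_swap]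
  exact deriv.fun_neg

theorem dt_uLog_neg_swap (a : ℂ) (P Q : ℝ → ℝ → ℂ) (x t : ℝ) :
    dt (uLog (-a) P Q) x t = -dt (uLog a Q P) x t := by
  simp only [dt, uLog_neg_swap]
  exact deriv.fun_neg

theorem hirota_iff_solvesNcILW (hL : 0 < L) (hδ : 0 < δ)
    (hFp : StripPeriodic L δ F) (hGp : StripPeriodic L δ G)
    (hFl : ∀ t, HasAnalyticLog δ (fun z => F z t)) (hGl : ∀ t, HasAnalyticLog δ (fun z => G z t))
    (hF : BdryContDiff δ 4 F) (hG : BdryContDiff δ 4 G) (ubar vbar : ℂ) :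
    (∃ lam1 lam2 : ℝ → ℂ, HirotaSystem δ ubar vbar lam1 lam2 F G) ↔
      SolvesNcILW L δ (uOfFG δ ubar F G) (vOfFG δ vbar F G) := by
  have hFp0 := fun x t => (bdry_ne_zero hδ hFl x t).1
  have hFm0 := fun x t => (bdry_ne_zero hδ hFl x t).2
  have hGp0 := fun x t => (bdry_ne_zero hδ hGl x t).1
  have hGm0 := fun x t => (bdry_ne_zero hδ hGl x t).2
  have cFp : ContDiff ℝ 4 fun p : ℝ × ℝ => bdryPlus δ F p.1 p.2 := hF.1
  have cFm : ContDiff ℝ 4 fun p : ℝ × ℝ => bdryMinus δ F p.1 p.2 := hF.2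
  have cGp : ContDiff ℝ 4 fun p : ℝ × ℝ => bdryPlus δ G p.1 p.2 := hG.1
  have cGm : ContDiff ℝ 4 fun p : ℝ × ℝ => bdryMinus δ G p.1 p.2 := hG.2
  rw [uOfFG_eq hFm0 hGp0
      (fun t => (contDiff_slice_x cFm t).differentiable (by norm_num))
      (fun t => (contDiff_slice_x cGp t).differentiable (by norm_num)),
    vOfFG_eq hFp0 hGm0
      (fun t => (contDiff_slice_x cFp t).differentiable (by norm_num))
      (fun t => (contDiff_slice_x cGm t).differentiable (by norm_num))]
  set Fm := bdryMinus δ F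
  set Fp := bdryPlus δ F
  set Gm := bdryMinus δ G
  set Gp := bdryPlus δ G
  have lFm : ∀ t, ContDiff ℝ 3 fun x => ld Fm x t := contDiff_real_slice_ld (n := 3) hF.2 hFm0
  have lFp : ∀ t, ContDiff ℝ 3 fun x => ld Fp x t := contDiff_real_slice_ld (n := 3) hF.1 hFp0
  have lGm : ∀ t, ContDiff ℝ 3 fun x => ld Gm x t := contDiff_real_slice_ld (n := 3) hG.2 hGm0
  have lGp : ∀ t, ContDiff ℝ 3 fun x => ld Gp x t := contDiff_real_slice_ld (n := 3) hG.1 hGp0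
  have sm : ∀ {P : ℝ → ℝ → ℂ}, (∀ t, ContDiff ℝ 3 fun x => ld P x t) →
      ∀ t, ContDiff ℝ 1 fun x => dxx (ld P) x t := fun h t =>
    ((h t).deriv' (n := 2)).deriv' (n := 1)
  have pr : ∀ {P : ℝ → ℝ → ℂ}, (∀ t, Function.Periodic (fun x => P x t) L) →
      ∀ t, Function.Periodic (fun x => dxx (ld P) x t) L := fun h t =>
    periodic_deriv (periodic_deriv (ld_periodic (h t)))
  have pFm := pr fun t => (bdry_periodic hδ hFp t).2
  have pFp := pr fun t => (bdry_periodic hδ hFp t).1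
  have pGm := pr fun t => (bdry_periodic hδ hGp t).2
  have pGp := pr fun t => (bdry_periodic hδ hGp t).1
  have hC := norm_I_mul_cothSym_le hL hδ
  have hS := norm_I_mul_cschSym_le hL hδ
  have per2 : ∀ {f g : ℝ → ℂ}, Function.Periodic f L → Function.Periodic g L →
      Function.Periodic (fun y => I * (f y - g y)) L := fun {f g} hf hg x => by
    simp only [hf x, hg x]
  have hT : ∀ {P Q : ℝ → ℝ → ℂ} (a : ℂ), (∀ t, ContDiff ℝ 3 fun x => ld P x t) →
      (∀ t, ContDiff ℝ 3 fun x => ld Q x t) →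
      (∀ t, Function.Periodic (fun x => dxx (ld P) x t) L) →
      (∀ t, Function.Periodic (fun x => dxx (ld Q) x t) L) → ∀ x t,
      TConverges L δ (fun y => dxx (uLog a P Q) y t) x ∧
      opT L δ (fun y => dxx (uLog a P Q) y t) x =
        I * (mulOp L (fun n => I * cothSym L δ n) (fun y => dxx (ld P) y t) x
          - mulOp L (fun n => I * cothSym L δ n) (fun y => dxx (ld Q) y t) x) := by
    intro P Q a hP hQ pP pQ x t
    rw [dxx_uLog (hP t) (hQ t)]
    have hc : ContDiff ℝ 1 fun y => I * (dxx (ld P) y t - dxx (ld Q) y t) :=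
      contDiff_const.mul ((sm hP t).sub (sm hQ t))
    refine ⟨tConverges hL hδ (per2 (pP t) (pQ t)) hc x, ?_⟩
    rw [opT_eq_mulOp hL hδ (per2 (pP t) (pQ t)) hc,
      mulOp_const_mul I (fun y => dxx (ld P) y t - dxx (ld Q) y t),
      mulOp_sub hL (pP t) (sm hP t) (pQ t) (sm hQ t) hC]
  have hTt : ∀ {P Q : ℝ → ℝ → ℂ} (a : ℂ), (∀ t, ContDiff ℝ 3 fun x => ld P x t) →
      (∀ t, ContDiff ℝ 3 fun x => ld Q x t) →
      (∀ t, Function.Periodic (fun x => dxx (ld P) x t) L) →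
      (∀ t, Function.Periodic (fun x => dxx (ld Q) x t) L) →
      (∀ t, fcoef L (fun x => dxx (ld P) x t) 0 = 0) →
      (∀ t, fcoef L (fun x => dxx (ld Q) x t) 0 = 0) → ∀ x t,
      opTt L δ (fun y => dxx (uLog a P Q) y t) x =
        I * (mulOp L (fun n => I * cschSym L δ n) (fun y => dxx (ld P) y t) x
          - mulOp L (fun n => I * cschSym L δ n) (fun y => dxx (ld Q) y t) x) := by
    intro P Q a hP hQ pP pQ zP zQ x t
    rw [dxx_uLog (hP t) (hQ t)]
    have hc : ContDiff ℝ 1 fun y => I * (dxx (ld P) y t - dxx (ld Q) y t) :=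
      contDiff_const.mul ((sm hP t).sub (sm hQ t))
    have hz : fcoef L (fun y => I * (dxx (ld P) y t - dxx (ld Q) y t)) 0 = 0 := by
      rw [fcoef_const_mul I (fun y => dxx (ld P) y t - dxx (ld Q) y t),
        fcoef_sub (sm hP t).continuous (sm hQ t).continuous, zP, zQ]
      ring
    rw [opTt_eq_mulOp hL hδ hc.continuous hz,
      mulOp_const_mul I (fun y => dxx (ld P) y t - dxx (ld Q) y t),
      mulOp_sub hL (pP t) (sm hP t) (pQ t) (sm hQ t) hS]
  have rF := fun t => fcoef_log_bdry hL hδ hFp hFl hF t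
  have rG := fun t => fcoef_log_bdry hL hδ hGp hGl hG t
  have zFm := fun t => (rF t).1
  have zGm := fun t => (rG t).1
  have zFp : ∀ t, fcoef L (fun x => dxx (ld Fp) x t) 0 = 0 := fun t => by
    rw [(rF t).2, (rF t).1, mul_zero]
  have zGp : ∀ t, fcoef L (fun x => dxx (ld Gp) x t) 0 = 0 := fun t => by
    rw [(rG t).2, (rG t).1, mul_zero]
  have bF := fun x t => mulOp_bdry_relations hL hδ (pFm t) (sm lFm t) (pFp t) (sm lFp t)
    (rF t).1 (rF t).2 x
  have bG := fun x t => mulOp_bdry_relations hL hδ (pGm t) (sm lGm t) (pGp t) (sm lGp t)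
    (rG t).1 (rG t).2 x
  -- The four nonlocal terms group into `T ∂ₓ³ log F⁻ - T̃ ∂ₓ³ log F⁺` and `T̃ ∂ₓ³ log G⁻ - T ∂ₓ³
  -- log G⁺`. Each group becomes local by `mulOp_bdry_relations`.
  have n1 : ∀ x t, opT L δ (fun y => dxx (uLog ubar Fm Gp) y t) x
      + opTt L δ (fun y => dxx (uLog vbar Gm Fp) y t) x
      = -(dxx (ld Fm) x t + dxx (ld Gp) x t) := fun x t => by
    rw [(hT ubar lFm lGp pFm pGp x t).2, hTt vbar lGm lFp pGm pFp zGm zFp x t]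
    linear_combination I * (bF x t).1 + I * (bG x t).2
      + (dxx (ld Fm) x t + dxx (ld Gp) x t) * I_sq
  have n2 : ∀ x t, opT L δ (fun y => dxx (uLog vbar Gm Fp) y t) x
      + opTt L δ (fun y => dxx (uLog ubar Fm Gp) y t) x
      = -(dxx (ld Fp) x t + dxx (ld Gm) x t) := fun x t => by
    rw [(hT vbar lGm lFp pGm pFp x t).2, hTt ubar lFm lGp pFm pGp zFm zGp x t]
    linear_combination I * (bG x t).1 + I * (bF x t).2
      + (dxx (ld Fp) x t + dxx (ld Gm) x t) * I_sq
  have i1 := hirotaForm_iff (a := ubar) cFm cGp hFm0 hGp0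
  have i2 := hirotaForm_iff (a := -vbar) cFp cGm hFp0 hGm0
  simp only [hirotaSystem_iff]
  constructor
  · rintro ⟨lam1, lam2, h1, h2⟩ x t
    have j1 := i1.mp ⟨lam1, h1⟩ x t
    have j2 := i2.mp ⟨lam2, h2⟩ x t
    rw [uLog_neg_swap, dx_uLog_neg_swap, dt_uLog_neg_swap] at j2
    refine ⟨(hT ubar lFm lGp pFm pGp x t).1, (hT vbar lGm lFp pGm pFp x t).1, ?_, ?_⟩
    · linear_combination j1 + n1 x t
    · linear_combination -j2 - n2 x t
  · intro h
    obtain ⟨lam1, h1⟩ := i1.mpr fun x t => by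
      linear_combination (h x t).2.2.1 - n1 x t
    obtain ⟨lam2, h2⟩ := i2.mpr fun x t => by
      rw [uLog_neg_swap, dx_uLog_neg_swap, dt_uLog_neg_swap]
      linear_combination -(h x t).2.2.2 - n2 x t
    exact ⟨lam1, lam2, h1, h2⟩

end

end

end NcILW

namespace NcILW

noncomputable section

/-! ### Conservation of the means -/

section Mean

variable {L δ : ℝ} {u v : ℝ → ℝ → ℂ}

/-- No term of the equation has a zero mode: `2uu_x` is the derivative of `u²`, and both multipliers
vanish at `n = 0`. The sign `s` covers both equations, `-1` for `u` and `1` for `v`. -/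
theorem fcoef_dt_zero (hL : 0 < L) (hδ : 0 < δ) (hu : ContDiff ℝ 3 fun p : ℝ × ℝ => u p.1 p.2)
    (hv : ContDiff ℝ 3 fun p : ℝ × ℝ => v p.1 p.2)
    (hup : ∀ t, Function.Periodic (fun x => u x t) L)
    (hvp : ∀ t, Function.Periodic (fun x => v x t) L) (s : ℂ) {t : ℝ}
    (h : ∀ x, dt u x t = s * (2 * u x t * dx u x t + opT L δ (fun y => dxx u y t) x
      + opTt L δ (fun y => dxx v y t) x)) :
    fcoef L (fun x => dt u x t) 0 = 0 := by
  have u3 : ContDiff ℝ 3 fun x => u x t := contDiff_slice_x hu t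
  have u1 : ContDiff ℝ 1 fun x => u x t := u3.of_le (by norm_num)
  have uxx : ContDiff ℝ 1 fun x => dxx u x t := (u3.deriv' (n := 2)).deriv' (n := 1)
  have v3 : ContDiff ℝ 3 fun x => v x t := contDiff_slice_x hv t
  have vx : ContDiff ℝ 2 fun x => dx v x t := v3.deriv' (n := 2)
  have vxx : ContDiff ℝ 1 fun x => dxx v x t := vx.deriv' (n := 1)
  have pu : Function.Periodic (fun x => dxx u x t) L := periodic_deriv (periodic_deriv (hup t))
  have pv : Function.Periodic (fun x => dxx v x t) L := periodic_deriv (periodic_deriv (hvp t))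
  have zv : fcoef L (fun x => dxx v x t) 0 = 0 :=
    fcoef_deriv_zero hL (periodic_deriv (hvp t)) (vx.of_le (by norm_num))
  have hC := norm_I_mul_cothSym_le hL hδ
  have hS := norm_I_mul_cschSym_le hL hδ
  have sq : ContDiff ℝ 1 fun x => u x t * u x t := u1.mul u1
  have dsq : deriv (fun x => u x t * u x t) = fun x => 2 * u x t * dx u x t := by
    funext x
    have h1 : HasDerivAt (fun y => u y t) (dx u x t) x :=
      (u1.differentiable one_ne_zero x).hasDerivAt
    have h2 : HasDerivAt (fun y => u y t * u y t) (dx u x t * u x t + u x t * dx u x t) x := h1.mul h1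
    rw [h2.deriv]
    ring
  have e : (fun x => dt u x t) = fun x => s * ((deriv (fun x => u x t * u x t) x
      + mulOp L (fun n => I * cothSym L δ n) (fun y => dxx u y t) x)
      + mulOp L (fun n => I * cschSym L δ n) (fun y => dxx v y t) x) := by
    funext x
    rw [h x, dsq, opT_eq_mulOp hL hδ pu uxx, opTt_eq_mulOp hL hδ vxx.continuous zv]
  have c1 := sq.continuous_deriv_one
  have c2 := continuous_mulOp hL pu uxx hC
  have c3 := continuous_mulOp hL pv vxx hS
  rw [e, fcoef_const_mul, fcoef_add (by fun_prop) c3, fcoef_add c1 c2,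
    fcoef_deriv_zero hL (fun x => by simp only [hup t x]) sq, fcoef_mulOp hL pu uxx hC,
    fcoef_mulOp hL pv vxx hS, cothSym_zero, cschSym_zero]
  ring

theorem mean_const (hL : 0 < L) (hδ : 0 < δ) (hu : ContDiff ℝ 3 fun p : ℝ × ℝ => u p.1 p.2)
    (hv : ContDiff ℝ 3 fun p : ℝ × ℝ => v p.1 p.2)
    (hup : ∀ t, Function.Periodic (fun x => u x t) L)
    (hvp : ∀ t, Function.Periodic (fun x => v x t) L) (s : ℂ)
    (h : ∀ x t, dt u x t = s * (2 * u x t * dx u x t + opT L δ (fun y => dxx u y t) x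
      + opTt L δ (fun y => dxx v y t) x)) (t : ℝ) :
    mean L (fun x => u x t) = mean L (fun x => u x 0) := by
  have hd := fun r => hasDerivAt_fcoef_time (L := L) (hu.of_le (by norm_num)) 0 r
  have h0 := fun r => fcoef_dt_zero hL hδ hu hv hup hvp s (fun x => h x r)
  rw [← fcoef_zero_eq_mean, ← fcoef_zero_eq_mean]
  refine is_const_of_deriv_eq_zero (f := fun r => fcoef L (fun x => u x r) 0)
    (fun r => (hd r).differentiableAt) (fun r => ?_) t 0
  rw [(hd r).deriv, h0 r]

end Mean

/-! ### Boundary values of the potentials -/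

/-- Symbols of `J = u₊ + v₊` in terms of `u` and `v`. -/
def alphaSym (L δ : ℝ) (n : ℤ) : ℂ := (1 + cothSym L δ n - cschSym L δ n) / 2

/-- See `alphaSym`. -/
def betaSym (L δ : ℝ) (n : ℤ) : ℂ := (1 - cothSym L δ n + cschSym L δ n) / 2

/-- `∑ₙ σₙ (αₙ f̂ₙ + βₙ ĝₙ) exp (2πi n x / L)`. -/
def pairOp (L δ : ℝ) (σ : ℤ → ℂ) (f g : ℝ → ℂ) (x : ℝ) : ℂ :=
  mulOp L (fun n => σ n * alphaSym L δ n) f x + mulOp L (fun n => σ n * betaSym L δ n) g x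

/-- The boundary value of `log F` at `x - iδ/2`. -/
def potM (L δ : ℝ) (f g : ℝ → ℂ) (x : ℝ) : ℂ :=
  pairOp L δ (potSym L δ (-(I * (δ / 2)))) f g x

/-- The boundary value of `log F` at `x + iδ/2`. -/
def potP (L δ : ℝ) (f g : ℝ → ℂ) (x : ℝ) : ℂ :=
  pairOp L δ (potSym L δ (I * (δ / 2))) f g x

section

variable {L δ : ℝ} {f g : ℝ → ℂ}

theorem bdry_mem (hδ : 0 < δ) : I * (δ / 2) ∈ closedStrip δ ∧ -(I * (δ / 2)) ∈ closedStrip δ := by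
  have h1 := bdryPlus_mem hδ 0
  have h2 := bdryMinus_mem hδ 0
  simp only [ofReal_zero, zero_add, zero_sub] at h1 h2
  exact ⟨h1, h2⟩

/-- A common bound for the symbols. -/
def symBound (L δ : ℝ) : ℝ := 1 + 1 / Real.sinh (2 * π * δ / L)

theorem symbol_bounds (hL : 0 < L) (hδ : 0 < δ) (n : ℤ) :
    ‖alphaSym L δ n‖ ≤ symBound L δ ∧ ‖betaSym L δ n‖ ≤ symBound L δ ∧
    ‖(1 + cothSym L δ n) / 2‖ ≤ symBound L δ ∧ ‖cschSym L δ n / 2‖ ≤ symBound L δ ∧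
    ‖(cothSym L δ n - 1) / 2‖ ≤ symBound L δ := by
  have hC := norm_cothSym_le hL hδ n
  have hS := norm_cschSym_le hL hδ n
  have hb := sinh_base_pos hL hδ
  have hb' : 0 < 1 / Real.sinh (2 * π * δ / L) := by positivity
  have e2 : ‖(2 : ℂ)‖ = 2 := by simp
  have a1 := norm_add_le (1 : ℂ) (cothSym L δ n)
  have a2 := norm_sub_le (1 : ℂ) (cothSym L δ n)
  have a3 := norm_sub_le (1 + cothSym L δ n) (cschSym L δ n)
  have a4 := norm_add_le (1 - cothSym L δ n) (cschSym L δ n)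
  have a5 := norm_sub_le (cothSym L δ n) (1 : ℂ)
  rw [norm_one] at a1 a2 a5
  simp only [symBound, alphaSym, betaSym, norm_div, e2, div_le_iff₀ (two_pos : (0 : ℝ) < 2)]
  refine ⟨?_, ?_, ?_, ?_, ?_⟩ <;> linarith

theorem norm_mul_le_of_le {a b : ℂ} {A B : ℝ} (ha : ‖a‖ ≤ A) (hb : ‖b‖ ≤ B) : ‖a * b‖ ≤ A * B := by
  rw [norm_mul]
  exact mul_le_mul ha hb (norm_nonneg _) ((norm_nonneg _).trans ha)

/-- Put `s = πnδ/L`. Since `coth 2s - csch 2s = tanh s`, the source symbols are `exp(±s) / (2 cosh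
s)`. On the boundary `potD` is `exp(±s) / (2 sinh s)`. The products have denominator `2 sinh 2s` and
are the symbols of `u₊` and `-v₊`. -/
theorem symbol_identities (hL : 0 < L) (hδ : 0 < δ) {n : ℤ} (hn : n ≠ 0) :
    potD L δ (-(I * (δ / 2))) n * alphaSym L δ n = (1 + cothSym L δ n) / 2 ∧
    potD L δ (-(I * (δ / 2))) n * betaSym L δ n = cschSym L δ n / 2 ∧
    potD L δ (I * (δ / 2)) n * alphaSym L δ n = cschSym L δ n / 2 ∧
    potD L δ (I * (δ / 2)) n * betaSym L δ n = (cothSym L δ n - 1) / 2 := by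
  have hm := mode_bdry L δ n 0
  rw [zero_add, zero_sub, mode_zero, one_mul, one_mul] at hm
  have h1 := sinh_freq_ne_zero hL (half_pos hδ) hn
  simp only [potD, alphaSym, betaSym, cothSym, cschSym, hm.1, hm.2]
  rw [← two_mul_freq_half L δ n, ← two_mul, Real.cosh_two_mul, Real.sinh_two_mul,
    ← Real.cosh_add_sinh, ← Real.cosh_sub_sinh]
  have h2 := (Real.cosh_pos (freq L (δ / 2) n)).ne'
  have h3 := Real.cosh_sq (freq L (δ / 2) n)
  generalize Real.sinh (freq L (δ / 2) n) = S at *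
  generalize Real.cosh (freq L (δ / 2) n) = C at *
  have h1' : (S : ℂ) ≠ 0 := by exact_mod_cast h1
  have h2' : (C : ℂ) ≠ 0 := by exact_mod_cast h2
  have h3' : (C : ℂ) ^ 2 = S ^ 2 + 1 := by exact_mod_cast h3
  push_cast
  refine ⟨?_, ?_, ?_, ?_⟩ <;> field_simp
  · linear_combination (C + S) * h3'
  · linear_combination (-(C + S)) * h3' + 2 * S * h3'
  · linear_combination (C - S) * h3' + 2 * S * h3'
  · linear_combination (-(C - S)) * h3'

theorem symbol_mul_potSym (hL : 0 < L) {n : ℤ} (hn : n ≠ 0) (z : ℂ) :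
    potSym L δ z n * (2 * π * I * n / L) = -I * potD L δ z n := by
  have hpi : (π : ℂ) ≠ 0 := by exact_mod_cast Real.pi_ne_zero
  have hL' : (L : ℂ) ≠ 0 := by exact_mod_cast hL.ne'
  have hn' : (n : ℂ) ≠ 0 := by exact_mod_cast hn
  rw [potSym]
  field_simp

/-- The relation between the symbols fails to carry information at `n = 0`; mean zero of `f` makes
that mode irrelevant. -/
theorem hasDerivAt_mulOp_symbol (hL : 0 < L) (hp : Function.Periodic f L) (hf : ContDiff ℝ 2 f)
    (h0 : fcoef L f 0 = 0) {m k : ℤ → ℂ} {B : ℝ} (hm : ∀ n, ‖m n‖ ≤ B)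
    (hk : ∀ n : ℤ, n ≠ 0 → m n * (2 * π * I * n / L) = -I * k n) (x : ℝ) :
    HasDerivAt (mulOp L m f) (-I * mulOp L k f x) x := by
  refine (hasDerivAt_mulOp hL hp hf hm x).congr_deriv ?_
  rw [mulOp, mulOp, ← tsum_mul_left]
  refine tsum_congr fun n => ?_
  rw [fcoef_deriv hL hp (hf.of_le (by norm_num))]
  by_cases hn : n = 0
  · rw [hn, h0]; ring
  · linear_combination (fcoef L f n * mode L n x) * hk n hn

theorem hasDerivAt_potM (hL : 0 < L) (hδ : 0 < δ) (hfp : Function.Periodic f L)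
    (hf : ContDiff ℝ 2 f) (hf0 : fcoef L f 0 = 0) (hgp : Function.Periodic g L)
    (hg : ContDiff ℝ 2 g) (hg0 : fcoef L g 0 = 0) (x : ℝ) :
    HasDerivAt (potM L δ f g) (-I * (mulOp L (fun n => (1 + cothSym L δ n) / 2) f x
      + mulOp L (fun n => cschSym L δ n / 2) g x)) x := by
  have hb := norm_potSym_le hL hδ (bdry_mem hδ).2
  rw [mul_add]
  refine (hasDerivAt_mulOp_symbol hL hfp hf hf0
    (fun n => norm_mul_le_of_le (hb n) (symbol_bounds hL hδ n).1) (fun n hn => ?_) x).add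
    (hasDerivAt_mulOp_symbol hL hgp hg hg0
    (fun n => norm_mul_le_of_le (hb n) (symbol_bounds hL hδ n).2.1) (fun n hn => ?_) x)
  · rw [← (symbol_identities hL hδ hn).1, ← mul_assoc, ← symbol_mul_potSym hL hn]; ring
  · rw [← (symbol_identities hL hδ hn).2.1, ← mul_assoc, ← symbol_mul_potSym hL hn]; ring

theorem hasDerivAt_potP (hL : 0 < L) (hδ : 0 < δ) (hfp : Function.Periodic f L)
    (hf : ContDiff ℝ 2 f) (hf0 : fcoef L f 0 = 0) (hgp : Function.Periodic g L)
    (hg : ContDiff ℝ 2 g) (hg0 : fcoef L g 0 = 0) (x : ℝ) :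
    HasDerivAt (potP L δ f g) (-I * (mulOp L (fun n => cschSym L δ n / 2) f x
      + mulOp L (fun n => (cothSym L δ n - 1) / 2) g x)) x := by
  have hb := norm_potSym_le hL hδ (bdry_mem hδ).1
  rw [mul_add]
  refine (hasDerivAt_mulOp_symbol hL hfp hf hf0
    (fun n => norm_mul_le_of_le (hb n) (symbol_bounds hL hδ n).1) (fun n hn => ?_) x).add
    (hasDerivAt_mulOp_symbol hL hgp hg hg0
    (fun n => norm_mul_le_of_le (hb n) (symbol_bounds hL hδ n).2.1) (fun n hn => ?_) x)
  · rw [← (symbol_identities hL hδ hn).2.2.1, ← mul_assoc, ← symbol_mul_potSym hL hn]; ring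
  · rw [← (symbol_identities hL hδ hn).2.2.2, ← mul_assoc, ← symbol_mul_potSym hL hn]; ring

theorem contDiff_pairOp (hL : 0 < L) (hδ : 0 < δ) (hfp : Function.Periodic f L)
    (hf : ContDiff ℝ 3 f) (hgp : Function.Periodic g L) (hg : ContDiff ℝ 3 g) {z : ℂ}
    (hz : z ∈ closedStrip δ) : ContDiff ℝ 2 (pairOp L δ (potSym L δ z) f g) := by
  have hb := norm_potSym_le hL hδ hz
  exact (contDiff_mulOp hL hfp 2 hf
      (fun n => norm_mul_le_of_le (hb n) (symbol_bounds hL hδ n).1)).add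
    (contDiff_mulOp hL hgp 2 hg
      (fun n => norm_mul_le_of_le (hb n) (symbol_bounds hL hδ n).2.1))

end

/-- A `C³` function on the plane, `L`-periodic and of mean zero in `x`. -/
structure MeanZero (L : ℝ) (w : ℝ → ℝ → ℂ) : Prop where
  smooth : ContDiff ℝ 3 fun p : ℝ × ℝ => w p.1 p.2
  periodic : ∀ t, Function.Periodic (fun x => w x t) L
  mean_zero : ∀ t, fcoef L (fun x => w x t) 0 = 0

section

variable {L δ : ℝ} {w p : ℝ → ℝ → ℂ}

theorem MeanZero.slice (hw : MeanZero L w) (t : ℝ) : ContDiff ℝ 3 fun x => w x t :=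
  contDiff_slice_x hw.smooth t

theorem MeanZero.slice_one (hw : MeanZero L w) (t : ℝ) : ContDiff ℝ 1 fun x => w x t :=
  (hw.slice t).of_le (by norm_num)

theorem MeanZero.periodic_dt (hw : MeanZero L w) (t : ℝ) :
    Function.Periodic (fun x => dt w x t) L := fun x => by
  simp only [dt]
  congr 1
  funext r
  exact hw.periodic r x

theorem MeanZero.contDiff_dt (hw : MeanZero L w) (t : ℝ) : ContDiff ℝ 2 fun x => dt w x t :=
  contDiff_slice_x (NcILW.contDiff_dt (n := 2) hw.smooth) t

theorem MeanZero.fcoef_dt (hw : MeanZero L w) (t : ℝ) : fcoef L (fun x => dt w x t) 0 = 0 := by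
  have h1 := hasDerivAt_fcoef_time (L := L) (hw.smooth.of_le (by norm_num)) 0 t
  simp only [hw.mean_zero] at h1
  exact h1.unique (hasDerivAt_const t (0 : ℂ))

theorem hasDerivAt_mulOp_time (hL : 0 < L) (hw : MeanZero L w) {m : ℤ → ℂ} {B : ℝ}
    (hm : ∀ n, ‖m n‖ ≤ B) (x t : ℝ) :
    HasDerivAt (fun s => mulOp L m (fun y => w y s) x) (mulOp L m (fun y => dt w y t) x) t := by
  have h1 := hasDerivAt_tsum_fcoef_time hL hw.smooth hw.periodic (m := fun n => m n * mode L n x)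
    (B := B * 1) (fun n => norm_mul_le_of_le (hm n) (norm_mode_real_le L n x)) t
  have e : ∀ h : ℝ → ℂ, mulOp L m h x = ∑' n, m n * mode L n x * fcoef L h n := fun h =>
    tsum_congr fun n => by ring
  simpa only [e] using h1

theorem hasDerivAt_pairOp_time (hL : 0 < L) (hδ : 0 < δ) (hw : MeanZero L w) (hp : MeanZero L p)
    {z : ℂ} (hz : z ∈ closedStrip δ) (x t : ℝ) :
    HasDerivAt (fun s => pairOp L δ (potSym L δ z) (fun y => w y s) (fun y => p y s) x)
      (pairOp L δ (potSym L δ z) (fun y => dt w y t) (fun y => dt p y t) x) t := by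
  have hb := norm_potSym_le hL hδ hz
  exact (hasDerivAt_mulOp_time hL hw
      (fun n => norm_mul_le_of_le (hb n) (symbol_bounds hL hδ n).1) x t).add
    (hasDerivAt_mulOp_time hL hp
      (fun n => norm_mul_le_of_le (hb n) (symbol_bounds hL hδ n).2.1) x t)

end

end

end NcILW

namespace NcILW

noncomputable section

theorem mulOp_linear_symbol {L : ℝ} {h : ℝ → ℂ} (hL : 0 < L) (hp : Function.Periodic h L)
    (hh : ContDiff ℝ 1 h) {m k : ℤ → ℂ} {A B : ℝ} (hm : ∀ n, ‖m n‖ ≤ A) (hk : ∀ n, ‖k n‖ ≤ B)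
    (a b : ℂ) (x : ℝ) :
    mulOp L (fun n => a * m n + b * k n) h x = a * mulOp L m h x + b * mulOp L k h x := by
  rw [mulOp, mulOp, mulOp, ← tsum_mul_left, ← tsum_mul_left,
    ← ((summable_mulOp hL hp hh hm x).mul_left a).tsum_add
      ((summable_mulOp hL hp hh hk x).mul_left b)]
  exact tsum_congr fun n => by ring

/-! ### Functions of the form `κ(t) exp Θ(x, t)` -/

section ExpForm

variable {P Θ : ℝ → ℝ → ℂ} {κ : ℝ → ℂ}

theorem contDiff_expForm (hP : ∀ x t, P x t = κ t * exp (Θ x t)) {t : ℝ}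
    (h : ContDiff ℝ 2 fun x => Θ x t) : ContDiff ℝ 2 fun x => P x t := by
  simp only [hP]
  exact contDiff_const.mul h.cexp

theorem ld_expForm (hP : ∀ x t, P x t = κ t * exp (Θ x t)) (hκ : ∀ t, κ t ≠ 0) {x t : ℝ} {d : ℂ}
    (h : HasDerivAt (fun y => Θ y t) d x) : ld P x t = d := by
  have h1 := h.cexp.const_mul (κ t)
  rw [ld, dx]
  simp only [hP]
  rw [h1.deriv, ← mul_assoc]
  exact mul_div_cancel_left₀ _ (mul_ne_zero (hκ t) (exp_ne_zero _))

theorem hasDerivAt_expForm_time (hP : ∀ x t, P x t = κ t * exp (Θ x t)) {x t : ℝ} {d : ℂ}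
    (hκ : DifferentiableAt ℝ κ t) (h : HasDerivAt (fun s => Θ x s) d t) :
    HasDerivAt (fun s => P x s) (deriv κ t * exp (Θ x t) + κ t * (exp (Θ x t) * d)) t := by
  simp only [hP]
  exact hκ.hasDerivAt.mul h.cexp

theorem dt_div_expForm (hP : ∀ x t, P x t = κ t * exp (Θ x t)) (hκ0 : ∀ t, κ t ≠ 0) {x t : ℝ}
    {d : ℂ} (hκ : DifferentiableAt ℝ κ t) (h : HasDerivAt (fun s => Θ x s) d t) :
    dt P x t / P x t = deriv κ t / κ t + d := by
  have := exp_ne_zero (Θ x t)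
  have := hκ0 t
  rw [dt, (hasDerivAt_expForm_time hP hκ h).deriv, hP]
  field_simp

end ExpForm

/-! ### The sources `u₊ + v₊` and the boundary values of their potentials -/

section Data

variable {L δ : ℝ} {u v : ℝ → ℝ → ℂ} {ubar vbar : ℂ}

theorem TTt_eq (hL : 0 < L) (hδ : 0 < δ) (hw : MeanZero L fun x t => u x t - ubar)
    (hp : MeanZero L fun x t => v x t - vbar) (x t : ℝ) :
    TTt L δ ubar vbar u v x t = mulOp L (fun n => I * cothSym L δ n) (fun y => u y t - ubar) x
      + mulOp L (fun n => I * cschSym L δ n) (fun y => v y t - vbar) x := by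
  rw [TTt, opT_eq_mulOp hL hδ (hw.periodic t) (hw.slice_one t),
    opTt_eq_mulOp hL hδ (hp.slice_one t).continuous (hp.mean_zero t)]

theorem norm_one_le : ∀ _ : ℤ, ‖(1 : ℂ)‖ ≤ 1 := fun _ => norm_one.le

theorem mulOp_half_add (hL : 0 < L) (hδ : 0 < δ) {h : ℝ → ℂ} (hp : Function.Periodic h L)
    (hh : ContDiff ℝ 1 h) (x : ℝ) :
    mulOp L (fun n => (1 + cothSym L δ n) / 2) h x
      = h x / 2 - I / 2 * mulOp L (fun n => I * cothSym L δ n) h x ∧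
    mulOp L (fun n => (cothSym L δ n - 1) / 2) h x
      = -(h x / 2) - I / 2 * mulOp L (fun n => I * cothSym L δ n) h x ∧
    mulOp L (fun n => cschSym L δ n / 2) h x
      = -(I / 2) * mulOp L (fun n => I * cschSym L δ n) h x := by
  have l1 := mulOp_linear_symbol hL hp hh norm_one_le (norm_I_mul_cothSym_le hL hδ) (1 / 2) (-(I / 2)) x
  have l2 := mulOp_linear_symbol hL hp hh norm_one_le (norm_I_mul_cothSym_le hL hδ) (-(1 / 2)) (-(I / 2)) x
  have l3 := mulOp_linear_symbol hL hp hh norm_one_le (norm_I_mul_cschSym_le hL hδ) 0 (-(I / 2)) x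
  rw [mulOp_one hL hp hh] at l1 l2 l3
  refine ⟨?_, ?_, ?_⟩
  · have e : (fun n : ℤ => (1 + cothSym L δ n) / 2)
        = fun n => 1 / 2 * 1 + -(I / 2) * (I * cothSym L δ n) := by
      funext n; linear_combination (cothSym L δ n / 2) * I_sq
    rw [e, l1]; ring
  · have e : (fun n : ℤ => (cothSym L δ n - 1) / 2)
        = fun n => -(1 / 2) * 1 + -(I / 2) * (I * cothSym L δ n) := by
      funext n; linear_combination (cothSym L δ n / 2) * I_sq
    rw [e, l2]; ring
  · have e : (fun n : ℤ => cschSym L δ n / 2)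
        = fun n => 0 * 1 + -(I / 2) * (I * cschSym L δ n) := by
      funext n; linear_combination (cschSym L δ n / 2) * I_sq
    rw [e, l3]; ring

theorem uPlus_eq (hL : 0 < L) (hδ : 0 < δ) (hw : MeanZero L fun x t => u x t - ubar)
    (hp : MeanZero L fun x t => v x t - vbar) (x t : ℝ) :
    uPlus L δ ubar vbar u v x t = mulOp L (fun n => (1 + cothSym L δ n) / 2) (fun y => u y t - ubar) x
      + mulOp L (fun n => cschSym L δ n / 2) (fun y => v y t - vbar) x := by
  rw [uPlus, TTt_eq hL hδ hw hp, (mulOp_half_add hL hδ (hw.periodic t) (hw.slice_one t) x).1,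
    (mulOp_half_add hL hδ (hp.periodic t) (hp.slice_one t) x).2.2]
  ring

theorem vPlus_eq (hL : 0 < L) (hδ : 0 < δ) (hw : MeanZero L fun x t => u x t - ubar)
    (hp : MeanZero L fun x t => v x t - vbar) (x t : ℝ) :
    vPlus L δ ubar vbar u v x t = -(mulOp L (fun n => cschSym L δ n / 2) (fun y => u y t - ubar) x
      + mulOp L (fun n => (cothSym L δ n - 1) / 2) (fun y => v y t - vbar) x) := by
  rw [vPlus, TTt_eq hL hδ hp hw, (mulOp_half_add hL hδ (hw.periodic t) (hw.slice_one t) x).2.2,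
    (mulOp_half_add hL hδ (hp.periodic t) (hp.slice_one t) x).2.1]
  ring

theorem contDiff_uPlus (hL : 0 < L) (hδ : 0 < δ) (hw : MeanZero L fun x t => u x t - ubar)
    (hp : MeanZero L fun x t => v x t - vbar) (t : ℝ) :
    ContDiff ℝ 2 (fun x => uPlus L δ ubar vbar u v x t) ∧
    ContDiff ℝ 2 (fun x => vPlus L δ ubar vbar u v x t) := by
  have hb := symbol_bounds hL hδ
  simp only [uPlus_eq hL hδ hw hp, vPlus_eq hL hδ hw hp]
  exact ⟨(contDiff_mulOp hL (hw.periodic t) 2 (hw.slice t) fun n => (hb n).2.2.1).add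
      (contDiff_mulOp hL (hp.periodic t) 2 (hp.slice t) fun n => (hb n).2.2.2.1),
    ((contDiff_mulOp hL (hw.periodic t) 2 (hw.slice t) fun n => (hb n).2.2.2.1).add
      (contDiff_mulOp hL (hp.periodic t) 2 (hp.slice t) fun n => (hb n).2.2.2.2)).neg⟩

theorem fcoef_source (hL : 0 < L) (hδ : 0 < δ) (hw : MeanZero L fun x t => u x t - ubar)
    (hp : MeanZero L fun x t => v x t - vbar) (t : ℝ) (n : ℤ) :
    fcoef L (fun y => uPlus L δ ubar vbar u v y t + vPlus L δ ubar vbar u v y t) n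
      = alphaSym L δ n * fcoef L (fun y => u y t - ubar) n
        + betaSym L δ n * fcoef L (fun y => v y t - vbar) n := by
  have hb := symbol_bounds hL hδ
  have e : (fun y => uPlus L δ ubar vbar u v y t + vPlus L δ ubar vbar u v y t) = fun y =>
      mulOp L (alphaSym L δ) (fun y => u y t - ubar) y
        + mulOp L (betaSym L δ) (fun y => v y t - vbar) y := by
    funext y
    have l1 := mulOp_linear_symbol hL (hw.periodic t) (hw.slice_one t) (fun n => (hb n).2.2.1)
      (fun n => (hb n).2.2.2.1) 1 (-1) y
    have l2 := mulOp_linear_symbol hL (hp.periodic t) (hp.slice_one t) (fun n => (hb n).2.2.2.1)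
      (fun n => (hb n).2.2.2.2) 1 (-1) y
    have e1 : alphaSym L δ = fun n => 1 * ((1 + cothSym L δ n) / 2) + -1 * (cschSym L δ n / 2) := by
      funext n; rw [alphaSym]; ring
    have e2 : betaSym L δ = fun n => 1 * (cschSym L δ n / 2) + -1 * ((cothSym L δ n - 1) / 2) := by
      funext n; rw [betaSym]; ring
    rw [uPlus_eq hL hδ hw hp, vPlus_eq hL hδ hw hp, e1, e2, l1, l2]
    ring
  rw [e, fcoef_add
      (continuous_mulOp hL (hw.periodic t) (hw.slice_one t) fun n => (hb n).1)
      (continuous_mulOp hL (hp.periodic t) (hp.slice_one t) fun n => (hb n).2.1),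
    fcoef_mulOp hL (hw.periodic t) (hw.slice_one t) (fun n => (hb n).1),
    fcoef_mulOp hL (hp.periodic t) (hp.slice_one t) (fun n => (hb n).2.1)]

theorem admissible_source (hL : 0 < L) (hδ : 0 < δ) (hw : MeanZero L fun x t => u x t - ubar)
    (hp : MeanZero L fun x t => v x t - vbar) (t : ℝ) :
    Admissible L (fun y => uPlus L δ ubar vbar u v y t + vPlus L δ ubar vbar u v y t) := by
  have hb := symbol_bounds hL hδ
  obtain ⟨c1, c2⟩ := contDiff_uPlus hL hδ hw hp t
  refine ⟨c1.continuous.add c2.continuous, ?_, ?_⟩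
  · have h1 := hw.mean_zero t
    have h2 := hp.mean_zero t
    rw [fcoef_source hL hδ hw hp, h1, h2]
    ring
  · simp only [fcoef_source hL hδ hw hp]
    refine Summable.of_nonneg_of_le (fun _ => norm_nonneg _) (fun _ => norm_add_le _ _)
      ((summable_mul_fcoef hL (hw.periodic t) (hw.slice_one t) fun n => (hb n).1).add
        (summable_mul_fcoef hL (hp.periodic t) (hp.slice_one t) fun n => (hb n).2.1))

/-- As `e_n(x + z) = e_n(x) e_n(z)`, the offset `z` enters the symbol only. With `z = ±iδ/2` both
boundary values become multipliers applied directly to `u - ū` and `v - v̄`. -/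
theorem potential_source (hL : 0 < L) (hδ : 0 < δ) (hw : MeanZero L fun x t => u x t - ubar)
    (hp : MeanZero L fun x t => v x t - vbar) (t : ℝ) {z : ℂ} (hz : z ∈ closedStrip δ) (x : ℝ) :
    potential L δ (fun y => uPlus L δ ubar vbar u v y t + vPlus L δ ubar vbar u v y t) (x + z)
      = pairOp L δ (potSym L δ z) (fun y => u y t - ubar) (fun y => v y t - vbar) x := by
  have hb := symbol_bounds hL hδ
  have hs := norm_potSym_le hL hδ hz
  rw [potential, pairOp, mulOp, mulOp, ← (summable_mulOp hL (hw.periodic t) (hw.slice_one t)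
      (fun n => norm_mul_le_of_le (hs n) (hb n).1) x).tsum_add
    (summable_mulOp hL (hp.periodic t) (hp.slice_one t)
      (fun n => norm_mul_le_of_le (hs n) (hb n).2.1) x)]
  refine tsum_congr fun n => ?_
  rw [fcoef_source hL hδ hw hp, potSym, potSym, potD, potD, mode_add]
  ring

/-- The boundary values of a solution of the potential equation. -/
theorem bdry_eq_of_isHirotaPotential (hL : 0 < L) (hδ : 0 < δ)
    (hw : MeanZero L fun x t => u x t - ubar) (hp : MeanZero L fun x t => v x t - vbar)
    {F : ℂ → ℝ → ℂ} (hF : IsHirotaPotential L δ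
      (fun y s => uPlus L δ ubar vbar u v y s + vPlus L δ ubar vbar u v y s) F)
    (hF0 : Differentiable ℝ fun t => F 0 t) :
    ∃ κ : ℝ → ℂ, (∀ t, κ t ≠ 0) ∧ Differentiable ℝ κ ∧
      (∀ x t, bdryMinus δ F x t
        = κ t * exp (potM L δ (fun y => u y t - ubar) (fun y => v y t - vbar) x)) ∧
      ∀ x t, bdryPlus δ F x t
        = κ t * exp (potP L δ (fun y => u y t - ubar) (fun y => v y t - vbar) x) := by
  have hK := admissible_source hL hδ hw hp
  have key := isHirotaPotential_eq hL hδ hK hF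
  have h0 : (0 : ℂ) ∈ closedStrip δ := openStrip_subset δ (zero_mem_openStrip hδ)
  have hz0 : ∀ t, potential L δ
      (fun y => uPlus L δ ubar vbar u v y t + vPlus L δ ubar vbar u v y t) 0
      = pairOp L δ (potSym L δ 0) (fun y => u y t - ubar) (fun y => v y t - vbar) 0 := fun t => by
    have := potential_source hL hδ hw hp t h0 0
    rwa [ofReal_zero, add_zero] at this
  -- The normalization at `z = 0` gives one factor `κ(t)` common to both boundary lines. It is
  -- differentiable because `F(0, t)` and the potential at `0` are.
  refine ⟨fun t => F 0 t * exp (-pairOp L δ (potSym L δ 0) (fun y => u y t - ubar)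
    (fun y => v y t - vbar) 0), fun t => mul_ne_zero (key t).1 (exp_ne_zero _), ?_, ?_, ?_⟩
  · intro t
    exact (hF0 t).mul (hasDerivAt_pairOp_time hL hδ hw hp h0 0 t).differentiableAt.neg.cexp
  · intro x t
    have h1 := (key t).2 _ (bdryMinus_mem hδ x)
    have h2 := potential_source hL hδ hw hp t (bdry_mem hδ).2 x
    rw [bdryMinus, h1, hz0, sub_eq_add_neg (x : ℂ), h2, ← potM, sub_eq_add_neg, Complex.exp_add]
    ring
  · intro x t
    have h1 := (key t).2 _ (bdryPlus_mem hδ x)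
    have h2 := potential_source hL hδ hw hp t (bdry_mem hδ).1 x
    rw [bdryPlus, h1, hz0, h2, ← potP, sub_eq_add_neg, Complex.exp_add]
    ring

theorem stripPeriodic_of_isHirotaPotential (hL : 0 < L) (hδ : 0 < δ)
    (hw : MeanZero L fun x t => u x t - ubar) (hp : MeanZero L fun x t => v x t - vbar)
    {F : ℂ → ℝ → ℂ} (hF : IsHirotaPotential L δ
      (fun y s => uPlus L δ ubar vbar u v y s + vPlus L δ ubar vbar u v y s) F) :
    StripPeriodic L δ F := by
  intro t z hz
  have key := isHirotaPotential_eq hL hδ (admissible_source hL hδ hw hp) hF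
  rw [(key t).2 _ (add_period_mem_closedStrip hz), (key t).2 z hz, potential_add_period hL]

/-- Regularity and logarithmic derivatives of the boundary values. -/
theorem bdry_facts (hL : 0 < L) (hδ : 0 < δ)
    (hw : MeanZero L fun x t => u x t - ubar) (hp : MeanZero L fun x t => v x t - vbar)
    {F : ℂ → ℝ → ℂ} (hF : IsHirotaPotential L δ
      (fun y s => uPlus L δ ubar vbar u v y s + vPlus L δ ubar vbar u v y s) F)
    (hF0 : Differentiable ℝ fun t => F 0 t) :
    BdryRegular δ F ∧ (∀ x t, bdryMinus δ F x t ≠ 0 ∧ bdryPlus δ F x t ≠ 0) ∧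
    (∀ x t, ld (bdryMinus δ F) x t = -I * uPlus L δ ubar vbar u v x t) ∧
    (∀ x t, ld (bdryPlus δ F) x t = I * vPlus L δ ubar vbar u v x t) ∧
    ∃ c : ℝ → ℂ,
      (∀ x t, dt (bdryMinus δ F) x t / bdryMinus δ F x t
        = c t + potM L δ (fun y => dt u y t) (fun y => dt v y t) x) ∧
      (∀ x t, dt (bdryPlus δ F) x t / bdryPlus δ F x t
        = c t + potP L δ (fun y => dt u y t) (fun y => dt v y t) x) := by
  obtain ⟨κ, hκ, hκd, hm, hpl⟩ := bdry_eq_of_isHirotaPotential hL hδ hw hp hF hF0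
  have tM := fun x t => hasDerivAt_pairOp_time hL hδ hw hp (bdry_mem hδ).2 x t
  have tP := fun x t => hasDerivAt_pairOp_time hL hδ hw hp (bdry_mem hδ).1 x t
  have du : ∀ t, (fun y => dt (fun x t => u x t - ubar) y t) = fun y => dt u y t := fun t => by
    funext y; exact deriv_sub_const _
  have dv : ∀ t, (fun y => dt (fun x t => v x t - vbar) y t) = fun y => dt v y t := fun t => by
    funext y; exact deriv_sub_const _
  simp only [du, dv] at tM tP
  have s2 := fun t => (hw.slice t).of_le (show (2 : WithTop ℕ∞) ≤ 3 by norm_num)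
  have p2 := fun t => (hp.slice t).of_le (show (2 : WithTop ℕ∞) ≤ 3 by norm_num)
  refine ⟨⟨fun t => ⟨?_, ?_⟩, fun x => ⟨fun t => ?_, fun t => ?_⟩⟩, fun x t => ⟨?_, ?_⟩,
    fun x t => ?_, fun x t => ?_, fun t => deriv κ t / κ t, fun x t => ?_, fun x t => ?_⟩
  · exact contDiff_expForm hpl (contDiff_pairOp hL hδ (hw.periodic t) (hw.slice t) (hp.periodic t)
      (hp.slice t) (bdry_mem hδ).1)
  · exact contDiff_expForm hm (contDiff_pairOp hL hδ (hw.periodic t) (hw.slice t) (hp.periodic t)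
      (hp.slice t) (bdry_mem hδ).2)
  · exact (hasDerivAt_expForm_time hpl (hκd t) (tP x t)).differentiableAt
  · exact (hasDerivAt_expForm_time hm (hκd t) (tM x t)).differentiableAt
  · rw [hm]; exact mul_ne_zero (hκ t) (exp_ne_zero _)
  · rw [hpl]; exact mul_ne_zero (hκ t) (exp_ne_zero _)
  · rw [uPlus_eq hL hδ hw hp]
    exact ld_expForm hm hκ (hasDerivAt_potM hL hδ (hw.periodic t) (s2 t) (hw.mean_zero t)
      (hp.periodic t) (p2 t) (hp.mean_zero t) x)
  · rw [vPlus_eq hL hδ hw hp, mul_neg, ← neg_mul]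
    exact ld_expForm hpl hκ (hasDerivAt_potP hL hδ (hw.periodic t) (s2 t) (hw.mean_zero t)
      (hp.periodic t) (p2 t) (hp.mean_zero t) x)
  · exact dt_div_expForm hm hκ (hκd t) (tM x t)
  · exact dt_div_expForm hpl hκ (hκd t) (tP x t)

end Data

end

end NcILW

/-! ### From a solution of the ncILW equation to the bilinear system -/

namespace NcILW

noncomputable section

section Solution

variable {L δ : ℝ} {u v : ℝ → ℝ → ℂ} {ubar vbar : ℂ}

theorem MeanZero.of_mean (hL : 0 < L) (hu : ContDiff ℝ 3 fun p : ℝ × ℝ => u p.1 p.2)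
    (hup : ∀ t, Function.Periodic (fun x => u x t) L)
    (hm : ∀ t, mean L (fun x => u x t) = ubar) : MeanZero L fun x t => u x t - ubar where
  smooth := hu.sub contDiff_const
  periodic t x := by simp only [hup t x]
  mean_zero t := by
    rw [fcoef_sub (contDiff_slice_x hu t).continuous continuous_const, fcoef_const hL,
      fcoef_zero_eq_mean, hm, if_pos rfl, sub_self]

theorem hasDerivAt_TTt (hL : 0 < L) (hδ : 0 < δ) (hw : MeanZero L fun x t => u x t - ubar)
    (hp : MeanZero L fun x t => v x t - vbar) (x t : ℝ) :
    HasDerivAt (fun y => TTt L δ ubar vbar u v y t)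
      (mulOp L (fun n => I * cothSym L δ n) (fun y => dx u y t) x
        + mulOp L (fun n => I * cschSym L δ n) (fun y => dx v y t) x) x := by
  have du : deriv (fun y => u y t - ubar) = fun y => dx u y t := funext fun y => deriv_sub_const _
  have dv : deriv (fun y => v y t - vbar) = fun y => dx v y t := funext fun y => deriv_sub_const _
  have h1 := hasDerivAt_mulOp hL (hw.periodic t) ((hw.slice t).of_le (by norm_num))
    (norm_I_mul_cothSym_le hL hδ) x
  have h2 := hasDerivAt_mulOp hL (hp.periodic t) ((hp.slice t).of_le (by norm_num))
    (norm_I_mul_cschSym_le hL hδ) x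
  rw [du] at h1
  rw [dv] at h2
  simp only [TTt_eq hL hδ hw hp]
  exact h1.add h2

theorem hasDerivAt_dx_TTt (hL : 0 < L) (hδ : 0 < δ) (hw : MeanZero L fun x t => u x t - ubar)
    (hp : MeanZero L fun x t => v x t - vbar) (x t : ℝ) :
    HasDerivAt (fun y => dx (TTt L δ ubar vbar u v) y t)
      (opT L δ (fun y => dxx u y t) x + opTt L δ (fun y => dxx v y t) x) x := by
  have du : deriv (fun y => u y t - ubar) = fun y => dx u y t := funext fun y => deriv_sub_const _
  have dv : deriv (fun y => v y t - vbar) = fun y => dx v y t := funext fun y => deriv_sub_const _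
  have e : (fun y => dx (TTt L δ ubar vbar u v) y t) = fun y =>
      mulOp L (fun n => I * cothSym L δ n) (fun y => dx u y t) y
        + mulOp L (fun n => I * cschSym L δ n) (fun y => dx v y t) y :=
    funext fun y => (hasDerivAt_TTt hL hδ hw hp y t).deriv
  have u2 : ContDiff ℝ 2 fun y => dx u y t := by rw [← du]; exact (hw.slice t).deriv' (n := 2)
  have v2 : ContDiff ℝ 2 fun y => dx v y t := by rw [← dv]; exact (hp.slice t).deriv' (n := 2)
  have pu : Function.Periodic (fun y => dx u y t) L := by
    rw [← du]; exact periodic_deriv (hw.periodic t)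
  have pv : Function.Periodic (fun y => dx v y t) L := by
    rw [← dv]; exact periodic_deriv (hp.periodic t)
  have zv : fcoef L (fun y => dxx v y t) 0 = 0 := fcoef_deriv_zero hL pv (v2.of_le (by norm_num))
  have u1 : ContDiff ℝ 1 fun y => dxx u y t := u2.deriv' (n := 1)
  have v1 : ContDiff ℝ 1 fun y => dxx v y t := v2.deriv' (n := 1)
  have pu' : Function.Periodic (fun y => dxx u y t) L := periodic_deriv pu
  rw [e, opT_eq_mulOp hL hδ pu' u1, opTt_eq_mulOp hL hδ v1.continuous zv]
  exact (hasDerivAt_mulOp hL pu u2 (norm_I_mul_cothSym_le hL hδ) x).add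
    (hasDerivAt_mulOp hL pv v2 (norm_I_mul_cschSym_le hL hδ) x)

theorem logDeriv_div_time {P Q : ℝ → ℝ → ℂ} {x t : ℝ}
    (hP : DifferentiableAt ℝ (fun s => P x s) t) (hQ : DifferentiableAt ℝ (fun s => Q x s) t)
    (hP0 : P x t ≠ 0) (hQ0 : Q x t ≠ 0) :
    logDeriv (fun s => P x s / Q x s) t = dt P x t / P x t - dt Q x t / Q x t :=
  logDeriv_div_eq (P := fun s y => P y s) (Q := fun s y => Q y s) hP hQ hP0 hQ0

/-- The difference of the time derivatives of `log F⁻` and `log G⁺`. -/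
theorem hasDerivAt_potM_sub_potP (hL : 0 < L) (hδ : 0 < δ) {f g : ℝ → ℂ}
    (hfp : Function.Periodic f L) (hf : ContDiff ℝ 2 f) (hf0 : fcoef L f 0 = 0)
    (hgp : Function.Periodic g L) (hg : ContDiff ℝ 2 g) (hg0 : fcoef L g 0 = 0) (x : ℝ) :
    HasDerivAt (fun y => potM L δ f g y - potP L δ g f y) (-I * f x) x := by
  refine ((hasDerivAt_potM hL hδ hfp hf hf0 hgp hg hg0 x).sub
    (hasDerivAt_potP hL hδ hgp hg hg0 hfp hf hf0 x)).congr_deriv ?_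
  obtain ⟨e1, e2, -⟩ := mulOp_half_add hL hδ hfp (hf.of_le (by norm_num)) x
  rw [e1, e2]
  ring

theorem uPlus_sub_uMinus (x t : ℝ) :
    uPlus L δ ubar vbar u v x t - uMinus L δ ubar vbar u v x t
      = -I * TTt L δ ubar vbar u v x t := by
  rw [uPlus, uMinus]; ring

theorem vPlus_sub_vMinus (x t : ℝ) :
    vPlus L δ ubar vbar u v x t - vMinus L δ ubar vbar u v x t
      = I * TTt L δ vbar ubar v u x t := by
  rw [vPlus, vMinus]; ring

theorem MeanZero.dt_facts (hw : MeanZero L fun x t => u x t - ubar) (t : ℝ) :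
    Function.Periodic (fun x => dt u x t) L ∧ ContDiff ℝ 2 (fun x => dt u x t) ∧
      fcoef L (fun x => dt u x t) 0 = 0 := by
  have du : (fun y => dt (fun x t => u x t - ubar) y t) = fun y => dt u y t := by
    funext y; exact deriv_sub_const _
  rw [← du]
  exact ⟨hw.periodic_dt t, hw.contDiff_dt t, hw.fcoef_dt t⟩

/-- `hirotaForm_iff` asks for jointly `C⁴` boundary values, whereas here they are `C²` in `x` and
differentiable in `t`. Instead `hirotaE` is written through `u`, `v` and the potentials of `u_t`,
`v_t`, which can still be differentiated once more in `x`. -/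
theorem hirota_of_solution (hL : 0 < L) (hδ : 0 < δ)
    (hw : MeanZero L fun x t => u x t - ubar) (hp : MeanZero L fun x t => v x t - vbar)
    (hsol : SolvesNcILW L δ u v) {F G : ℂ → ℝ → ℂ}
    (hF : IsHirotaPotential L δ
      (fun y s => uPlus L δ ubar vbar u v y s + vPlus L δ ubar vbar u v y s) F)
    (hG : IsHirotaPotential L δ
      (fun y s => uMinus L δ ubar vbar u v y s + vMinus L δ ubar vbar u v y s) G)
    (hF0 : Differentiable ℝ fun t => F 0 t) (hG0 : Differentiable ℝ fun t => G 0 t) :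
    StripPeriodic L δ F ∧ StripPeriodic L δ G ∧ BdryRegular δ F ∧ BdryRegular δ G ∧
    (∀ x t, u x t = uOfFG δ ubar F G x t ∧ v x t = vOfFG δ vbar F G x t) ∧
    (∀ t, Differentiable ℝ (fun x =>
        uPlus L δ ubar vbar u v x t - uMinus L δ ubar vbar u v x t) ∧
      Differentiable ℝ (fun x =>
        vPlus L δ ubar vbar u v x t - vMinus L δ ubar vbar u v x t)) ∧
    ∃ lam1 lam2 : ℝ → ℂ,
      (∀ x t, lam1 t =
        I * logDeriv (fun s : ℝ => bdryMinus δ F x s / bdryPlus δ G x s) t + u x t ^ 2 +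
        I * dx (fun y s =>
          uPlus L δ ubar vbar u v y s - uMinus L δ ubar vbar u v y s) x t) ∧
      (∀ x t, lam2 t =
        I * logDeriv (fun s : ℝ => bdryPlus δ F x s / bdryMinus δ G x s) t + v x t ^ 2 -
        I * dx (fun y s =>
          vPlus L δ ubar vbar u v y s - vMinus L δ ubar vbar u v y s) x t) ∧
      HirotaSystem δ ubar vbar lam1 lam2 F G := by
  -- Exchanging `u` and `v` turns `u₊` into `v₋` and `v₊` into `u₋`, so `G` is the potential `F` of
  -- the exchanged data and all facts about `F` apply to it.
  have hG' : IsHirotaPotential L δ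
      (fun y s => uPlus L δ vbar ubar v u y s + vPlus L δ vbar ubar v u y s) G := by
    have e : (fun y s => uPlus L δ vbar ubar v u y s + vPlus L δ vbar ubar v u y s)
        = fun y s => uMinus L δ ubar vbar u v y s + vMinus L δ ubar vbar u v y s := by
      funext y s; exact add_comm _ _
    rw [e]; exact hG
  obtain ⟨rF, nF, lFm, lFp, cF, tFm, tFp⟩ := bdry_facts hL hδ hw hp hF hF0
  obtain ⟨rG, nG, lGm, lGp, cG, tGm, tGp⟩ := bdry_facts hL hδ hp hw hG' hG0
  have lGm' : ∀ x t, ld (bdryMinus δ G) x t = -I * vMinus L δ ubar vbar u v x t := lGm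
  have lGp' : ∀ x t, ld (bdryPlus δ G) x t = I * uMinus L δ ubar vbar u v x t := lGp
  have xFm := fun t => (rF.1 t).2.differentiable two_ne_zero
  have xFp := fun t => (rF.1 t).1.differentiable two_ne_zero
  have xGm := fun t => (rG.1 t).2.differentiable two_ne_zero
  have xGp := fun t => (rG.1 t).1.differentiable two_ne_zero
  have eu : ∀ x t, uLog ubar (bdryMinus δ F) (bdryPlus δ G) x t = u x t := fun x t => by
    rw [uLog, lFm, lGp', uPlus, uMinus]
    linear_combination (-(u x t - ubar)) * I_sq
  have ev : ∀ x t, uLog vbar (bdryMinus δ G) (bdryPlus δ F) x t = v x t := fun x t => by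
    rw [uLog, lFp, lGm', vPlus, vMinus]
    linear_combination (-(v x t - vbar)) * I_sq
  have dU : ∀ x t, DifferentiableAt ℝ (fun y => TTt L δ ubar vbar u v y t) x := fun x t =>
    (hasDerivAt_TTt hL hδ hw hp x t).differentiableAt
  have dV : ∀ x t, DifferentiableAt ℝ (fun y => TTt L δ vbar ubar v u y t) x := fun x t =>
    (hasDerivAt_TTt hL hδ hp hw x t).differentiableAt
  have dxU : ∀ x t, dx (fun y s =>
      uPlus L δ ubar vbar u v y s - uMinus L δ ubar vbar u v y s) x t
      = -I * dx (TTt L δ ubar vbar u v) x t := fun x t => by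
    simp only [dx, uPlus_sub_uMinus]
    exact deriv_const_mul _ (dU x t)
  have dxV : ∀ x t, dx (fun y s =>
      vPlus L δ ubar vbar u v y s - vMinus L δ ubar vbar u v y s) x t
      = I * dx (TTt L δ vbar ubar v u) x t := fun x t => by
    simp only [dx, vPlus_sub_vMinus]
    exact deriv_const_mul _ (dV x t)
  have cu := fun t => contDiff_uPlus hL hδ hw hp t
  have cv := fun t => contDiff_uPlus hL hδ hp hw t
  have ldU : ∀ x t, dx (ld (bdryMinus δ F)) x t + dx (ld (bdryPlus δ G)) x t
      = -I * dx (fun y s =>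
        uPlus L δ ubar vbar u v y s - uMinus L δ ubar vbar u v y s) x t := fun x t => by
    have h1 := ((cu t).1.differentiable two_ne_zero x).hasDerivAt
    have h2 := ((cv t).2.differentiable two_ne_zero x).hasDerivAt
    simp only [dx, lFm, lGp]
    have h3 : HasDerivAt (fun y => uPlus L δ ubar vbar u v y t - uMinus L δ ubar vbar u v y t)
        (deriv (fun x => uPlus L δ ubar vbar u v x t) x
          - deriv (fun x => vPlus L δ vbar ubar v u x t) x) x := h1.sub h2
    rw [(h1.const_mul (-I)).deriv, (h2.const_mul I).deriv, h3.deriv]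
    ring
  have ldV : ∀ x t, dx (ld (bdryPlus δ F)) x t + dx (ld (bdryMinus δ G)) x t
      = I * dx (fun y s =>
        vPlus L δ ubar vbar u v y s - vMinus L δ ubar vbar u v y s) x t := fun x t => by
    have h1 := ((cu t).2.differentiable two_ne_zero x).hasDerivAt
    have h2 := ((cv t).1.differentiable two_ne_zero x).hasDerivAt
    simp only [dx, lFp, lGm]
    have h3 : HasDerivAt (fun y => vPlus L δ ubar vbar u v y t - vMinus L δ ubar vbar u v y t)
        (deriv (fun x => vPlus L δ ubar vbar u v x t) x
          - deriv (fun x => uPlus L δ vbar ubar v u x t) x) x := h1.sub h2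
    rw [(h1.const_mul I).deriv, (h2.const_mul (-I)).deriv, h3.deriv]
    ring
  have eE1 : ∀ x t, hirotaE ubar (bdryMinus δ F) (bdryPlus δ G) x t =
      I * logDeriv (fun s : ℝ => bdryMinus δ F x s / bdryPlus δ G x s) t + u x t ^ 2 +
        I * dx (fun y s =>
          uPlus L δ ubar vbar u v y s - uMinus L δ ubar vbar u v y s) x t := fun x t => by
    rw [hirotaE, eu, ldU, logDeriv_div_time ((rF.2 x).2 t) ((rG.2 x).1 t) (nF x t).1 (nG x t).2]
    ring
  have eE2 : ∀ x t, hirotaE (-vbar) (bdryPlus δ F) (bdryMinus δ G) x t =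
      I * logDeriv (fun s : ℝ => bdryPlus δ F x s / bdryMinus δ G x s) t + v x t ^ 2 -
        I * dx (fun y s =>
          vPlus L δ ubar vbar u v y s - vMinus L δ ubar vbar u v y s) x t := fun x t => by
    rw [hirotaE, uLog_neg_swap, ev, ldV,
      logDeriv_div_time ((rF.2 x).1 t) ((rG.2 x).2 t) (nF x t).2 (nG x t).1]
    ring
  have u1 : ContDiff ℝ 1 fun p : ℝ × ℝ => u p.1 p.2 := by
    have := (hw.smooth.add (contDiff_const (c := ubar))).of_le (show (1 : WithTop ℕ∞) ≤ 3 by norm_num)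
    simpa using this
  have v1 : ContDiff ℝ 1 fun p : ℝ × ℝ => v p.1 p.2 := by
    have := (hp.smooth.add (contDiff_const (c := vbar))).of_le (show (1 : WithTop ℕ∞) ≤ 3 by norm_num)
    simpa using this
  -- The time part of `hirotaE` is `i` times a function of `t` plus a difference of potentials with
  -- `x`-derivative `-i u_t`. Its total `x`-derivative is `u_t + 2uu_x + T u_xx + T̃ v_xx`, which
  -- vanishes.
  have c1 : ∀ x t, hirotaE ubar (bdryMinus δ F) (bdryPlus δ G) x t
      = hirotaE ubar (bdryMinus δ F) (bdryPlus δ G) 0 t := by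
    intro x t
    obtain ⟨pu, su, zu⟩ := hw.dt_facts t
    obtain ⟨pv, sv, zv⟩ := hp.dt_facts t
    have hd : ∀ y, HasDerivAt (fun y => hirotaE ubar (bdryMinus δ F) (bdryPlus δ G) y t) 0 y := by
      intro y
      have e : (fun y => hirotaE ubar (bdryMinus δ F) (bdryPlus δ G) y t) = fun y =>
          I * ((cF t - cG t) + (potM L δ (fun y => dt u y t) (fun y => dt v y t) y
            - potP L δ (fun y => dt v y t) (fun y => dt u y t) y)) + u y t ^ 2
            - dx (TTt L δ ubar vbar u v) y t * (-I * -I) := by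
        funext y
        rw [hirotaE, eu, ldU, dxU, tFm, tGp]
        ring
      rw [e]
      refine (((((hasDerivAt_potM_sub_potP hL hδ pu su zu pv sv zv y).const_add _).const_mul I).add
        ((hasDerivAt_dx u1 y t).pow 2)).sub
          ((hasDerivAt_dx_TTt hL hδ hw hp y t).mul_const _)).congr_deriv ?_
      have := (hsol y t).2.2.1
      push_cast
      linear_combination this - (dt u y t + (opT L δ (fun y => dxx u y t) y
        + opTt L δ (fun y => dxx v y t) y)) * I_sq
    exact is_const_of_deriv_eq_zero (fun y => (hd y).differentiableAt) (fun y => (hd y).deriv) x 0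
  have c2 : ∀ x t, hirotaE (-vbar) (bdryPlus δ F) (bdryMinus δ G) x t
      = hirotaE (-vbar) (bdryPlus δ F) (bdryMinus δ G) 0 t := by
    intro x t
    obtain ⟨pu, su, zu⟩ := hw.dt_facts t
    obtain ⟨pv, sv, zv⟩ := hp.dt_facts t
    have hd : ∀ y, HasDerivAt (fun y => hirotaE (-vbar) (bdryPlus δ F) (bdryMinus δ G) y t) 0 y := by
      intro y
      have e : (fun y => hirotaE (-vbar) (bdryPlus δ F) (bdryMinus δ G) y t) = fun y =>
          -I * ((cG t - cF t) + (potM L δ (fun y => dt v y t) (fun y => dt u y t) y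
            - potP L δ (fun y => dt u y t) (fun y => dt v y t) y)) + v y t ^ 2
            - dx (TTt L δ vbar ubar v u) y t * (I * I) := by
        funext y
        rw [hirotaE, uLog_neg_swap, ev, ldV, dxV, tFp, tGm]
        ring
      rw [e]
      refine (((((hasDerivAt_potM_sub_potP hL hδ pv sv zv pu su zu y).const_add _).const_mul
        (-I)).add ((hasDerivAt_dx v1 y t).pow 2)).sub
          ((hasDerivAt_dx_TTt hL hδ hp hw y t).mul_const _)).congr_deriv ?_
      have := (hsol y t).2.2.2
      push_cast
      linear_combination -this + (dt v y t - (opT L δ (fun y => dxx v y t) y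
        + opTt L δ (fun y => dxx u y t) y)) * I_sq
    exact is_const_of_deriv_eq_zero (fun y => (hd y).differentiableAt) (fun y => (hd y).deriv) x 0
  refine ⟨stripPeriodic_of_isHirotaPotential hL hδ hw hp hF,
    stripPeriodic_of_isHirotaPotential hL hδ hp hw hG', rF, rG, fun x t => ⟨?_, ?_⟩,
    fun t => ⟨fun x => ?_, fun x => ?_⟩,
    fun t => hirotaE ubar (bdryMinus δ F) (bdryPlus δ G) 0 t,
    fun t => hirotaE (-vbar) (bdryPlus δ F) (bdryMinus δ G) 0 t,
    fun x t => (c1 x t).symm.trans (eE1 x t), fun x t => (c2 x t).symm.trans (eE2 x t), ?_⟩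
  · rw [uOfFG_eq (fun x t => (nF x t).1) (fun x t => (nG x t).2) xFm xGp, eu]
  · rw [vOfFG_eq (fun x t => (nF x t).2) (fun x t => (nG x t).1) xFp xGm, ev]
  · simp only [uPlus_sub_uMinus]
    exact (dU x t).const_mul _
  · simp only [vPlus_sub_vMinus]
    exact (dV x t).const_mul _
  · rw [hirotaSystem_iff]
    refine ⟨fun x t => ?_, fun x t => ?_⟩
    · rw [hirotaForm_eq (rF.1 t).2 (rG.1 t).1 (nF x t).1 (nG x t).2, c1 x t, sub_self, mul_zero]
    · rw [hirotaForm_eq (rF.1 t).1 (rG.1 t).2 (nF x t).2 (nG x t).1, c2 x t, sub_self, mul_zero]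

end Solution

end

end NcILW

/-! ### Assembly of (A) and (B) -/

theorem mainTheorem2 (L δ : ℝ) (hL : 0 < L) (hδ : 0 < δ) :
    -- (A)
    (∀ F G : ℂ → ℝ → ℂ,
      NcILW.StripPeriodic L δ F → NcILW.StripPeriodic L δ G →
      (∀ t, NcILW.HasAnalyticLog δ (fun z => F z t)) →
      (∀ t, NcILW.HasAnalyticLog δ (fun z => G z t)) →
      NcILW.BdryContDiff δ 4 F → NcILW.BdryContDiff δ 4 G →
      ∀ ubar vbar : ℂ,
        (∃ lam1 lam2 : ℝ → ℂ, NcILW.HirotaSystem δ ubar vbar lam1 lam2 F G) ↔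
          NcILW.SolvesNcILW L δ (NcILW.uOfFG δ ubar F G) (NcILW.vOfFG δ vbar F G)) ∧
    -- (B)
    (∀ u v : ℝ → ℝ → ℂ,
      ContDiff ℝ 3 (fun p : ℝ × ℝ => u p.1 p.2) → ContDiff ℝ 3 (fun p : ℝ × ℝ => v p.1 p.2) →
      (∀ t, Function.Periodic (fun x => u x t) L) → (∀ t, Function.Periodic (fun x => v x t) L) →
      NcILW.SolvesNcILW L δ u v →
      ∀ ubar vbar : ℂ,
        NcILW.mean L (fun x => u x 0) = ubar → NcILW.mean L (fun x => v x 0) = vbar →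
        -- the means are constant in time
        (∀ t, NcILW.mean L (fun x => u x t) = ubar ∧ NcILW.mean L (fun x => v x t) = vbar) ∧
        -- existence of `F` and `G`, with arbitrary normalizations at `z = 0`
        (∀ c d : ℝ → ℂ, (∀ t, c t ≠ 0) → (∀ t, d t ≠ 0) →
          ∃ F G : ℂ → ℝ → ℂ,
            NcILW.IsHirotaPotential L δ (fun y s =>
              NcILW.uPlus L δ ubar vbar u v y s + NcILW.vPlus L δ ubar vbar u v y s) F ∧
            NcILW.IsHirotaPotential L δ (fun y s =>
              NcILW.uMinus L δ ubar vbar u v y s + NcILW.vMinus L δ ubar vbar u v y s) G ∧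
            (∀ t, F 0 t = c t) ∧ (∀ t, G 0 t = d t)) ∧
        -- uniqueness of `F` and of `G` up to a factor that depends on `t` only
        (∀ F₁ F₂ : ℂ → ℝ → ℂ,
          NcILW.IsHirotaPotential L δ (fun y s =>
            NcILW.uPlus L δ ubar vbar u v y s + NcILW.vPlus L δ ubar vbar u v y s) F₁ →
          NcILW.IsHirotaPotential L δ (fun y s =>
            NcILW.uPlus L δ ubar vbar u v y s + NcILW.vPlus L δ ubar vbar u v y s) F₂ →
          ∃ c : ℝ → ℂ, ∀ t, c t ≠ 0 ∧ ∀ z ∈ NcILW.closedStrip δ, F₂ z t = c t * F₁ z t) ∧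
        (∀ G₁ G₂ : ℂ → ℝ → ℂ,
          NcILW.IsHirotaPotential L δ (fun y s =>
            NcILW.uMinus L δ ubar vbar u v y s + NcILW.vMinus L δ ubar vbar u v y s) G₁ →
          NcILW.IsHirotaPotential L δ (fun y s =>
            NcILW.uMinus L δ ubar vbar u v y s + NcILW.vMinus L δ ubar vbar u v y s) G₂ →
          ∃ d : ℝ → ℂ, ∀ t, d t ≠ 0 ∧ ∀ z ∈ NcILW.closedStrip δ, G₂ z t = d t * G₁ z t) ∧
        -- every such pair, with normalizations differentiable in `t`, solves the bilinear system
        (∀ F G : ℂ → ℝ → ℂ,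
          NcILW.IsHirotaPotential L δ (fun y s =>
            NcILW.uPlus L δ ubar vbar u v y s + NcILW.vPlus L δ ubar vbar u v y s) F →
          NcILW.IsHirotaPotential L δ (fun y s =>
            NcILW.uMinus L δ ubar vbar u v y s + NcILW.vMinus L δ ubar vbar u v y s) G →
          Differentiable ℝ (fun t => F 0 t) → Differentiable ℝ (fun t => G 0 t) →
          NcILW.StripPeriodic L δ F ∧ NcILW.StripPeriodic L δ G ∧
          NcILW.BdryRegular δ F ∧ NcILW.BdryRegular δ G ∧
          (∀ x t, u x t = NcILW.uOfFG δ ubar F G x t ∧ v x t = NcILW.vOfFG δ vbar F G x t) ∧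
          (∀ t, Differentiable ℝ (fun x =>
              NcILW.uPlus L δ ubar vbar u v x t - NcILW.uMinus L δ ubar vbar u v x t) ∧
            Differentiable ℝ (fun x =>
              NcILW.vPlus L δ ubar vbar u v x t - NcILW.vMinus L δ ubar vbar u v x t)) ∧
          ∃ lam1 lam2 : ℝ → ℂ,
            (∀ x t, lam1 t =
              Complex.I * logDeriv (fun s : ℝ =>
                NcILW.bdryMinus δ F x s / NcILW.bdryPlus δ G x s) t + u x t ^ 2 +
              Complex.I * NcILW.dx (fun y s =>
                NcILW.uPlus L δ ubar vbar u v y s - NcILW.uMinus L δ ubar vbar u v y s) x t) ∧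
            (∀ x t, lam2 t =
              Complex.I * logDeriv (fun s : ℝ =>
                NcILW.bdryPlus δ F x s / NcILW.bdryMinus δ G x s) t + v x t ^ 2 -
              Complex.I * NcILW.dx (fun y s =>
                NcILW.vPlus L δ ubar vbar u v y s - NcILW.vMinus L δ ubar vbar u v y s) x t) ∧
            NcILW.HirotaSystem δ ubar vbar lam1 lam2 F G)) := by
  refine ⟨fun F G hFp hGp hFl hGl hF hG ubar vbar =>
    NcILW.hirota_iff_solvesNcILW hL hδ hFp hGp hFl hGl hF hG ubar vbar, ?_⟩
  intro u v hu hv hup hvp hsol ubar vbar hmu hmv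
  have mu : ∀ t, NcILW.mean L (fun x => u x t) = ubar := fun t =>
    (NcILW.mean_const hL hδ hu hv hup hvp (-1)
      (fun x t => by linear_combination (hsol x t).2.2.1) t).trans hmu
  have mv : ∀ t, NcILW.mean L (fun x => v x t) = vbar := fun t =>
    (NcILW.mean_const hL hδ hv hu hvp hup 1
      (fun x t => by linear_combination (hsol x t).2.2.2) t).trans hmv
  have hw := NcILW.MeanZero.of_mean hL hu hup mu
  have hp := NcILW.MeanZero.of_mean hL hv hvp mv
  refine ⟨fun t => ⟨mu t, mv t⟩, fun c d hc hd => ?_,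
    fun F₁ F₂ h₁ h₂ => NcILW.isHirotaPotential_unique hδ h₁ h₂,
    fun G₁ G₂ h₁ h₂ => NcILW.isHirotaPotential_unique hδ h₁ h₂,
    fun F G hF hG hF0 hG0 => NcILW.hirota_of_solution hL hδ hw hp hsol hF hG hF0 hG0⟩
  obtain ⟨F, hF, hF0⟩ :=
    NcILW.exists_isHirotaPotential hL hδ (NcILW.admissible_source hL hδ hw hp) c hc
  -- `G` is constructed from the data with `u` and `v` exchanged.
  obtain ⟨G, hG, hG0⟩ :=
    NcILW.exists_isHirotaPotential hL hδ (NcILW.admissible_source hL hδ hp hw) d hd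
  refine ⟨F, G, hF, ?_, hF0, hG0⟩
  have e : (fun y s => NcILW.uMinus L δ ubar vbar u v y s + NcILW.vMinus L δ ubar vbar u v y s)
      = fun y s => NcILW.uPlus L δ vbar ubar v u y s + NcILW.vPlus L δ vbar ubar v u y s := by
    funext y s
    exact add_comm _ _
  rw [e]
  exact hG
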